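/- Let $M$ be a smooth manifold (Hausdorff, second countable, of dimension $n\ge 1$) with non-empty boundary $\partial M$, and let $I=[0,1]$. Let ${\rm Diff}(M,{\rm rel}\,\partial)$ be the group of diffeomorphisms of $M$ which restrict to the identity on $\partial M$. Two such diffeomorphisms $f_0,f_1$ are pseudo-isotopic rel boundary if there is a diffeomorphism $\Phi$ of $M\times I$ with $\Phi(x,0)=(f_0(x),0)$, $\Phi(x,1)=(f_1(x),1)$ for $x\in M$ and $\Phi(x,t)=(x,t)$ for $x\in\partial M$, $t\in I$; the group of classes is the relative mapping class group $\tilde\pi_0{\rm Diff}(M,{\rm rel}\,\partial)$. For a manifold $N$ without boundary, $\tilde\pi_0{\rm Diff}(N)$ is the group of pseudo-isotopy classes of all diffeomorphisms of $N$, defined in the same way without boundary condition. Let ${\cal D}M=\partial(M\times I)$ be the double of $M$, the union of $M=M\times\{0\}$ and $M_+=(\partial M\times I)\cup(M\times\{1\})$, with a smooth structure for which it is the union of two smooth copies of $M$ glued along $\partial M$: the inclusion $M\times\{0\}\to{\cal D}M$ is a smooth embedding, and there is a smooth embedding $M\to{\cal D}M$ with image $M_+$ which agrees with this inclusion on $\partial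 M$. For $\varphi\in{\rm Diff}(M,{\rm rel}\,\partial)$ let $\tilde\varphi:{\cal D}M\to{\cal D}M$ be $\varphi$ on $M$ and the identity on $M_+$. Then every class in $\tilde\pi_0{\rm Diff}(M,{\rm rel}\,\partial)$ contains some $\varphi$ for which $\tilde\varphi$ is a diffeomorphism of ${\cal D}M$, and there is a homomorphism $$\omega:\tilde\pi_0{\rm Diff}(M,{\rm rel}\,\partial)\to\tilde\pi_0{\rm Diff}({\cal D}M)$$ with $\omega([\varphi])=[\tilde\varphi]$ whenever $\tilde\varphi$ is a diffeomorphism. This (unique) homomorphism $\omega$ is injective. -/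

import Mathlib

open scoped Manifold ContDiff

/-! ### Diffeomorphisms fixing a set, and pseudo-isotopy relative to that set -/

section PseudoIsotopy

/-- `DiffRel J A` is the group of smooth diffeomorphisms of the manifold `N` (modelled on `J`, with
or without boundary) which fix every point of the set `A`. -/
def DiffRel {E : Type*} [NormedAddCommGroup E] [NormedSpace ℝ E] {H : Type*} [TopologicalSpace H]
    (J : ModelWithCorners ℝ E H) {N : Type*} [TopologicalSpace N] [ChartedSpace H N]
    (A : Set N) : Type _ :=
  {f : N ≃ₘ^∞⟮J, J⟯ N // ∀ x ∈ A, f x = x}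

variable {E : Type*} [NormedAddCommGroup E] [NormedSpace ℝ E] {H : Type*} [TopologicalSpace H]
  {J : ModelWithCorners ℝ E H} {N : Type*} [TopologicalSpace N] [ChartedSpace H N] {A : Set N}

namespace DiffRel

noncomputable instance : CoeFun (DiffRel J A) (fun _ => N → N) := ⟨fun f => f.1⟩

@[ext]
theorem ext {f g : DiffRel J A} (h : ∀ x, f x = g x) : f = g :=
  Subtype.ext (Diffeomorph.ext h)

/-- The group law is composition: `(f * g) x = f (g x)`. -/
noncomputable instance : Group (DiffRel J A) where
  mul f g := ⟨g.1.trans f.1, fun x hx => by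
    change f.1 (g.1 x) = x
    rw [g.2 x hx, f.2 x hx]⟩
  one := ⟨Diffeomorph.refl J N ∞, fun _ _ => rfl⟩
  inv f := ⟨f.1.symm, fun x hx => by
    conv_lhs => rw [← f.2 x hx]
    exact f.1.symm_apply_apply x⟩
  mul_assoc _ _ _ := rfl
  one_mul _ := rfl
  mul_one _ := rfl
  inv_mul_cancel f := ext fun x => f.1.symm_apply_apply x

@[simp] theorem mul_apply (f g : DiffRel J A) (x : N) : (f * g) x = f (g x) := rfl

@[simp] theorem one_apply (x : N) : (1 : DiffRel J A) x = x := rfl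

end DiffRel

/-- `f₀` and `f₁` are pseudo-isotopic rel `A`: there is a diffeomorphism `Φ` of `N × [0,1]` with
`Φ|_{N × 0} = f₀`, `Φ|_{N × 1} = f₁` and `Φ|_{A × [0,1]} = id`. -/
def PseudoIsotopic (f₀ f₁ : DiffRel J A) : Prop :=
  ∃ Φ : (N × unitInterval) ≃ₘ^∞⟮J.prod (𝓡∂ 1), J.prod (𝓡∂ 1)⟯ (N × unitInterval),
    (∀ x, Φ (x, 0) = (f₀ x, 0)) ∧ (∀ x, Φ (x, 1) = (f₁ x, 1)) ∧
      ∀ x ∈ A, ∀ t, Φ (x, t) = (x, t)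

theorem PseudoIsotopic.refl (f : DiffRel J A) : PseudoIsotopic f f :=
  ⟨f.1.prodCongr (Diffeomorph.refl (𝓡∂ 1) unitInterval ∞), fun _ => rfl, fun _ => rfl,
    fun x hx _ => Prod.ext (f.2 x hx) rfl⟩

theorem PseudoIsotopic.mul {f₀ f₁ g₀ g₁ : DiffRel J A} (hf : PseudoIsotopic f₀ f₁)
    (hg : PseudoIsotopic g₀ g₁) : PseudoIsotopic (f₀ * g₀) (f₁ * g₁) := by
  obtain ⟨Φ, h0, h1, hA⟩ := hf
  obtain ⟨Ψ, k0, k1, kA⟩ := hg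
  refine ⟨Ψ.trans Φ, fun x => ?_, fun x => ?_, fun x hx t => ?_⟩
  · simp [k0, h0]
  · simp [k1, h1]
  · simp [kA x hx, hA x hx]

theorem PseudoIsotopic.inv {f₀ f₁ : DiffRel J A} (hf : PseudoIsotopic f₀ f₁) :
    PseudoIsotopic f₀⁻¹ f₁⁻¹ := by
  obtain ⟨Φ, h0, h1, hA⟩ := hf
  have key : ∀ p q, Φ q = p → Φ.symm p = q := fun p q h => by
    rw [← h]; exact Φ.symm_apply_apply q
  refine ⟨Φ.symm, fun x => key _ _ ?_, fun x => key _ _ ?_, fun x hx t => key _ _ (hA x hx t)⟩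
  · rw [h0, ← DiffRel.mul_apply, mul_inv_cancel, DiffRel.one_apply]
  · rw [h1, ← DiffRel.mul_apply, mul_inv_cancel, DiffRel.one_apply]

theorem PseudoIsotopic.symm {f₀ f₁ : DiffRel J A} (hf : PseudoIsotopic f₀ f₁) :
    PseudoIsotopic f₁ f₀ := by
  simpa using ((PseudoIsotopic.refl f₁).mul hf.inv).mul (PseudoIsotopic.refl f₀)

theorem PseudoIsotopic.trans {f₀ f₁ f₂ : DiffRel J A} (h : PseudoIsotopic f₀ f₁)
    (k : PseudoIsotopic f₁ f₂) : PseudoIsotopic f₀ f₂ := by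
  simpa using (k.mul (PseudoIsotopic.refl f₁⁻¹)).mul h

/-- Pseudo-isotopy rel `A` as a congruence on the group of diffeomorphisms fixing `A`. -/
def pseudoIsotopyCon {E : Type*} [NormedAddCommGroup E] [NormedSpace ℝ E] {H : Type*}
    [TopologicalSpace H] (J : ModelWithCorners ℝ E H) {N : Type*} [TopologicalSpace N]
    [ChartedSpace H N] (A : Set N) : Con (DiffRel J A) where
  r := PseudoIsotopic
  iseqv := ⟨PseudoIsotopic.refl, PseudoIsotopic.symm, PseudoIsotopic.trans⟩
  mul' := PseudoIsotopic.mul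

end PseudoIsotopy

/-! ### The two mapping class groups -/

/-- `Diff(M, rel ∂)`: the diffeomorphisms of `M` which restrict to the identity on `∂M`. -/
abbrev DiffRelBoundary (n : ℕ) [NeZero n] (M : Type*) [TopologicalSpace M]
    [ChartedSpace (EuclideanHalfSpace n) M] : Type _ :=
  DiffRel (𝓡∂ n) ((𝓡∂ n).boundary M)

/-- The relative mapping class group of `M`: `Diff(M, rel ∂)` modulo pseudo-isotopy rel `∂M`. -/
abbrev RelMappingClassGroup (n : ℕ) [NeZero n] (M : Type*) [TopologicalSpace M]
    [ChartedSpace (EuclideanHalfSpace n) M] : Type _ :=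
  (pseudoIsotopyCon (𝓡∂ n) ((𝓡∂ n).boundary M)).Quotient

/-- `Diff(N)`: all diffeomorphisms of the manifold without boundary `N`. -/
abbrev DiffAll (n : ℕ) (N : Type*) [TopologicalSpace N]
    [ChartedSpace (EuclideanSpace ℝ (Fin n)) N] : Type _ :=
  DiffRel (𝓡 n) (∅ : Set N)

/-- The (pseudo-isotopy) mapping class group of the manifold without boundary `N`:
`Diff(N)` modulo pseudo-isotopy. -/
abbrev MappingClassGroup (n : ℕ) (N : Type*) [TopologicalSpace N]
    [ChartedSpace (EuclideanSpace ℝ (Fin n)) N] : Type _ :=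
  (pseudoIsotopyCon (𝓡 n) (∅ : Set N)).Quotient

/-- The class in the relative mapping class group of a diffeomorphism of `M` rel `∂M`. -/
noncomputable def relClass {n : ℕ} [NeZero n] {M : Type*} [TopologicalSpace M]
    [ChartedSpace (EuclideanHalfSpace n) M] (φ : DiffRelBoundary n M) :
    RelMappingClassGroup n M :=
  (pseudoIsotopyCon (𝓡∂ n) ((𝓡∂ n).boundary M)).mk' φ

/-- The class in the mapping class group of a diffeomorphism of `N`. -/
noncomputable def diffClass {n : ℕ} {N : Type*} [TopologicalSpace N]
    [ChartedSpace (EuclideanSpace ℝ (Fin n)) N] (F : DiffAll n N) : MappingClassGroup n N :=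
  (pseudoIsotopyCon (𝓡 n) (∅ : Set N)).mk' F

/-! ### The double `DM = ∂(M × I)` -/

section Double

/-- The double of `M`: the boundary `∂(M × I)` of `M × [0,1]`, as a topological space. -/
abbrev Double (n : ℕ) [NeZero n] (M : Type*) [TopologicalSpace M]
    [ChartedSpace (EuclideanHalfSpace n) M] : Type _ :=
  ↥(((𝓡∂ n).prod (𝓡∂ 1)).boundary (M × unitInterval))

variable {n : ℕ} [NeZero n] {M : Type*} [TopologicalSpace M]
  [ChartedSpace (EuclideanHalfSpace n) M]

theorem mem_boundary_prod_unitInterval {p : M × unitInterval} :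
    p ∈ ((𝓡∂ n).prod (𝓡∂ 1)).boundary (M × unitInterval) ↔
      p.1 ∈ (𝓡∂ n).boundary M ∨ p.2 = 0 ∨ p.2 = 1 := by
  have h : (𝓡∂ 1).boundary unitInterval = {0, 1} := boundary_Icc
  rw [ModelWithCorners.boundary_prod, h]
  change ((p.1 ∈ Set.univ ∧ p.2 ∈ ({0, 1} : Set unitInterval)) ∨
    (p.1 ∈ (𝓡∂ n).boundary M ∧ p.2 ∈ Set.univ)) ↔ _
  simp only [Set.mem_univ, true_and, and_true, Set.mem_insert_iff, Set.mem_singleton_iff]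
  exact or_comm

/-- The first copy `M = M × 0` of `M` in the double. -/
def Double.bottom (n : ℕ) [NeZero n] {M : Type*} [TopologicalSpace M]
    [ChartedSpace (EuclideanHalfSpace n) M] (x : M) : Double n M :=
  ⟨(x, 0), mem_boundary_prod_unitInterval.2 (Or.inr (Or.inl rfl))⟩

/-- The second half `M₊ = (∂M × I) ∪ (M × 1)` of the double. -/
def Double.upper (n : ℕ) [NeZero n] (M : Type*) [TopologicalSpace M]
    [ChartedSpace (EuclideanHalfSpace n) M] : Set (Double n M) :=
  {p | p.1.1 ∈ (𝓡∂ n).boundary M ∨ p.1.2 = 1}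

/-- The smooth structure on `DM = ∂(M × I)` at hand is a smooth structure of the double: it makes
`DM` the union of two smooth copies of `M` glued along `∂M`. That is, the inclusion of `M = M × 0`
is a smooth embedding, and there is a smooth embedding of `M` with image `M₊` which agrees on `∂M`
with that inclusion. (Straightening the corners of `M × I` gives such a structure, and it is unique
up to diffeomorphism.) -/
structure IsDoubleSmoothStructure (n : ℕ) [NeZero n] (M : Type*) [TopologicalSpace M]
    [ChartedSpace (EuclideanHalfSpace n) M]
    [ChartedSpace (EuclideanSpace ℝ (Fin n)) (Double n M)] : Prop where
  isManifold : IsManifold (𝓡 n) ∞ (Double n M)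
  bottom : Manifold.IsSmoothEmbedding (𝓡∂ n) (𝓡 n) ∞ (Double.bottom n : M → Double n M)
  upper : ∃ j : M → Double n M, Manifold.IsSmoothEmbedding (𝓡∂ n) (𝓡 n) ∞ j ∧
    Set.range j = Double.upper n M ∧ ∀ x ∈ (𝓡∂ n).boundary M, j x = Double.bottom n x

/-- `F` is the extension of `φ` by the identity: `F = φ` on `M = M × 0` and `F = id` on `M₊`. -/
def IsExtensionById [ChartedSpace (EuclideanSpace ℝ (Fin n)) (Double n M)]
    (φ : DiffRelBoundary n M) (F : DiffAll n (Double n M)) : Prop :=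
  (∀ x : M, F (Double.bottom n x) = Double.bottom n (φ x)) ∧ ∀ p ∈ Double.upper n M, F p = p

end Double

/-!
# Extending diffeomorphisms to the double

Let `N` be the double of `M`, let `b : M → N` be the inclusion of the first copy, `j` that of the
second one, and let `F = φ ∪ id` denote the extension of a diffeomorphism `φ` of `M` rel boundary by
the identity of `j(M)`; it may fail to be smooth along the common boundary. The proof has three
ingredients, and works with pseudo-isotopies only: there is no isotopy extension theorem in it.

*Germs.* A local diffeomorphism of a manifold `W` which fixes the base of a collar agrees near the
base with a global diffeomorphism supported close to the base, also with parameters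
(`Collar.exists_diffeomorph_of_germ`). Applied to `φ⁻¹`, with the time as parameter, it shows that
`φ` is pseudo-isotopic to a diffeomorphism which is the identity near the boundary
(`Collar.exists_isIdNear`), and such a diffeomorphism has a smooth extension. Applied to the inverse
of a pseudo-isotopy between two diffeomorphisms that are the identity near the boundary, it makes
the pseudo-isotopy itself the identity near the boundary, so that it extends to `N × [0, 1]`
(`MirrorDouble.pseudoIsotopic_extension`). The theorem on germs is proved without flows: a
diffeomorphism along the lines of the collar is the solution of an implicit equation in one real
unknown (`Collar.exists_diffeomorph_fiberwise`); two of these make the germ preserve the level, and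
a level-preserving germ is cut off by reading it on a smaller level
(`Collar.LevelPreserving.exists_diffeomorph`).

*Pushing.* For an arbitrary `φ` with a smooth extension `F`, push `N` along a bicollar of the common
boundary, so that a neighbourhood of the boundary in `b(M)` is covered by points of `j(M)`.
Conjugating `F` by the push gives pseudo-isotopies, of `φ` and of `F`, to a diffeomorphism which is
the identity near the boundary and to its extension (`MirrorDouble.exists_isExtension_isIdNear`).
With the above, the class of `F` depends only on the class of `φ`, so that `ω` is defined, and it
is a homomorphism because extensions compose.

*Bending.* For injectivity let `Φ` be a pseudo-isotopy on `N × [0, 1]` from `F` to the identity,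
with `φ` the identity near the boundary. Again by germs, `Φ` can be made a product near both ends.
Now `N × [0, 1]` without its top and without `j(M) × 0` embeds into `M × [0, 1]`: the two halves
`b(M) × 0` and `j(M) × 0` of the bottom become the two faces of a wedge with its edge at the
boundary of `M`, the first of them being `M × 0`. The embedding is explicit, in polar coordinates
around the edge (`MirrorDouble.bend`). The diffeomorphism `Φ` is supported away from the removed part, so it can be
transported to `M × [0, 1]`, where it is a pseudo-isotopy from `φ` to the identity
(`MirrorDouble.pseudoIsotopic_one_of_extension`).

The bend map needs a bicollar in which the two copies of `M` are mirror images of each other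
(`MirrorDouble`). The bicollar comes from the smooth embeddings of the two copies
(`Manifold.IsSmoothEmbedding.isSmoothDomain`, `IsSmoothDomain.exists_bicollar`); the second
embedding is then changed by a diffeomorphism of `M`, which is possible by the theorem on germs
(`exists_mirrorDouble`).
-/

open Set Filter Topology

/-! ### Implicit functions of one real variable on domains with unique derivatives -/

section Implicit

variable {E : Type*} [NormedAddCommGroup E] [NormedSpace ℝ E]

/-- The derivative of a slice `l ↦ R (y, l)` is the value of the total derivative at `(0, 1)`. -/
theorem derivWithin_slice {R : E × ℝ → ℝ} {T : Set (E × ℝ)} {L : Set ℝ} {y : E} {l : ℝ}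
    (h : DifferentiableWithinAt ℝ R T (y, l)) (hT : ∀ᶠ l' in 𝓝[L] l, (y, l') ∈ T) :
    HasDerivWithinAt (fun l' => R (y, l')) (fderivWithin ℝ R T (y, l) (0, 1)) L l := by
  have hmk : HasDerivWithinAt (fun l' : ℝ => (y, l')) ((0 : E), (1 : ℝ)) {l' ∈ L | (y, l') ∈ T} l :=
    ((hasDerivAt_const l y).prodMk (hasDerivAt_id l)).hasDerivWithinAt
  have h1 := h.hasFDerivWithinAt.comp_hasDerivWithinAt l hmk (fun l' hl' => hl'.2)
  refine h1.mono_of_mem_nhdsWithin ?_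
  filter_upwards [hT, self_mem_nhdsWithin] with l' h1 h2 using ⟨h2, h1⟩

/-- **Implicit functions, one real unknown.** A continuous solution `v` of `R (x, v x) = c x` is
smooth if `R` and `c` are and the derivative of `R` in the unknown does not vanish. Nothing is
assumed to be open, so that boundary points and corners are covered. -/
theorem contDiffOn_of_implicit {S : Set E} {L : Set ℝ} (hS : UniqueDiffOn ℝ S)
    (hL : UniqueDiffOn ℝ L) {R : E × ℝ → ℝ} (hR : ContDiffOn ℝ ∞ R (S ×ˢ L)) {c v : E → ℝ}
    (hc : ContDiffOn ℝ ∞ c S) (hv : ContinuousOn v S) (hvL : MapsTo v S L)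
    (hd : ∀ x ∈ S, derivWithin (fun l => R (x, l)) L (v x) ≠ 0) (heq : ∀ x ∈ S, R (x, v x) = c x) :
    ContDiffOn ℝ ∞ v S := by
  have hSL : UniqueDiffOn ℝ (S ×ˢ L) := hS.prod hL
  set A : E → (E × ℝ →L[ℝ] ℝ) := fun x => fderivWithin ℝ R (S ×ˢ L) (x, v x) with hA
  set v' : E → (E →L[ℝ] ℝ) := fun x =>
    (A x (0, 1))⁻¹ • (fderivWithin ℝ c S x - (A x).comp (ContinuousLinearMap.inl ℝ E ℝ)) with hv'
  have hdiff : ∀ x ∈ S, DifferentiableWithinAt ℝ R (S ×ˢ L) (x, v x) := fun x hx =>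
    (hR.differentiableOn (by simp)) _ ⟨hx, hvL hx⟩
  have hne : ∀ x ∈ S, A x (0, 1) ≠ 0 := by
    intro x hx
    have h1 : HasDerivWithinAt (fun l => R (x, l)) (A x (0, 1)) L (v x) :=
      derivWithin_slice (hdiff x hx) (by
        filter_upwards [self_mem_nhdsWithin] with l hl using ⟨hx, hl⟩)
    rw [← h1.derivWithin (hL _ (hvL hx))]
    exact hd x hx
  have hder : ∀ x ∈ S, HasFDerivWithinAt v (v' x) S x := by
    intro x hx
    have hf : HasFDerivWithinAt (fun q : E × ℝ => (q.1, R q))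
        ((ContinuousLinearMap.fst ℝ E ℝ).prod (A x)) (S ×ˢ L) (x, v x) :=
      hasFDerivWithinAt_fst.prodMk (hdiff x hx).hasFDerivWithinAt
    have hh : HasFDerivWithinAt (fun y : E => (y, c y))
        ((ContinuousLinearMap.id ℝ E).prod (fderivWithin ℝ c S x)) S x :=
      (hasFDerivWithinAt_id _ _).prodMk
        ((hc.differentiableOn (by simp)) x hx).hasFDerivWithinAt
    have hst : Tendsto (fun y : E => (y, v y)) (𝓝[S] x) (𝓝[S ×ˢ L] (x, v x)) := by
      refine tendsto_nhdsWithin_iff.2 ⟨?_, ?_⟩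
      · exact (continuousWithinAt_id.prodMk (hv x hx)).tendsto
      · filter_upwards [self_mem_nhdsWithin] with y hy using ⟨hy, hvL hy⟩
    -- the graph of `v` is mapped to that of `c` by `(y, l) ↦ (y, R (y, l))`, whose derivative has
    -- the left inverse `g`; this gives the derivative of `v` without an open domain
    let g : E × ℝ →L[ℝ] E × ℝ := (ContinuousLinearMap.fst ℝ E ℝ).prod
      ((A x (0, 1))⁻¹ • (ContinuousLinearMap.snd ℝ E ℝ -
        ((A x).comp (ContinuousLinearMap.inl ℝ E ℝ)).comp (ContinuousLinearMap.fst ℝ E ℝ)))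
    have hleft : Function.LeftInverse g ((ContinuousLinearMap.fst ℝ E ℝ).prod (A x)) := by
      rintro ⟨p, l⟩
      have h1 : A x (p, l) = A x (p, 0) + l * A x (0, 1) := by
        have : ((p, l) : E × ℝ) = (p, 0) + l • ((0 : E), (1 : ℝ)) := by simp
        rw [this, map_add, map_smul, smul_eq_mul]
      have := hne x hx
      simp only [g, ContinuousLinearMap.prod_apply, ContinuousLinearMap.coe_fst',
        smul_apply, sub_apply,
        ContinuousLinearMap.coe_snd', ContinuousLinearMap.comp_apply,
        ContinuousLinearMap.inl_apply, h1, smul_eq_mul, Prod.mk.injEq, true_and]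
      field_simp
      ring
    have h2 := HasFDerivWithinAt.of_comp_of_leftInverse (g := fun y : E => (y, v y)) hst hf hh
      (by filter_upwards [self_mem_nhdsWithin] with y hy; simp [heq y hy]) hleft hx
    have h3 := h2.snd
    convert! h3 using 1
  -- the derivative of `v` is a smooth expression in `x` and `v x`: bootstrap
  have key : ∀ k : ℕ, ContDiffOn ℝ k v S := by
    intro k
    induction k with
    | zero => exact contDiffOn_zero.2 hv
    | succ k ih =>
      push_cast
      refine (contDiffOn_succ_iff_hasFDerivWithinAt_of_uniqueDiffOn hS).2
        ⟨by simp, v', ?_, hder⟩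
      have hfd : ContDiffOn ℝ k (fderivWithin ℝ R (S ×ˢ L)) (S ×ˢ L) :=
        (((contDiffOn_infty_iff_fderivWithin hSL).1 hR).2).of_le (by exact_mod_cast le_top)
      have hAk : ContDiffOn ℝ k A S :=
        hfd.comp (contDiffOn_id.prodMk ih) (fun x hx => ⟨hx, hvL hx⟩)
      have hck : ContDiffOn ℝ k (fderivWithin ℝ c S) S :=
        (((contDiffOn_infty_iff_fderivWithin hS).1 hc).2).of_le (by exact_mod_cast le_top)
      refine ContDiffOn.smul (ContDiffOn.inv (hAk.clm_apply contDiffOn_const) hne) ?_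
      exact hck.sub (hAk.clm_comp contDiffOn_const)
  exact contDiffOn_infty.2 key

end Implicit

section ImplicitManifold

variable {E : Type*} [NormedAddCommGroup E] [NormedSpace ℝ E] {H : Type*} [TopologicalSpace H]
  {I : ModelWithCorners ℝ E H} {W : Type*} [TopologicalSpace W] [ChartedSpace H W]
  [IsManifold I ∞ W]

theorem contMDiffOn_prod_self_iff {F : Type*} [NormedAddCommGroup F] [NormedSpace ℝ F]
    {R : E × ℝ → F} {T : Set (E × ℝ)} :
    ContMDiffOn (𝓘(ℝ, E).prod 𝓘(ℝ, ℝ)) 𝓘(ℝ, F) ∞ R T ↔ ContDiffOn ℝ ∞ R T := by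
  rw [← contMDiffOn_iff_contDiffOn, modelWithCornersSelf_prod, ← chartedSpaceSelf_prod]

/-- A function on (part of) `W × ℝ` read in a chart of `W`. -/
theorem contDiffOn_chart_prod {R : W × ℝ → ℝ} {T : Set (W × ℝ)}
    (hR : ContMDiffOn (I.prod 𝓘(ℝ, ℝ)) 𝓘(ℝ, ℝ) ∞ R T) (x₀ : W) :
    ContDiffOn ℝ ∞ (fun q : E × ℝ => R ((extChartAt I x₀).symm q.1, q.2))
      {q | q.1 ∈ (extChartAt I x₀).target ∧ ((extChartAt I x₀).symm q.1, q.2) ∈ T} := by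
  rw [← contMDiffOn_prod_self_iff]
  refine hR.comp (t := T) ?_ (fun q hq => hq.2)
  have h1 : ContMDiffOn (𝓘(ℝ, E).prod 𝓘(ℝ, ℝ)) I ∞
      (fun q : E × ℝ => (extChartAt I x₀).symm q.1)
      {q | q.1 ∈ (extChartAt I x₀).target ∧ ((extChartAt I x₀).symm q.1, q.2) ∈ T} :=
    (contMDiffOn_extChartAt_symm x₀).comp contMDiffOn_fst (fun q hq => hq.1)
  exact h1.prodMk contMDiffOn_snd

/-- The partial derivative in the real variable of a smooth function on an open part of
`W × L` is continuous. -/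
theorem continuousOn_derivWithin_snd {L : Set ℝ} (hL : UniqueDiffOn ℝ L) {R : W × ℝ → ℝ}
    {Ω : Set (W × ℝ)} (hΩ : IsOpen Ω)
    (hR : ContMDiffOn (I.prod 𝓘(ℝ, ℝ)) 𝓘(ℝ, ℝ) ∞ R (Ω ∩ univ ×ˢ L)) :
    (∀ q ∈ Ω ∩ univ ×ˢ L, DifferentiableWithinAt ℝ (fun l => R (q.1, l)) L q.2) ∧
    ContinuousOn (fun q : W × ℝ => derivWithin (fun l => R (q.1, l)) L q.2) (Ω ∩ univ ×ˢ L) := by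
  have main : ∀ x₀ : W, ∃ A : W × ℝ → ℝ, ContinuousOn A
      (Ω ∩ univ ×ˢ L ∩ {q | q.1 ∈ (extChartAt I x₀).source}) ∧
      ∀ q ∈ Ω ∩ univ ×ˢ L ∩ {q | q.1 ∈ (extChartAt I x₀).source},
        HasDerivWithinAt (fun l => R (q.1, l)) (A q) L q.2 := by
    intro x₀
    set e := extChartAt I x₀
    set R' : E × ℝ → ℝ := fun q => R (e.symm q.1, q.2)
    set T : Set (E × ℝ) := {q | q.1 ∈ e.target ∧ (e.symm q.1, q.2) ∈ Ω ∩ univ ×ˢ L} with hT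
    have hR' : ContDiffOn ℝ ∞ R' T := contDiffOn_chart_prod hR x₀
    have hcont : ContinuousOn (fun q : E × ℝ => (e.symm q.1, q.2)) (e.target ×ˢ L) :=
      ((continuousOn_extChartAt_symm x₀).comp continuousOn_fst (fun q hq => hq.1)).prodMk
        continuousOn_snd
    have hTu : UniqueDiffOn ℝ T := by
      obtain ⟨O, hO, hOe⟩ := (continuousOn_iff'.1 hcont) Ω hΩ
      have : T = (e.target ×ˢ L) ∩ O := by
        rw [inter_comm, ← hOe]
        ext q
        simp only [hT, mem_ofPred_eq, mem_inter_iff, mem_prod, mem_univ, true_and, mem_preimage]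
        tauto
      rw [this]
      exact ((uniqueDiffOn_extChartAt_target x₀).prod hL).inter hO
    refine ⟨fun q => fderivWithin ℝ R' T (e q.1, q.2) (0, 1), ?_, ?_⟩
    · have h1 : ContinuousOn (fderivWithin ℝ R' T) T :=
        hR'.continuousOn_fderivWithin hTu (by simp)
      have h2 : ContinuousOn (fun q : W × ℝ => (e q.1, q.2))
          (Ω ∩ univ ×ˢ L ∩ {q | q.1 ∈ e.source}) :=
        ((continuousOn_extChartAt x₀).comp continuousOn_fst (fun q hq => hq.2)).prodMk
          continuousOn_snd
      have h3 := h1.comp h2 (fun q hq => by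
        refine ⟨e.map_source hq.2, ?_⟩
        have : e.symm (e q.1) = q.1 := e.left_inv hq.2
        simpa [this] using hq.1)
      exact h3.clm_apply continuousOn_const
    · intro q hq
      have hs : e.symm (e q.1) = q.1 := e.left_inv hq.2
      have hqT : (e q.1, q.2) ∈ T := ⟨e.map_source hq.2, by simpa [hs] using hq.1⟩
      have h1 := derivWithin_slice (R := R') (T := T) (L := L) (y := e q.1) (l := q.2)
        ((hR'.differentiableOn (by simp)) _ hqT) (by
          have : ∀ᶠ l' in 𝓝 q.2, (q.1, l') ∈ Ω :=
            (Continuous.prodMk_right q.1).continuousAt (hΩ.mem_nhds hq.1.1)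
          filter_upwards [mem_nhdsWithin_of_mem_nhds this, self_mem_nhdsWithin] with l' h1 h2
          refine ⟨e.map_source hq.2, ?_⟩
          simpa [hs] using ⟨h1, h2⟩)
      simpa [R', hs] using h1
  refine ⟨fun q hq => ?_, fun q hq => ?_⟩
  · obtain ⟨A, -, hA⟩ := main q.1
    exact (hA q ⟨hq, mem_extChartAt_source q.1⟩).differentiableWithinAt
  · obtain ⟨A, hAc, hA⟩ := main q.1
    have hq' : q ∈ Ω ∩ univ ×ˢ L ∩ {p | p.1 ∈ (extChartAt I q.1).source} :=
      ⟨hq, mem_extChartAt_source q.1⟩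
    have h1 : ContinuousWithinAt (fun q : W × ℝ => derivWithin (fun l => R (q.1, l)) L q.2)
        (Ω ∩ univ ×ˢ L ∩ {p | p.1 ∈ (extChartAt I q.1).source}) q :=
      (hAc q hq').congr (fun p hp => (hA p hp).derivWithin (hL _ hp.1.2.2))
        ((hA q hq').derivWithin (hL _ hq.2.2))
    refine h1.mono_of_mem_nhdsWithin ?_
    refine inter_mem self_mem_nhdsWithin (mem_nhdsWithin_of_mem_nhds ?_)
    exact continuous_fst.continuousAt ((isOpen_extChartAt_source q.1).mem_nhds
      (mem_extChartAt_source q.1))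

/-- Implicit functions of one real unknown on a manifold with boundary and corners. -/
theorem contMDiffOn_of_implicit {L : Set ℝ} (hL : UniqueDiffOn ℝ L) {B : Set W} (hB : IsOpen B)
    {R : W × ℝ → ℝ} (hR : ContMDiffOn (I.prod 𝓘(ℝ, ℝ)) 𝓘(ℝ, ℝ) ∞ R (B ×ˢ L)) {c v : W → ℝ}
    (hc : ContMDiffOn I 𝓘(ℝ, ℝ) ∞ c B) (hv : ContinuousOn v B) (hvL : MapsTo v B L)
    (hd : ∀ x ∈ B, derivWithin (fun l => R (x, l)) L (v x) ≠ 0)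
    (heq : ∀ x ∈ B, R (x, v x) = c x) : ContMDiffOn I 𝓘(ℝ, ℝ) ∞ v B := by
  intro x₀ hx₀
  set e := extChartAt I x₀
  set S : Set E := e.target ∩ e.symm ⁻¹' B with hSdef
  have hS : UniqueDiffOn ℝ S := by
    obtain ⟨O, hO, hOe⟩ := (continuousOn_iff'.1 (continuousOn_extChartAt_symm (I := I) x₀)) B hB
    have : S = e.target ∩ O := by rw [hSdef, inter_comm, hOe, inter_comm]
    rw [this]
    exact (uniqueDiffOn_extChartAt_target x₀).inter hO
  have hsymm : ContMDiffOn 𝓘(ℝ, E) I ∞ e.symm S :=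
    (contMDiffOn_extChartAt_symm x₀).mono inter_subset_left
  have h1 : ContDiffOn ℝ ∞ (v ∘ e.symm) S := by
    refine contDiffOn_of_implicit (R := fun q : E × ℝ => R (e.symm q.1, q.2)) (c := c ∘ e.symm)
      hS hL ?_ ?_ ?_ (fun y hy => hvL hy.2) (fun y hy => hd _ hy.2) (fun y hy => heq _ hy.2)
    · exact (contDiffOn_chart_prod hR x₀).mono (fun q hq => ⟨hq.1.1, hq.1.2, hq.2⟩)
    · rw [← contMDiffOn_iff_contDiffOn]
      exact hc.comp hsymm (fun y hy => hy.2)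
    · exact hv.comp hsymm.continuousOn (fun y hy => hy.2)
  have h2 : ContMDiffOn I 𝓘(ℝ, ℝ) ∞ ((v ∘ e.symm) ∘ e) (e.source ∩ B) :=
    (contMDiffOn_iff_contDiffOn.2 h1).comp ((contMDiffOn_extChartAt (n := ∞)).mono
      (by simp only [e, extChartAt_source]; exact inter_subset_left))
      (fun y hy => ⟨e.map_source hy.1, by simpa [e.left_inv hy.1] using hy.2⟩)
  have h3 : ContMDiffOn I 𝓘(ℝ, ℝ) ∞ v (e.source ∩ B) :=
    h2.congr (fun y hy => by simp [e.left_inv hy.1])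
  refine (h3 x₀ ⟨mem_extChartAt_source x₀, hx₀⟩).mono_of_mem_nhdsWithin ?_
  exact inter_mem (mem_nhdsWithin_of_mem_nhds ((isOpen_extChartAt_source x₀).mem_nhds
    (mem_extChartAt_source x₀))) self_mem_nhdsWithin

end ImplicitManifold

/-! ### Gluing, restricting and transporting diffeomorphisms -/

section Transport

variable {E : Type*} [NormedAddCommGroup E] [NormedSpace ℝ E] {H : Type*} [TopologicalSpace H]
  {I : ModelWithCorners ℝ E H} {X : Type*} [TopologicalSpace X] [ChartedSpace H X]
  {E' : Type*} [NormedAddCommGroup E'] [NormedSpace ℝ E'] {H' : Type*} [TopologicalSpace H']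
  {J : ModelWithCorners ℝ E' H'} {Z : Type*} [TopologicalSpace Z] [ChartedSpace H' Z]

theorem contMDiff_of_isOpen_cover {f : X → Z} {U V : Set X} (hU : IsOpen U) (hV : IsOpen V)
    (hUV : ∀ x, x ∈ U ∨ x ∈ V) (hfU : ContMDiffOn I J ∞ f U) (hfV : ContMDiffOn I J ∞ f V) :
    ContMDiff I J ∞ f := fun x => by
  rcases hUV x with h | h
  · exact hfU.contMDiffAt (hU.mem_nhds h)
  · exact hfV.contMDiffAt (hV.mem_nhds h)

open Classical in
/-- The map of `Z` that is `c ∘ Θ ∘ c⁻¹` on the image of `c` and the identity elsewhere. -/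
theorem contMDiff_transport {c : X → Z} {e : Z → X} {U : Set X} {U' : Set Z} (hU' : IsOpen U')
    (hc : ContMDiffOn I J ∞ c U) (he : ContMDiffOn J I ∞ e U') (hcU : MapsTo c U U')
    (heU : MapsTo e U' U) (hce : ∀ z ∈ U', c (e z) = z) {Θ : X → X} (hΘ : ContMDiff I I ∞ Θ)
    (hΘU : MapsTo Θ U U) {S : Set X} (hSU : S ⊆ U) (hS : ∀ x ∉ S, Θ x = x)
    (hcl : IsClosed (c '' S)) :
    ContMDiff J J ∞ (fun z => if z ∈ U' then c (Θ (e z)) else z) := by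
  refine contMDiff_of_isOpen_cover hU' hcl.isOpen_compl (fun z => ?_) ?_ ?_
  · by_cases h : z ∈ c '' S
    · obtain ⟨x, hx, rfl⟩ := h
      exact Or.inl (hcU (hSU hx))
    · exact Or.inr h
  · have h1 : ContMDiffOn J I ∞ (fun z => Θ (e z)) U' := hΘ.comp_contMDiffOn he
    have h : ContMDiffOn J J ∞ (fun z => c (Θ (e z))) U' :=
      hc.comp h1 (fun z hz => hΘU (heU hz))
    exact h.congr (fun z hz => by simp [hz])
  · refine contMDiffOn_id.congr (fun z hz => ?_)
    by_cases h : z ∈ U'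
    · have : e z ∉ S := fun h' => hz ⟨e z, h', hce z h⟩
      simp [h, hS _ this, hce z h]
    · simp [h]

/-- A diffeomorphism supported in an open set `U` can be transported along a diffeomorphism of `U`
onto an open set of another manifold, if the image of the support stays closed there. -/
theorem exists_diffeomorph_transport {c : X → Z} {e : Z → X} {U : Set X} {U' : Set Z}
    (hU' : IsOpen U') (hc : ContMDiffOn I J ∞ c U) (he : ContMDiffOn J I ∞ e U')
    (hcU : MapsTo c U U') (heU : MapsTo e U' U) (hec : ∀ x ∈ U, e (c x) = x)
    (hce : ∀ z ∈ U', c (e z) = z) (Θ : X ≃ₘ^∞⟮I, I⟯ X) {S : Set X} (hSU : S ⊆ U)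
    (hS : ∀ x ∉ S, Θ x = x) (hcl : IsClosed (c '' S)) :
    ∃ Ψ : Z ≃ₘ^∞⟮J, J⟯ Z, (∀ x ∈ U, Ψ (c x) = c (Θ x)) ∧ ∀ z ∉ c '' S, Ψ z = z := by
  classical
  have hS' : ∀ x ∉ S, Θ.symm x = x := fun x hx =>
    (congrArg Θ.symm (hS x hx)).symm.trans (Θ.symm_apply_apply x)
  have hU1 : MapsTo Θ U U := fun x hx => by
    by_contra h
    have h1 : Θ x ∉ S := fun h' => h (hSU h')
    have h2 := hS' _ h1
    rw [Θ.symm_apply_apply] at h2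
    exact h (h2 ▸ hx)
  have hU2 : MapsTo Θ.symm U U := fun x hx => by
    by_contra h
    have h1 : Θ.symm x ∉ S := fun h' => h (hSU h')
    have h2 := hS _ h1
    rw [Θ.apply_symm_apply] at h2
    exact h (h2 ▸ hx)
  refine ⟨⟨⟨fun z => if z ∈ U' then c (Θ (e z)) else z,
    fun z => if z ∈ U' then c (Θ.symm (e z)) else z, fun z => ?_, fun z => ?_⟩,
    contMDiff_transport hU' hc he hcU heU hce Θ.contMDiff hU1 hSU hS hcl,
    contMDiff_transport hU' hc he hcU heU hce Θ.symm.contMDiff hU2 hSU hS' hcl⟩, ?_, ?_⟩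
  · by_cases h : z ∈ U'
    · simp [h, hcU (hU1 (heU h)), hec _ (hU1 (heU h)), hce z h]
    · simp [h]
  · by_cases h : z ∈ U'
    · simp [h, hcU (hU2 (heU h)), hec _ (hU2 (heU h)), hce z h]
    · simp [h]
  · intro x hx
    change (if c x ∈ U' then c (Θ (e (c x))) else c x) = _
    simp [hcU hx, hec x hx]
  · intro z hz
    change (if z ∈ U' then c (Θ (e z)) else z) = _
    by_cases h : z ∈ U'
    · have : e z ∉ S := fun h' => hz ⟨e z, h', hce z h⟩
      simp [h, hS _ this, hce z h]
    · simp [h]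

/-- The inverse of a smooth embedding is smooth on its image. -/
theorem Manifold.IsSmoothEmbedding.contMDiffOn_leftInverse {f : X → Z} [IsManifold I ∞ X]
    [IsManifold J ∞ Z]
    (hf : Manifold.IsSmoothEmbedding I J ∞ f) {g : Z → X} (hg : ∀ x, g (f x) = x) :
    ContMDiffOn J I ∞ g (range f) := by
  rintro _ ⟨x, rfl⟩
  have h := hf.isImmersion.isImmersionAt x
  have hx := h.mem_domChart_source
  have key : ∀ y ∈ h.domChart.source,
      (h.equiv.symm (h.codChart.extend J (f y))).1 = h.domChart.extend I y := by
    intro y hy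
    have hy' : y ∈ (h.domChart.extend I).source := by simpa using hy
    have := h.writtenInCharts ((h.domChart.extend I).map_source hy')
    simp only [Function.comp_apply, (h.domChart.extend I).left_inv hy'] at this
    rw [this]
    simp
  have hF : ContMDiffOn J I ∞ (fun z => (h.domChart.extend I).symm
      (h.equiv.symm ((h.codChart.extend J) z)).1) (h.codChart.source ∩ f '' h.domChart.source) := by
    have h1 : ContMDiffOn J 𝓘(ℝ, E') ∞ (h.codChart.extend J) h.codChart.source :=
      J.contMDiff.comp_contMDiffOn
        (contMDiffOn_of_mem_maximalAtlas h.codChart_mem_maximalAtlas)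
    have h2 : ContMDiff 𝓘(ℝ, E') 𝓘(ℝ, E) ∞ (fun z => (h.equiv.symm z).1) :=
      ContDiff.contMDiff (by fun_prop)
    have h3 : ContMDiffOn J 𝓘(ℝ, E) ∞ (fun z => (h.equiv.symm ((h.codChart.extend J) z)).1)
      h.codChart.source := h2.comp_contMDiffOn h1
    refine (contMDiffOn_extend_symm h.domChart_mem_maximalAtlas).comp
      (h3.mono inter_subset_left) ?_
    rintro _ ⟨-, y, hy, rfl⟩
    have hw := key y hy
    simp only [mem_preimage, hw]
    exact ⟨h.domChart y, h.domChart.map_source hy, rfl⟩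
  have hF2 : ContMDiffOn J I ∞ g (h.codChart.source ∩ f '' h.domChart.source) := by
    refine hF.congr ?_
    rintro _ ⟨-, y, hy, rfl⟩
    rw [key y hy, (h.domChart.extend I).left_inv (by simpa using hy), hg]
  refine (hF2 (f x) ⟨h.source_subset_preimage_source hx, mem_image_of_mem f hx⟩).mono_of_mem_nhdsWithin
    ?_
  rw [← hf.isEmbedding.map_nhds_eq]
  refine mem_map.2 ?_
  filter_upwards [h.domChart.open_source.mem_nhds hx] with y hy
  exact ⟨h.source_subset_preimage_source hy, mem_image_of_mem f hy⟩

end Transport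

/-! ### Collars and their fibrewise diffeomorphisms -/

/-- A collar (for `L = [0, 1)`) or a bicollar (for `L = (-1, 1)`) in the manifold `W`: an open set
`dom` which is smoothly fibred by lines, each a copy of `L`. Here `lev x` is the position of `x` on
its line, and `mov x l` is the point of the line through `x` at position `l`. The last field says
that the parts `|lev| ≤ c` are closed in all of `W`; so functions and maps that are standard for
`|lev| > c` extend from `dom` to `W`. -/
structure Collar {E : Type*} [NormedAddCommGroup E] [NormedSpace ℝ E] {H : Type*}
    [TopologicalSpace H] (I : ModelWithCorners ℝ E H) (W : Type*) [TopologicalSpace W]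
    [ChartedSpace H W] (L : Set ℝ) where
  /-- The collar neighbourhood. -/
  dom : Set W
  /-- The position of a point on its line. -/
  lev : W → ℝ
  /-- The point at a given position on the line through a given point. -/
  mov : W → ℝ → W
  isOpen_dom : IsOpen dom
  lev_mem : ∀ x ∈ dom, lev x ∈ L
  mov_mem : ∀ x ∈ dom, ∀ l ∈ L, mov x l ∈ dom
  lev_mov : ∀ x ∈ dom, ∀ l ∈ L, lev (mov x l) = l
  mov_lev : ∀ x ∈ dom, mov x (lev x) = x
  mov_mov : ∀ x ∈ dom, ∀ l ∈ L, ∀ l' ∈ L, mov (mov x l) l' = mov x l'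
  smooth_lev : ContMDiffOn I 𝓘(ℝ, ℝ) ∞ lev dom
  smooth_mov : ContMDiffOn (I.prod 𝓘(ℝ, ℝ)) I ∞ (fun q : W × ℝ => mov q.1 q.2) (dom ×ˢ L)
  closed : ∀ c < 1, IsClosed {x | x ∈ dom ∧ |lev x| ≤ c}

namespace Collar

variable {E : Type*} [NormedAddCommGroup E] [NormedSpace ℝ E] {H : Type*} [TopologicalSpace H]
  {I : ModelWithCorners ℝ E H} {W : Type*} [TopologicalSpace W] [ChartedSpace H W]
  {L : Set ℝ} (K : Collar I W L)

theorem contMDiff_mov_const {x : W} (hx : x ∈ K.dom) :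
    ContMDiffOn 𝓘(ℝ, ℝ) I ∞ (K.mov x) L :=
  K.smooth_mov.comp (contMDiff_const.prodMk contMDiff_id).contMDiffOn (fun _ hl => ⟨hx, hl⟩)

theorem contMDiffOn_mov {X : Type*} [TopologicalSpace X] {E' : Type*} [NormedAddCommGroup E']
    [NormedSpace ℝ E'] {H' : Type*} [TopologicalSpace H'] {J : ModelWithCorners ℝ E' H'}
    [ChartedSpace H' X] {f : X → W} {m : X → ℝ} {s : Set X} (hf : ContMDiffOn J I ∞ f s)
    (hm : ContMDiffOn J 𝓘(ℝ, ℝ) ∞ m s) (hfs : MapsTo f s K.dom) (hms : MapsTo m s L) :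
    ContMDiffOn J I ∞ (fun x => K.mov (f x) (m x)) s :=
  K.smooth_mov.comp (hf.prodMk hm) (fun _ hx => ⟨hfs hx, hms hx⟩)

/-- A function with positive derivative along the lines is strictly increasing on them. -/
theorem strictMonoOn_line (hL : Convex ℝ L) {m : W → ℝ} (hm : ContMDiffOn I 𝓘(ℝ, ℝ) ∞ m K.dom)
    (hd : ∀ x ∈ K.dom, 0 < derivWithin (fun l => m (K.mov x l)) L (K.lev x)) {x : W}
    (hx : x ∈ K.dom) : StrictMonoOn (fun l => m (K.mov x l)) L := by
  have hc : ContMDiffOn 𝓘(ℝ, ℝ) 𝓘(ℝ, ℝ) ∞ (fun l => m (K.mov x l)) L :=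
    hm.comp (K.contMDiff_mov_const hx) (fun l hl => K.mov_mem x hx l hl)
  refine strictMonoOn_of_deriv_pos hL hc.continuousOn (fun l hl => ?_)
  have hlL := interior_subset hl
  have h1 := hd _ (K.mov_mem x hx l hlL)
  rw [K.lev_mov x hx l hlL, derivWithin_congr (f := fun l' => m (K.mov x l'))
    (fun l' hl' => by simp only [K.mov_mov x hx l hlL l' hl'])
    (by simp only [K.mov_mov x hx l hlL l hlL]),
    derivWithin_of_mem_nhds (mem_interior_iff_mem_nhds.1 hl)] at h1
  exact h1

open Classical in
theorem contMDiff_fiberwise {m : W → ℝ} (hm : ContMDiffOn I 𝓘(ℝ, ℝ) ∞ m K.dom)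
    (hmL : MapsTo m K.dom L) {c₀ : ℝ} (hc₀ : c₀ < 1)
    (hmc : ∀ x ∈ K.dom, c₀ ≤ |K.lev x| → m x = K.lev x) :
    ContMDiff I I ∞ (fun x => if x ∈ K.dom then K.mov x (m x) else x) := by
  refine contMDiff_of_isOpen_cover K.isOpen_dom (K.closed c₀ hc₀).isOpen_compl (fun x => ?_) ?_ ?_
  · by_cases h : x ∈ K.dom
    · exact Or.inl h
    · exact Or.inr (fun h' => h h'.1)
  · exact (K.contMDiffOn_mov contMDiffOn_id hm (fun x hx => hx) hmL).congr
      (fun x hx => by simp [hx])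
  · refine contMDiffOn_id.congr (fun x hx => ?_)
    by_cases h : x ∈ K.dom
    · have : c₀ ≤ |K.lev x| := by
        by_contra h'
        exact hx ⟨h, (not_le.1 h').le⟩
      simp [h, hmc x h this, K.mov_lev x h]
    · simp [h]

/-- Moving the points of a collar along the lines, `x ↦ mov x (m x)`, is a diffeomorphism of the
whole manifold if `m` is increasing along the lines, maps each line onto itself and is standard near
the end of the collar. -/
theorem exists_diffeomorph_fiberwise [IsManifold I ∞ W] (hL : Convex ℝ L)
    (hL' : (interior L).Nonempty) {m : W → ℝ}
    (hm : ContMDiffOn I 𝓘(ℝ, ℝ) ∞ m K.dom) (hmL : MapsTo m K.dom L) {c₀ : ℝ} (hc₀ : c₀ < 1)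
    (hmc : ∀ x ∈ K.dom, c₀ ≤ |K.lev x| → m x = K.lev x)
    (hd : ∀ x ∈ K.dom, 0 < derivWithin (fun l => m (K.mov x l)) L (K.lev x))
    (hs : ∀ x ∈ K.dom, ∀ η ∈ L, ∃ a ∈ L, ∃ b ∈ L, m (K.mov x a) ≤ η ∧ η ≤ m (K.mov x b)) :
    ∃ τ : W ≃ₘ^∞⟮I, I⟯ W, (∀ x ∈ K.dom, τ x = K.mov x (m x)) ∧ ∀ x ∉ K.dom, τ x = x := by
  classical
  have hmono : ∀ x ∈ K.dom, StrictMonoOn (fun l => m (K.mov x l)) L :=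
    fun x hx => K.strictMonoOn_line hL hm hd hx
  have hUD : UniqueDiffOn ℝ L := uniqueDiffOn_convex hL hL'
  -- the inverse map is `x ↦ mov x (v x)`, where `v x` solves `m (mov x (v x)) = lev x`
  have hex : ∀ x, ∃ v, x ∈ K.dom → v ∈ L ∧ m (K.mov x v) = K.lev x := by
    intro x
    by_cases hx : x ∈ K.dom
    · obtain ⟨a, ha, b, hb, h1, h2⟩ := hs x hx _ (K.lev_mem x hx)
      have hab : uIcc a b ⊆ L := by
        rw [← segment_eq_uIcc]; exact hL.segment_subset ha hb
      have hc : ContinuousOn (fun l => m (K.mov x l)) (uIcc a b) :=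
        (hm.comp (K.contMDiff_mov_const hx)
          (fun l hl => K.mov_mem x hx l hl)).continuousOn.mono hab
      obtain ⟨v, hv, hv'⟩ := intermediate_value_uIcc hc (mem_uIcc.2 (Or.inl ⟨h1, h2⟩))
      exact ⟨v, fun _ => ⟨hab hv, hv'⟩⟩
    · exact ⟨0, fun h => (hx h).elim⟩
  choose v hv using hex
  have hvL : MapsTo v K.dom L := fun x hx => (hv x hx).1
  have hRs : ContMDiffOn (I.prod 𝓘(ℝ, ℝ)) 𝓘(ℝ, ℝ) ∞ (fun q : W × ℝ => m (K.mov q.1 q.2))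
      (K.dom ×ˢ L) := hm.comp K.smooth_mov (fun q hq => K.mov_mem _ hq.1 _ hq.2)
  have hder : ∀ x ∈ K.dom, ∀ l ∈ L, 0 < derivWithin (fun l => m (K.mov x l)) L l := by
    intro x hx l hl
    have h1 := hd _ (K.mov_mem x hx l hl)
    rwa [K.lev_mov x hx l hl, derivWithin_congr (f := fun l' => m (K.mov x l'))
      (fun l' hl' => by simp only [K.mov_mov x hx l hl l' hl'])
      (by simp only [K.mov_mov x hx l hl l hl])] at h1
  have hslice : ∀ a ∈ L, ContinuousOn (fun x => m (K.mov x a)) K.dom := fun a ha =>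
    hRs.continuousOn.comp (Continuous.prodMk_left a).continuousOn (fun x hx => ⟨hx, ha⟩)
  have hvcont : ContinuousOn v K.dom := by
    intro x₀ hx₀
    refine tendsto_order.2 ⟨fun a ha => ?_, fun a ha => ?_⟩
    · by_cases haL : a ∈ L
      · have h1 : m (K.mov x₀ a) - K.lev x₀ < 0 := by
          rw [← (hv x₀ hx₀).2]
          exact sub_neg.2 (hmono x₀ hx₀ haL (hvL hx₀) ha)
        have h2 := ((hslice a haL x₀ hx₀).sub (K.smooth_lev.continuousOn x₀ hx₀)).eventually
          (gt_mem_nhds h1)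
        filter_upwards [h2, self_mem_nhdsWithin] with x h3 hx
        rw [Pi.sub_apply, ← (hv x hx).2] at h3
        exact ((hmono x hx).lt_iff_lt haL (hvL hx)).1 (sub_neg.1 h3)
      · filter_upwards [self_mem_nhdsWithin] with x hx
        by_contra h
        exact haL (hL.ordConnected.out (hvL hx) (hvL hx₀) ⟨not_lt.1 h, ha.le⟩)
    · by_cases haL : a ∈ L
      · have h1 : 0 < m (K.mov x₀ a) - K.lev x₀ := by
          rw [← (hv x₀ hx₀).2]
          exact sub_pos.2 (hmono x₀ hx₀ (hvL hx₀) haL ha)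
        have h2 := ((hslice a haL x₀ hx₀).sub (K.smooth_lev.continuousOn x₀ hx₀)).eventually
          (lt_mem_nhds h1)
        filter_upwards [h2, self_mem_nhdsWithin] with x h3 hx
        rw [Pi.sub_apply, ← (hv x hx).2] at h3
        exact ((hmono x hx).lt_iff_lt (hvL hx) haL).1 (sub_pos.1 h3)
      · filter_upwards [self_mem_nhdsWithin] with x hx
        by_contra h
        exact haL (hL.ordConnected.out (hvL hx₀) (hvL hx) ⟨ha.le, not_lt.1 h⟩)
  have hvs : ContMDiffOn I 𝓘(ℝ, ℝ) ∞ v K.dom :=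
    contMDiffOn_of_implicit hUD K.isOpen_dom hRs K.smooth_lev hvcont hvL
      (fun x hx => (hder x hx _ (hvL hx)).ne') (fun x hx => (hv x hx).2)
  have hvc : ∀ x ∈ K.dom, c₀ ≤ |K.lev x| → v x = K.lev x := by
    intro x hx h
    refine (hmono x hx).injOn (hvL hx) (K.lev_mem x hx) ?_
    simp only [(hv x hx).2, K.mov_lev x hx, hmc x hx h]
  have hmem : ∀ x ∈ K.dom, K.mov x (m x) ∈ K.dom := fun x hx => K.mov_mem x hx _ (hmL hx)
  have hmem' : ∀ x ∈ K.dom, K.mov x (v x) ∈ K.dom := fun x hx => K.mov_mem x hx _ (hvL hx)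
  refine ⟨⟨⟨fun x => if x ∈ K.dom then K.mov x (m x) else x,
    fun x => if x ∈ K.dom then K.mov x (v x) else x, fun x => ?_, fun x => ?_⟩,
    K.contMDiff_fiberwise hm hmL hc₀ hmc, K.contMDiff_fiberwise hvs hvL hc₀ hvc⟩,
    fun x hx => if_pos hx, fun x hx => if_neg hx⟩
  · by_cases hx : x ∈ K.dom
    · simp only [hx, if_true, hmem x hx]
      have hmx := hmL hx
      have h1 : v (K.mov x (m x)) = K.lev x := by
        refine (hmono x hx).injOn (hvL (hmem x hx)) (K.lev_mem x hx) ?_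
        have := (hv _ (hmem x hx)).2
        rw [K.lev_mov x hx _ hmx, K.mov_mov x hx _ hmx _ (hvL (hmem x hx))] at this
        simp only [this, K.mov_lev x hx]
      rw [h1, K.mov_mov x hx _ hmx _ (K.lev_mem x hx), K.mov_lev x hx]
    · simp [hx]
  · by_cases hx : x ∈ K.dom
    · simp only [hx, if_true, hmem' x hx, (hv x hx).2]
      rw [K.mov_mov x hx _ (hvL hx) _ (K.lev_mem x hx), K.mov_lev x hx]
    · simp [hx]

/-- The foot of the line through a point: its point at level `0`. -/
def foot (x : W) : W := K.mov x 0

/-- The zero level of a collar. -/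
def base : Set W := {x | x ∈ K.dom ∧ K.lev x = 0}

theorem foot_mem_base (h0 : (0 : ℝ) ∈ L) {x : W} (hx : x ∈ K.dom) : K.foot x ∈ K.base :=
  ⟨K.mov_mem x hx 0 h0, K.lev_mov x hx 0 h0⟩

theorem foot_mov (h0 : (0 : ℝ) ∈ L) {x : W} (hx : x ∈ K.dom) {l : ℝ} (hl : l ∈ L) :
    K.foot (K.mov x l) = K.foot x :=
  K.mov_mov x hx l hl 0 h0

theorem mov_foot (h0 : (0 : ℝ) ∈ L) {x : W} (hx : x ∈ K.dom) {l : ℝ} (hl : l ∈ L) :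
    K.mov (K.foot x) l = K.mov x l :=
  K.mov_mov x hx 0 h0 l hl

theorem foot_of_mem_base {x : W} (hx : x ∈ K.base) : K.foot x = x := by
  have := K.mov_lev x hx.1
  rwa [hx.2] at this

theorem isClosed_base : IsClosed K.base := by
  have := K.closed 0 zero_lt_one
  simpa only [abs_nonpos_iff, base] using this

theorem contMDiffOn_foot (h0 : (0 : ℝ) ∈ L) : ContMDiffOn I I ∞ K.foot K.dom :=
  K.contMDiffOn_mov contMDiffOn_id contMDiffOn_const (fun _ hx => hx) (fun _ _ => h0)

/-- Near a point of the zero level, points of small level stay in a given neighbourhood. -/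
theorem eventually_mov_mem (h0 : (0 : ℝ) ∈ L) {x : W} (hx : x ∈ K.base) {O : Set W}
    (hO : O ∈ 𝓝 x) : ∃ δ > 0, ∀ᶠ y in 𝓝 x, y ∈ K.dom ∧ ∀ l ∈ L, |l| < δ → K.mov y l ∈ O := by
  have h1 : ContinuousWithinAt (fun q : W × ℝ => K.mov q.1 q.2) (K.dom ×ˢ L) (x, 0) :=
    K.smooth_mov.continuousOn _ ⟨hx.1, h0⟩
  have h2 : ∀ᶠ q in 𝓝[K.dom ×ˢ L] (x, (0 : ℝ)), K.mov q.1 q.2 ∈ O := by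
    refine h1 ?_
    have : K.mov x 0 = x := K.foot_of_mem_base hx
    simpa only [this] using hO
  rw [nhdsWithin_prod_eq, (K.isOpen_dom.nhdsWithin_eq hx.1)] at h2
  obtain ⟨pa, ha, pb, hb, hab⟩ := eventually_prod_iff.1 h2
  obtain ⟨δ, hδ, hδ'⟩ := Metric.mem_nhdsWithin_iff.1 hb
  refine ⟨δ, hδ, ?_⟩
  filter_upwards [ha, K.isOpen_dom.mem_nhds hx.1] with y hy hyd
  exact ⟨hyd, fun l hl hlδ => hab hy (hδ' ⟨by simpa using hlδ, hl⟩)⟩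

/-- Every neighbourhood of the zero level contains a smaller tube around it. -/
theorem exists_tube [FiniteDimensional ℝ E] [IsManifold I ∞ W] [SigmaCompactSpace W] [T2Space W]
    (h0 : (0 : ℝ) ∈ L) {O : Set W} (hO : IsOpen O) (hbO : K.base ⊆ O) {c₀ : ℝ} (hc₀ : 0 < c₀) :
    ∃ ε : C^∞⟮I, W; 𝓘(ℝ, ℝ), ℝ⟯, (∀ x, 0 < ε x ∧ ε x ≤ c₀) ∧
      ∀ x ∈ K.dom, |K.lev x| < ε (K.foot x) → x ∈ O := by
  set t : W → Set ℝ := fun y => {c : ℝ | (0 < c ∧ c ≤ c₀) ∧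
      (y ∈ K.base → ∀ l ∈ L, |l| < c → K.mov y l ∈ O)}
  have hconv : ∀ y, Convex ℝ (t y) := fun y => by
    refine Set.OrdConnected.convex ⟨fun a ha b hb c hc => ⟨⟨ha.1.1.trans_le hc.1,
      hc.2.trans hb.1.2⟩, fun hy l hl h => hb.2 hy l hl (h.trans_le hc.2)⟩⟩
  have hloc : ∀ x, ∃ c, ∀ᶠ y in 𝓝 x, c ∈ t y := fun x => by
    by_cases hx : x ∈ K.base
    · obtain ⟨δ, hδ, h⟩ := K.eventually_mov_mem h0 hx (hO.mem_nhds (hbO hx))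
      refine ⟨min δ c₀, ?_⟩
      filter_upwards [h] with y hy
      exact ⟨⟨lt_min hδ hc₀, min_le_right _ _⟩,
        fun _ l hl hlt => hy.2 l hl (hlt.trans_le (min_le_left _ _))⟩
    · refine ⟨c₀, ?_⟩
      filter_upwards [K.isClosed_base.isOpen_compl.mem_nhds hx] with y hy
      exact ⟨⟨hc₀, le_rfl⟩, fun h => (hy h).elim⟩
  obtain ⟨ε, hε⟩ := exists_contMDiffMap_forall_mem_convex_of_local_const (n := ⊤) I hconv hloc
  refine ⟨ε, fun x => (hε x).1, fun x hx h => ?_⟩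
  have := (hε (K.foot x)).2 (K.foot_mem_base h0 hx) _ (K.lev_mem x hx) h
  rwa [K.mov_foot h0 hx (K.lev_mem x hx), K.mov_lev x hx] at this

/-- The ranges of levels in use: `[0, 1)` for collars and `(-1, 1)` for bicollars. -/
structure _root_.IsLevelRange (L : Set ℝ) : Prop where
  zero_mem : (0 : ℝ) ∈ L
  abs_lt_one : ∀ l ∈ L, |l| < 1
  mul_mem : ∀ l ∈ L, ∀ t, 0 < t → |l * t| < 1 → l * t ∈ L

theorem _root_.isLevelRange_Ico : IsLevelRange (Ico 0 1) where
  zero_mem := by simp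
  abs_lt_one l hl := by rw [abs_of_nonneg hl.1]; exact hl.2
  mul_mem l hl t ht h := ⟨mul_nonneg hl.1 ht.le, (le_abs_self _).trans_lt h⟩

theorem _root_.isLevelRange_Ioo : IsLevelRange (Ioo (-1) 1) where
  zero_mem := by simp
  abs_lt_one l hl := abs_lt.2 hl
  mul_mem l hl t ht h := abs_lt.1 h

theorem _root_.IsLevelRange.mul_mem_of_le (hL : IsLevelRange L) {t l : ℝ} (ht : 0 < t ∧ t ≤ 1)
    (hl : l ∈ L) : l * t ∈ L := by
  refine hL.mul_mem l hl t ht.1 ?_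
  rw [abs_mul, abs_of_pos ht.1]
  exact (mul_le_of_le_one_right (abs_nonneg l) ht.2).trans_lt (hL.abs_lt_one l hl)

/-- A collar can be made thinner, with a thickness depending on the line. -/
noncomputable def shrink (hL : IsLevelRange L) (ε : W → ℝ)
    (hε : ContMDiff I 𝓘(ℝ, ℝ) ∞ ε) (hε0 : ∀ x, 0 < ε x ∧ ε x ≤ 1) :
    Collar I W L where
  dom := {x | x ∈ K.dom ∧ |K.lev x| < ε (K.foot x)}
  lev x := K.lev x / ε (K.foot x)
  mov x l := K.mov x (l * ε (K.foot x))
  isOpen_dom := by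
    have h := (K.smooth_lev.continuousOn.abs.sub
      (hε.continuous.comp_continuousOn (K.contMDiffOn_foot hL.zero_mem).continuousOn)).isOpen_inter_preimage
      K.isOpen_dom isOpen_Iio (t := Iio (0 : ℝ))
    convert! h using 1
    ext x
    simp
  lev_mem x hx := by
    have h := (hε0 (K.foot x)).1
    rw [div_eq_mul_inv]
    refine hL.mul_mem _ (K.lev_mem x hx.1) _ (inv_pos.2 h) ?_
    rw [← div_eq_mul_inv, abs_div, abs_of_pos h, div_lt_one h]
    exact hx.2
  mov_mem x hx l hl := by
    have hl' := hL.mul_mem_of_le (hε0 (K.foot x)) hl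
    refine ⟨K.mov_mem x hx.1 _ hl', ?_⟩
    rw [K.foot_mov hL.zero_mem hx.1 hl', K.lev_mov x hx.1 _ hl', abs_mul,
      abs_of_pos (hε0 (K.foot x)).1]
    exact mul_lt_of_lt_one_left (hε0 (K.foot x)).1 (hL.abs_lt_one l hl)
  lev_mov x hx l hl := by
    have hl' := hL.mul_mem_of_le (hε0 (K.foot x)) hl
    rw [K.foot_mov hL.zero_mem hx.1 hl', K.lev_mov x hx.1 _ hl',
      mul_div_cancel_right₀ _ (hε0 (K.foot x)).1.ne']
  mov_lev x hx := by
    have h := (hε0 (K.foot x)).1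
    rw [div_mul_cancel₀ _ h.ne', K.mov_lev x hx.1]
  mov_mov x hx l hl l' hl' := by
    have h1 := hL.mul_mem_of_le (hε0 (K.foot x)) hl
    rw [K.foot_mov hL.zero_mem hx.1 h1, K.mov_mov x hx.1 _ h1 _ (hL.mul_mem_of_le (hε0 (K.foot x)) hl')]
  smooth_lev := by
    have h1 : ContMDiffOn I 𝓘(ℝ, ℝ) ∞ (fun x => (ε (K.foot x))⁻¹) K.dom := fun x hx =>
      ((hε.comp_contMDiffOn (K.contMDiffOn_foot hL.zero_mem)) x hx).inv₀ (hε0 (K.foot x)).1.ne'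
    exact (K.smooth_lev.mul h1).mono (fun x hx => hx.1)
  smooth_mov := by
    refine K.contMDiffOn_mov contMDiff_fst.contMDiffOn ?_ (fun q hq => hq.1.1)
      (fun q hq => hL.mul_mem_of_le (hε0 _) hq.2)
    refine contMDiff_snd.contMDiffOn.mul ?_
    exact (hε.comp_contMDiffOn (K.contMDiffOn_foot hL.zero_mem)).comp contMDiff_fst.contMDiffOn
      (fun q hq => hq.1.1)
  closed c hc := by
    have h1 : ContinuousOn (fun x => |K.lev x| - c * ε (K.foot x))
        {x | x ∈ K.dom ∧ |K.lev x| ≤ max c 0} :=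
      (K.smooth_lev.continuousOn.abs.sub (continuousOn_const.mul
        (hε.continuous.comp_continuousOn (K.contMDiffOn_foot hL.zero_mem).continuousOn))).mono
        (fun x hx => hx.1)
    have h2 := h1.preimage_isClosed_of_isClosed (K.closed _ (max_lt hc one_pos))
      (isClosed_Iic (a := (0 : ℝ)))
    convert! h2 using 1
    ext x
    have h := hε0 (K.foot x)
    simp only [mem_ofPred_eq, mem_inter_iff, mem_preimage, mem_Iic, sub_nonpos, abs_div,
      abs_of_pos h.1, div_le_iff₀ h.1]
    refine ⟨fun hx => ⟨⟨hx.1.1, hx.2.trans ?_⟩, hx.2⟩, fun hx => ⟨⟨hx.1.1, hx.2.trans_lt ?_⟩, hx.2⟩⟩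
    · calc c * ε (K.foot x) ≤ max c 0 * ε (K.foot x) := by gcongr; exacts [h.1.le, le_max_left _ _]
        _ ≤ max c 0 := mul_le_of_le_one_right (le_max_right _ _) h.2
    · exact mul_lt_of_lt_one_left h.1 hc

/-- The product of a collar with a manifold. -/
noncomputable def prod {E' : Type*} [NormedAddCommGroup E'] [NormedSpace ℝ E'] {H' : Type*}
    [TopologicalSpace H'] (J : ModelWithCorners ℝ E' H') (X : Type*) [TopologicalSpace X]
    [ChartedSpace H' X] : Collar (I.prod J) (W × X) L where
  dom := K.dom ×ˢ univ
  lev p := K.lev p.1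
  mov p l := (K.mov p.1 l, p.2)
  isOpen_dom := K.isOpen_dom.prod isOpen_univ
  lev_mem p hp := K.lev_mem _ hp.1
  mov_mem p hp l hl := ⟨K.mov_mem _ hp.1 l hl, mem_univ _⟩
  lev_mov p hp l hl := K.lev_mov _ hp.1 l hl
  mov_lev p hp := Prod.ext (K.mov_lev _ hp.1) rfl
  mov_mov p hp l hl l' hl' := Prod.ext (K.mov_mov _ hp.1 l hl l' hl') rfl
  smooth_lev := K.smooth_lev.comp contMDiffOn_fst (fun p hp => hp.1)
  smooth_mov := (K.contMDiffOn_mov (contMDiff_fst.comp contMDiff_fst).contMDiffOn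
    contMDiff_snd.contMDiffOn (fun q hq => hq.1.1) (fun q hq => hq.2)).prodMk
    (contMDiff_snd.comp contMDiff_fst).contMDiffOn
  closed c hc := by
    convert! (K.closed c hc).preimage (continuous_fst (Y := X)) using 1
    ext p
    simp

/-- The collar of the bottom `W × 0` in `W × [0, 1]`. -/
noncomputable def bottom (I : ModelWithCorners ℝ E H) (W : Type*) [TopologicalSpace W]
    [ChartedSpace H W] : Collar (I.prod (𝓡∂ 1)) (W × unitInterval) (Ico 0 1) where
  dom := {p | p.2.1 < 1}
  lev p := p.2
  mov p l := (p.1, projIcc 0 1 zero_le_one l)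
  isOpen_dom := isOpen_lt (by fun_prop) continuous_const
  lev_mem p hp := ⟨p.2.2.1, hp⟩
  mov_mem p hp l hl := by
    simp only [mem_ofPred_eq, projIcc_of_mem zero_le_one (Ico_subset_Icc_self hl)]
    exact hl.2
  lev_mov p hp l hl := by simp [projIcc_of_mem zero_le_one (Ico_subset_Icc_self hl)]
  mov_lev p hp := by simp
  mov_mov p hp l hl l' hl' := rfl
  smooth_lev := (contMDiff_subtypeVal_Icc.comp contMDiff_snd).contMDiffOn
  smooth_mov := by
    refine (contMDiff_fst.comp contMDiff_fst).contMDiffOn.prodMk ?_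
    exact contMDiffOn_projIcc.comp contMDiff_snd.contMDiffOn
      (fun q hq => Ico_subset_Icc_self hq.2)
  closed c hc := by
    have h : {p : W × unitInterval | p.2.1 < 1 ∧ |p.2.1| ≤ c} = {p | p.2.1 ≤ c} := by
      ext p
      simp only [mem_ofPred_eq, abs_of_nonneg p.2.2.1]
      exact ⟨fun h => h.2, fun h => ⟨h.trans_lt hc, h⟩⟩
    change IsClosed {p : W × unitInterval | p.2.1 < 1 ∧ |p.2.1| ≤ c}
    rw [h]
    exact isClosed_le (by fun_prop) continuous_const

/-- The collar of the top `W × 1` in `W × [0, 1]`. -/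
noncomputable def top (I : ModelWithCorners ℝ E H) (W : Type*) [TopologicalSpace W]
    [ChartedSpace H W] : Collar (I.prod (𝓡∂ 1)) (W × unitInterval) (Ico 0 1) where
  dom := {p | 0 < p.2.1}
  lev p := 1 - p.2
  mov p l := (p.1, projIcc 0 1 zero_le_one (1 - l))
  isOpen_dom := isOpen_lt continuous_const (by fun_prop)
  lev_mem p hp := ⟨sub_nonneg.2 p.2.2.2, sub_lt_self _ hp⟩
  mov_mem p hp l hl := by
    have h : 1 - l ∈ Icc (0 : ℝ) 1 := ⟨by linarith [hl.2], by linarith [hl.1]⟩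
    simp only [mem_ofPred_eq, projIcc_of_mem zero_le_one h]
    exact sub_pos.2 hl.2
  lev_mov p hp l hl := by
    have h : 1 - l ∈ Icc (0 : ℝ) 1 := ⟨by linarith [hl.2], by linarith [hl.1]⟩
    simp [projIcc_of_mem zero_le_one h]
  mov_lev p hp := by simp
  mov_mov p hp l hl l' hl' := rfl
  smooth_lev := ((contDiff_const.sub contDiff_id).contMDiff.comp
    (contMDiff_subtypeVal_Icc.comp contMDiff_snd)).contMDiffOn
  smooth_mov := by
    refine (contMDiff_fst.comp contMDiff_fst).contMDiffOn.prodMk ?_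
    exact contMDiffOn_projIcc.comp
      ((contDiff_const.sub contDiff_id).contMDiff.comp contMDiff_snd).contMDiffOn
      (fun q hq => ⟨by linarith [hq.2.2], by linarith [hq.2.1]⟩)
  closed c hc := by
    have h : {p : W × unitInterval | 0 < p.2.1 ∧ |1 - p.2.1| ≤ c} = {p | 1 - p.2.1 ≤ c} := by
      ext p
      simp only [mem_ofPred_eq, abs_of_nonneg (sub_nonneg.2 p.2.2.2)]
      exact ⟨fun h => h.2, fun h => ⟨by linarith, h⟩⟩
    change IsClosed {p : W × unitInterval | 0 < p.2.1 ∧ |1 - p.2.1| ≤ c}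
    rw [h]
    exact isClosed_le (by fun_prop) continuous_const

end Collar

/-! ### Derivatives along the lines of a collar -/

namespace Collar

variable {E : Type*} [NormedAddCommGroup E] [NormedSpace ℝ E] {H : Type*} [TopologicalSpace H]
  {I : ModelWithCorners ℝ E H} {W : Type*} [TopologicalSpace W] [ChartedSpace H W]
  {L : Set ℝ} (K : Collar I W L)

/-- The derivative of a function along the line through a point of the collar. -/
noncomputable def lineDeriv (f : W → ℝ) (x : W) : ℝ :=
  derivWithin (fun l => f (K.mov x l)) L (K.lev x)

/-- The set of pairs `(x, l)` with `mov x l ∈ O` is the part over `L` of an open set of `W × ℝ`. -/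
theorem isOpen_preimage_mov {O : Set W} (hO : IsOpen O) :
    ∃ Ω : Set (W × ℝ), IsOpen Ω ∧ Ω ∩ univ ×ˢ L =
      {q | q ∈ K.dom ×ˢ L ∧ K.mov q.1 q.2 ∈ O} := by
  obtain ⟨Ω, hΩ, h⟩ := (continuousOn_iff'.1 K.smooth_mov.continuousOn) O hO
  refine ⟨Ω ∩ K.dom ×ˢ univ, hΩ.inter (K.isOpen_dom.prod isOpen_univ), ?_⟩
  ext q
  have := congrArg (q ∈ ·) h
  simp only [mem_inter_iff, mem_preimage, mem_prod, eq_iff_iff] at this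
  simp only [mem_inter_iff, mem_prod, mem_univ, mem_ofPred_eq, true_and, and_true]
  tauto

/-- Smooth functions are differentiable along the lines, with a continuous derivative. -/
theorem hasDerivWithinAt_and_continuousOn_lineDeriv [IsManifold I ∞ W]
    (hL : UniqueDiffOn ℝ L) {f : W → ℝ} {O : Set W}
    (hO : IsOpen O) (hf : ContMDiffOn I 𝓘(ℝ, ℝ) ∞ f O) :
    (∀ x ∈ K.dom, ∀ l ∈ L, K.mov x l ∈ O →
      HasDerivWithinAt (fun l => f (K.mov x l)) (K.lineDeriv f (K.mov x l)) L l) ∧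
    ContinuousOn (K.lineDeriv f) (K.dom ∩ O) := by
  obtain ⟨Ω, hΩ, h⟩ := K.isOpen_preimage_mov hO
  have hR : ContMDiffOn (I.prod 𝓘(ℝ, ℝ)) 𝓘(ℝ, ℝ) ∞ (fun q : W × ℝ => f (K.mov q.1 q.2))
      (Ω ∩ univ ×ˢ L) := by
    rw [h]
    exact hf.comp (K.smooth_mov.mono (fun q hq => hq.1)) (fun q hq => hq.2)
  have hc := continuousOn_derivWithin_snd hL hΩ hR
  constructor
  · intro x hx l hl hxl
    have h1 := (hc.1 (x, l) (by rw [h]; exact ⟨⟨hx, hl⟩, hxl⟩)).hasDerivWithinAt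
    have h2 : K.lineDeriv f (K.mov x l) = derivWithin (fun l => f (K.mov x l)) L l := by
      rw [lineDeriv, K.lev_mov x hx l hl]
      exact derivWithin_congr (fun l' hl' => by simp only [K.mov_mov x hx l hl l' hl'])
        (by simp only [K.mov_mov x hx l hl l hl])
    rwa [h2]
  · have h1 : ContinuousOn (fun x => (x, K.lev x)) (K.dom ∩ O) :=
      continuousOn_id.prodMk (K.smooth_lev.continuousOn.mono inter_subset_left)
    refine hc.2.comp h1 (fun x hx => ?_)
    rw [h]
    exact ⟨⟨hx.1, K.lev_mem x hx.1⟩, by simpa [K.mov_lev x hx.1] using hx.2⟩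

theorem hasDerivWithinAt_lineDeriv [IsManifold I ∞ W] (hL : UniqueDiffOn ℝ L) {f : W → ℝ}
    {O : Set W} (hO : IsOpen O) (hf : ContMDiffOn I 𝓘(ℝ, ℝ) ∞ f O) {x : W} (hx : x ∈ K.dom)
    (hxO : x ∈ O) :
    HasDerivWithinAt (fun l => f (K.mov x l)) (K.lineDeriv f x) L (K.lev x) := by
  have := (K.hasDerivWithinAt_and_continuousOn_lineDeriv hL hO hf).1 x hx _ (K.lev_mem x hx)
  rw [K.mov_lev x hx] at this
  exact this hxO

/-- The line through a point of an open set stays in the set for a short while. -/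
theorem eventually_line_mem {x : W} (hx : x ∈ K.dom) {O : Set W} (hO : O ∈ 𝓝 x) :
    ∀ᶠ l in 𝓝[L] (K.lev x), K.mov x l ∈ O := by
  have h := (K.contMDiff_mov_const hx).continuousOn _ (K.lev_mem x hx)
  refine h ?_
  rwa [K.mov_lev x hx]

theorem lineDeriv_congr {f g : W → ℝ} {x : W} (hx : x ∈ K.dom) (h : f =ᶠ[𝓝 x] g) :
    K.lineDeriv f x = K.lineDeriv g x := by
  refine Filter.EventuallyEq.derivWithin_eq (K.eventually_line_mem hx h) ?_
  simp only [K.mov_lev x hx]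
  exact h.eq_of_nhds

theorem lineDeriv_lev (hL : UniqueDiffOn ℝ L) {x : W} (hx : x ∈ K.dom) :
    K.lineDeriv K.lev x = 1 := by
  rw [lineDeriv, derivWithin_congr (f := fun l => l) (fun l hl => K.lev_mov x hx l hl)
    (K.lev_mov x hx _ (K.lev_mem x hx))]
  exact derivWithin_id _ _ (hL _ (K.lev_mem x hx))

end Collar

namespace Collar

variable {E : Type*} [NormedAddCommGroup E] [NormedSpace ℝ E] {H : Type*} [TopologicalSpace H]
  {I : ModelWithCorners ℝ E H} {W : Type*} [TopologicalSpace W] [ChartedSpace H W]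
  (K : Collar I W (Ico 0 1))

theorem uniqueDiffOn_Ico_zero_one : UniqueDiffOn ℝ (Ico (0 : ℝ) 1) := uniqueDiffOn_Ico 0 1

/-- A function which vanishes on the zero level grows at most linearly with the level, uniformly
near each point of the zero level. -/
theorem exists_linear_bound [IsManifold I ∞ W] {f : W → ℝ} {O : Set W} (hO : IsOpen O)
    (hf : ContMDiffOn I 𝓘(ℝ, ℝ) ∞ f O) (hf0 : ∀ x ∈ K.base, f x = 0) {y₀ : W} (hy₀ : y₀ ∈ K.base)
    (hyO : y₀ ∈ O) :
    ∃ C > 0, ∃ δ > 0, ∀ᶠ y in 𝓝 y₀, y ∈ K.base → ∀ l ∈ Ico (0 : ℝ) 1, l < δ →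
      K.mov y l ∈ O ∧ f (K.mov y l) ≤ C * l := by
  obtain ⟨h1, h2⟩ := K.hasDerivWithinAt_and_continuousOn_lineDeriv uniqueDiffOn_Ico_zero_one hO hf
  have h3 : ContinuousAt (K.lineDeriv f) y₀ :=
    h2.continuousAt ((K.isOpen_dom.inter hO).mem_nhds ⟨hy₀.1, hyO⟩)
  set C := |K.lineDeriv f y₀| + 1
  have h4 : {x | x ∈ O ∧ |K.lineDeriv f x| < C} ∈ 𝓝 y₀ :=
    inter_mem (hO.mem_nhds hyO) (h3.abs.eventually (gt_mem_nhds (lt_add_one _)))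
  obtain ⟨δ, hδ, h5⟩ := K.eventually_mov_mem (by simp) hy₀ h4
  refine ⟨C, by positivity, δ, hδ, ?_⟩
  filter_upwards [h5] with y hy hyb l hl hlδ
  have hs : ∀ l' ∈ Icc 0 l, l' ∈ Ico (0 : ℝ) 1 ∧ |l'| < δ := fun l' hl' =>
    ⟨⟨hl'.1, hl'.2.trans_lt hl.2⟩, by rw [abs_of_nonneg hl'.1]; exact hl'.2.trans_lt hlδ⟩
  refine ⟨(hy.2 l hl (hs l ⟨hl.1, le_rfl⟩).2).1, ?_⟩
  have h6 := Convex.norm_image_sub_le_of_norm_hasDerivWithin_le (s := Icc 0 l) (C := C)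
    (f := fun l => f (K.mov y l)) (f' := fun l => K.lineDeriv f (K.mov y l))
    (fun l' hl' => (h1 y hyb.1 l' (hs l' hl').1 (hy.2 l' (hs l' hl').1 (hs l' hl').2).1).mono
      (fun l'' hl'' => (hs l'' hl'').1))
    (fun l' hl' => (hy.2 l' (hs l' hl').1 (hs l' hl').2).2.le) (convex_Icc 0 l)
    (left_mem_Icc.2 hl.1) (right_mem_Icc.2 hl.1)
  have h7 : f (K.mov y 0) = 0 := by
    rw [show K.mov y 0 = y from K.foot_of_mem_base hyb, hf0 y hyb]
  simp only [h7, sub_zero, Real.norm_eq_abs, abs_of_nonneg hl.1] at h6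
  exact (le_abs_self _).trans h6

/-- A local diffeomorphism which fixes the zero level and maps the collar side to the collar side
crosses the zero level with positive speed. -/
theorem lineDeriv_lev_comp_pos [IsManifold I ∞ W] (φ : OpenPartialHomeomorph W W)
    (hφ : ContMDiffOn I I ∞ φ φ.source) (hφ' : ContMDiffOn I I ∞ φ.symm φ.target)
    (hb : K.base ⊆ φ.source) (hfix : ∀ x ∈ K.base, φ x = x) {y : W} (hy : y ∈ K.base) :
    0 < K.lineDeriv (fun x => K.lev (φ x)) y := by
  have hφb : ∀ x ∈ K.base, x ∈ φ.target ∧ φ.symm x = x := fun x hx =>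
    ⟨hfix x hx ▸ φ.map_source (hb hx), by
      conv_lhs => rw [← hfix x hx]
      exact φ.left_inv (hb hx)⟩
  have hO : IsOpen (φ.symm.source ∩ φ.symm ⁻¹' K.dom) :=
    φ.symm.isOpen_inter_preimage K.isOpen_dom
  have hO' : IsOpen (φ.source ∩ φ ⁻¹' K.dom) := φ.isOpen_inter_preimage K.isOpen_dom
  have hyO' : y ∈ φ.source ∩ φ ⁻¹' K.dom :=
    ⟨hb hy, by rw [mem_preimage, hfix y hy]; exact hy.1⟩
  obtain ⟨C, hC, δ, hδ, h⟩ := K.exists_linear_bound (f := fun z => K.lev (φ.symm z)) hO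
    (K.smooth_lev.comp (hφ'.mono inter_subset_left) (fun z hz => hz.2))
    (fun x hx => by rw [(hφb x hx).2, hx.2]) hy
    ⟨(hφb y hy).1, by rw [mem_preimage, (hφb y hy).2]; exact hy.1⟩
  have hder := K.hasDerivWithinAt_lineDeriv uniqueDiffOn_Ico_zero_one hO'
    (f := fun x => K.lev (φ x))
    (K.smooth_lev.comp (hφ.mono inter_subset_left) (fun z hz => hz.2)) hy.1 hyO'
  rw [hy.2] at hder
  -- the level of `φ (mov y l)` is at least `l / C`, because `φ.symm` raises levels at most `C`-fold
  have hgood : ∀ᶠ x in 𝓝 y, x ∈ φ.source ∧ φ x ∈ K.dom ∧ K.lev (φ x) < δ ∧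
      (K.foot (φ x) ∈ K.base → ∀ l ∈ Ico (0 : ℝ) 1, l < δ →
      K.mov (K.foot (φ x)) l ∈ φ.symm.source ∩ φ.symm ⁻¹' K.dom ∧
      K.lev (φ.symm (K.mov (K.foot (φ x)) l)) ≤ C * l) := by
    have hφc : ContinuousAt φ y := φ.continuousAt (hb hy)
    have hlev : ContinuousAt K.lev (φ y) := K.smooth_lev.continuousOn.continuousAt
      (K.isOpen_dom.mem_nhds (by rw [hfix y hy]; exact hy.1))
    have hft : ContinuousAt K.foot (φ y) := (K.contMDiffOn_foot (by simp)).continuousOn.continuousAt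
      (K.isOpen_dom.mem_nhds (by rw [hfix y hy]; exact hy.1))
    have hlt : (K.lev ∘ φ) y < δ := by rw [Function.comp_apply, hfix y hy, hy.2]; exact hδ
    filter_upwards [hO'.mem_nhds hyO', (hlev.comp hφc).eventually (gt_mem_nhds hlt),
      (hft.comp hφc).eventually (by
        rw [Function.comp_apply, hfix y hy, K.foot_of_mem_base hy]; exact h)] with x h1 h2 h3
    exact ⟨h1.1, h1.2, h2, h3⟩
  have hlow : ∀ᶠ l in 𝓝[Ico (0 : ℝ) 1] 0, l ≤ C * K.lev (φ (K.mov y l)) := by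
    have := K.eventually_line_mem hy.1 hgood
    rw [hy.2] at this
    filter_upwards [this, self_mem_nhdsWithin] with l hl hl01
    obtain ⟨h1, h2, h3, h4⟩ := hl
    have h5 := (h4 (K.foot_mem_base (by simp) h2) _ (K.lev_mem _ h2) h3).2
    rwa [K.mov_foot (by simp) h2 (K.lev_mem _ h2), K.mov_lev _ h2, φ.left_inv h1,
      K.lev_mov y hy.1 l hl01] at h5
  have hslope := hasDerivWithinAt_iff_tendsto_slope.1 hder
  have hne : (𝓝[Ico (0 : ℝ) 1 \ {0}] 0).NeBot := by
    have : Ico (0 : ℝ) 1 \ {0} = Ioo 0 1 := Ico_sdiff_left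
    rw [this]
    exact left_nhdsWithin_Ioo_neBot one_pos
  have : 1 / C ≤ K.lineDeriv (fun x => K.lev (φ x)) y := by
    refine ge_of_tendsto hslope ?_
    filter_upwards [nhdsWithin_mono _ sdiff_subset hlow, self_mem_nhdsWithin] with l hl hl'
    have hlpos : 0 < l := lt_of_le_of_ne hl'.1.1 (fun h => hl'.2 h.symm)
    have h0 : K.lev (φ (K.mov y 0)) = 0 := by
      rw [show K.mov y 0 = y from K.foot_of_mem_base hy, hfix y hy, hy.2]
    rw [slope_def_field, h0, sub_zero, sub_zero, div_le_div_iff₀ hC hlpos]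
    linarith
  exact (by positivity : 0 < 1 / C).trans_le this

end Collar

/-- On a compact set, a small multiple of one continuous function is below a positive one. -/
theorem IsCompact.exists_pos_mul_le {X : Type*} [TopologicalSpace X] {Q : Set X} (hQ : IsCompact Q)
    {a b : X → ℝ} (ha : ContinuousOn a Q) (hb : ContinuousOn b Q) (hpos : ∀ x ∈ Q, 0 < a x) :
    ∃ c > 0, ∀ x ∈ Q, c * |b x| ≤ a x := by
  obtain ⟨C, hC⟩ := hQ.exists_bound_of_continuousOn hb
  rcases Q.eq_empty_or_nonempty with rfl | hne
  · exact ⟨1, one_pos, by simp⟩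
  obtain ⟨x₀, hx₀, hmin⟩ := hQ.exists_isMinOn hne ha
  have hC0 : 0 ≤ C := (norm_nonneg _).trans (hC x₀ hx₀)
  refine ⟨a x₀ / (C + 1), div_pos (hpos _ hx₀) (by positivity), fun x hx => ?_⟩
  calc a x₀ / (C + 1) * |b x| ≤ a x₀ / (C + 1) * (C + 1) := by
        have := hC x hx
        rw [Real.norm_eq_abs] at this
        have := hpos _ hx₀
        gcongr
        linarith
    _ = a x₀ := by field_simp
    _ ≤ a x := hmin hx

/-- A positive smooth function can be chosen below a given one, and so that the derivative along the
lines of its composition with `g` is smaller than a given positive function. The set `P₀` of points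
where this is required only has to be relatively compact over compact sets. -/
theorem Collar.exists_small_lineDeriv {E : Type*} [NormedAddCommGroup E] [NormedSpace ℝ E]
    [FiniteDimensional ℝ E] {H : Type*} [TopologicalSpace H] {I : ModelWithCorners ℝ E H}
    {W : Type*} [TopologicalSpace W] [ChartedSpace H W] [IsManifold I ∞ W] [SigmaCompactSpace W]
    [T2Space W] {L : Set ℝ} (K : Collar I W L) (hL : UniqueDiffOn ℝ L) {e : W → ℝ}
    (he : Continuous e) (he0 : ∀ x, 0 < e x) {P P₀ : Set W} (hP : IsOpen P) (hPdom : P ⊆ K.dom)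
    {g : W → W} (hg : ContMDiffOn I I ∞ g P) {α : W → ℝ} (hα : ContinuousOn α P)
    (hα0 : ∀ x ∈ P, 0 < α x)
    (hcomp : ∀ C, IsCompact C → ∃ Q ⊆ P, IsCompact Q ∧ ∀ x ∈ P₀, g x ∈ C → x ∈ Q) :
    ∃ ε : W → ℝ, ContMDiff I 𝓘(ℝ, ℝ) ∞ ε ∧ (∀ x, 0 < ε x ∧ ε x ≤ e x) ∧
      ∀ x ∈ P₀, |K.lineDeriv (fun x => ε (g x)) x| < α x := by
  have : LocallyCompactSpace H := I.locallyCompactSpace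
  have : LocallyCompactSpace W := ChartedSpace.locallyCompactSpace H W
  set X := CompactExhaustion.choice W
  obtain ⟨f, hf⟩ := SmoothPartitionOfUnity.exists_isSubordinate I (isClosed_univ (X := W))
    (fun n : ℕ => interior (X (n + 1))) (fun n => isOpen_interior) (fun x _ => by
      obtain ⟨n, hn⟩ := mem_iUnion.1 (X.iUnion_eq.symm ▸ mem_univ x)
      exact mem_iUnion.2 ⟨n, X.subset_interior_succ n hn⟩)
  choose Q hQP hQc hQ using fun n : ℕ => hcomp (X (n + 1)) (X.isCompact (n + 1))
  have hfg : ∀ n, ContMDiffOn I 𝓘(ℝ, ℝ) ∞ (fun x => f n (g x)) P := fun n =>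
    (f n).contMDiff.comp_contMDiffOn hg
  have hc1 : ∀ n, ∃ c > 0, ∀ x ∈ X (n + 1), c * |(1 : ℝ)| ≤ e x := fun n =>
    (X.isCompact (n + 1)).exists_pos_mul_le he.continuousOn continuousOn_const (fun x _ => he0 x)
  have hc2 : ∀ n, ∃ c > 0, ∀ x ∈ Q n, c * |K.lineDeriv (fun x => f n (g x)) x| ≤ α x := fun n =>
    (hQc n).exists_pos_mul_le (hα.mono (hQP n))
      ((K.hasDerivWithinAt_and_continuousOn_lineDeriv hL hP (hfg n)).2.mono
        (fun x hx => ⟨hPdom (hQP n hx), hQP n hx⟩))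
      (fun x hx => hα0 x (hQP n hx))
  choose c₁ hc₁ hc₁' using hc1
  choose c₂ hc₂ hc₂' using hc2
  set c : ℕ → ℝ := fun n => min (c₁ n) (c₂ n * (1 / 2) ^ (n + 2))
  have hcpos : ∀ n, 0 < c n := fun n =>
    lt_min (hc₁ n) (mul_pos (hc₂ n) (by positivity))
  have hmem : ∀ n x, x ∈ tsupport (f n) → x ∈ X (n + 1) := fun n x hx =>
    interior_subset (hf n hx)
  have hsum : ∀ x, ∑ᶠ i, f i x • c i = ∑ i ∈ f.finsupport x, f i x * c i := fun x =>
    (f.sum_finsupport_smul_eq_finsum x (fun i _ => c i)).symm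
  have hsupp : ∀ x i, i ∈ f.finsupport x ↔ f i x ≠ 0 := fun x i => by
    rw [SmoothPartitionOfUnity.mem_finsupport]; rfl
  refine ⟨fun x => ∑ᶠ i, f i x • c i, f.contMDiff_finsum_smul (fun i x _ => contMDiffAt_const),
    fun x => ⟨?_, ?_⟩, fun x hx => ?_⟩
  · beta_reduce
    rw [hsum]
    obtain ⟨i, hi⟩ := f.exists_pos_of_mem (mem_univ x)
    exact Finset.sum_pos' (fun i _ => mul_nonneg (f.nonneg i x) (hcpos i).le)
      ⟨i, (hsupp x i).2 hi.ne', mul_pos hi (hcpos i)⟩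
  · beta_reduce
    rw [hsum]
    calc ∑ i ∈ f.finsupport x, f i x * c i ≤ ∑ i ∈ f.finsupport x, f i x * e x := by
          refine Finset.sum_le_sum (fun i hi => ?_)
          have := hc₁' i x (hmem i x (subset_tsupport _ ((hsupp x i).1 hi)))
          have h2 : c i ≤ c₁ i := min_le_left _ _
          have := f.nonneg i x
          gcongr
          simp only [abs_one, mul_one] at *
          linarith
      _ = e x := by rw [← Finset.sum_mul, f.sum_finsupport x (mem_univ x), one_mul]
  · have hxP : x ∈ P := by
      obtain ⟨Q', hQ', -, h⟩ := hcomp {g x} isCompact_singleton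
      exact hQ' (h x hx rfl)
    set F := f.fintsupport (g x)
    have hgc : ContinuousAt g x := hg.continuousOn.continuousAt (hP.mem_nhds hxP)
    have heq : (fun x => ∑ᶠ i, f i (g x) • c i) =ᶠ[𝓝 x] fun x => ∑ i ∈ F, f i (g x) * c i := by
      filter_upwards [hgc.eventually (f.eventually_finsupport_subset (g x))] with z hz
      rw [hsum]
      refine Finset.sum_subset hz (fun i _ hi => ?_)
      have : f i (g z) = 0 := by
        by_contra h
        exact hi ((hsupp _ i).2 h)
      rw [this, zero_mul]
    rw [K.lineDeriv_congr (hPdom hxP) heq]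
    have hd : HasDerivWithinAt (fun l => ∑ i ∈ F, f i (g (K.mov x l)) * c i)
        (∑ i ∈ F, K.lineDeriv (fun x => f i (g x)) x * c i) L (K.lev x) :=
      HasDerivWithinAt.fun_sum (fun i _ =>
        (K.hasDerivWithinAt_lineDeriv hL hP (hfg i) (hPdom hxP) hxP).mul_const _)
    rw [lineDeriv, hd.derivWithin (hL _ (K.lev_mem x (hPdom hxP)))]
    have hαx := hα0 x hxP
    calc |∑ i ∈ F, K.lineDeriv (fun x => f i (g x)) x * c i|
        ≤ ∑ i ∈ F, |K.lineDeriv (fun x => f i (g x)) x * c i| := Finset.abs_sum_le_sum_abs _ _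
      _ ≤ ∑ i ∈ F, α x * (1 / 2) ^ (i + 2) := by
          refine Finset.sum_le_sum (fun i hi => ?_)
          have h1 := hc₂' i x (hQ i x hx (hmem i _ ((f.mem_fintsupport_iff _ i).1 hi)))
          have h2 : c i ≤ c₂ i * (1 / 2) ^ (i + 2) := min_le_right _ _
          rw [abs_mul, abs_of_pos (hcpos i)]
          calc |K.lineDeriv (fun x => f i (g x)) x| * c i
              ≤ |K.lineDeriv (fun x => f i (g x)) x| * (c₂ i * (1 / 2) ^ (i + 2)) := by gcongr
            _ = (c₂ i * |K.lineDeriv (fun x => f i (g x)) x|) * (1 / 2) ^ (i + 2) := by ring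
            _ ≤ α x * (1 / 2) ^ (i + 2) := by gcongr
      _ = α x * ((1 / 4) * ∑ i ∈ F, (1 / 2 : ℝ) ^ i) := by
          rw [Finset.mul_sum, Finset.mul_sum]
          exact Finset.sum_congr rfl (fun i _ => by ring)
      _ ≤ α x * ((1 / 4) * 2) := by
          have := summable_geometric_two.sum_le_tsum F (fun i _ => by positivity)
          rw [tsum_geometric_two] at this
          gcongr
      _ < α x := by linarith

/-! ### Extending germs of diffeomorphisms along a collar -/

/-- A smooth decreasing function, `1` up to `1/3` and `0` from `2/3` on. -/
noncomputable def cutoff (t : ℝ) : ℝ := Real.smoothTransition (2 - 3 * t)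

theorem contDiff_cutoff : ContDiff ℝ ∞ cutoff :=
  Real.smoothTransition.contDiff.comp (contDiff_const.sub (contDiff_const.mul contDiff_id))

theorem cutoff_of_le {t : ℝ} (h : t ≤ 1 / 3) : cutoff t = 1 :=
  Real.smoothTransition.one_of_one_le (by linarith)

theorem cutoff_of_ge {t : ℝ} (h : 2 / 3 ≤ t) : cutoff t = 0 :=
  Real.smoothTransition.zero_of_nonpos (by linarith)

theorem cutoff_nonneg (t : ℝ) : 0 ≤ cutoff t := Real.smoothTransition.nonneg _

theorem cutoff_le_one (t : ℝ) : cutoff t ≤ 1 := Real.smoothTransition.le_one _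

theorem antitone_cutoff : Antitone cutoff := fun a b h =>
  Real.smoothTransition.monotone (by linarith)

namespace Collar

variable {E : Type*} [NormedAddCommGroup E] [NormedSpace ℝ E] {H : Type*} [TopologicalSpace H]
  {I : ModelWithCorners ℝ E H} {W : Type*} [TopologicalSpace W] [ChartedSpace H W]
  (K : Collar I W (Ico 0 1))

/-- Given a function `r` on a neighbourhood `D'` of the zero level which increases along the lines,
there is a diffeomorphism along the lines which near the zero level moves a point to the level
`c * r`, where `c` is a small function on the zero level. The function `lam` is a parameter: for
`lam = 0` the diffeomorphism is the identity. -/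
theorem exists_diffeomorph_normalize [IsManifold I ∞ W] {D' : Set W} (hD'o : IsOpen D')
    (hD' : D' ⊆ K.dom) (hD'half : ∀ x ∈ D', K.lev x < 1 / 2) {r c lam : W → ℝ}
    (hr : ContMDiffOn I 𝓘(ℝ, ℝ) ∞ r D') (hr0 : ∀ x ∈ D', 0 ≤ r x)
    (hrd : ∀ x ∈ D', 0 < K.lineDeriv r x) (hc : ContMDiff I 𝓘(ℝ, ℝ) ∞ c) (hc0 : ∀ x, 0 < c x)
    (hcr : ∀ x ∈ D', c (K.foot x) * r x ≤ K.lev x) (hlam : ContMDiff I 𝓘(ℝ, ℝ) ∞ lam)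
    (hlam01 : ∀ x, 0 ≤ lam x ∧ lam x ≤ 1)
    (hlamm : ∀ x ∈ K.dom, ∀ l ∈ Ico (0 : ℝ) 1, lam (K.mov x l) = lam x)
    (hcl : IsOpen (K.dom \ {x | x ∈ D' ∧ r x ≤ 2 / 3})) :
    ∃ τ : W ≃ₘ^∞⟮I, I⟯ W, (∀ x ∈ D', τ x = K.mov x ((1 - lam x * cutoff (r x)) * K.lev x +
      lam x * cutoff (r x) * (c (K.foot x) * r x))) ∧ (∀ x ∉ D', τ x = x) ∧
      ∀ x ∈ K.dom, ∃ l ∈ Ico (0 : ℝ) 1, τ x = K.mov x l := by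
  classical
  -- the level moves from `lev` to `c * r` as the cutoff moves from `0` to `1`
  set m₀ : W → ℝ := fun x => (1 - lam x * cutoff (r x)) * K.lev x +
      lam x * cutoff (r x) * (c (K.foot x) * r x) with hm₀
  set m : W → ℝ := fun x => if x ∈ D' then m₀ x else K.lev x with hm
  have hmD : ∀ x ∈ D', m x = m₀ x := fun x hx => if_pos hx
  have hmlev : EqOn m K.lev (K.dom \ {x | x ∈ D' ∧ r x ≤ 2 / 3}) := by
    intro x hx
    by_cases h : x ∈ D'
    · have : cutoff (r x) = 0 := cutoff_of_ge (by
        by_contra h'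
        exact hx.2 ⟨h, (not_le.1 h').le⟩)
      simp [hmD x h, hm₀, this]
    · exact if_neg h
  have hcut : ContMDiffOn I 𝓘(ℝ, ℝ) ∞ (fun x => lam x * cutoff (r x)) D' :=
    hlam.contMDiffOn.mul (contDiff_cutoff.contMDiff.comp_contMDiffOn hr)
  have hlev : ContMDiffOn I 𝓘(ℝ, ℝ) ∞ K.lev D' := K.smooth_lev.mono hD'
  have hm₀s : ContMDiffOn I 𝓘(ℝ, ℝ) ∞ m₀ D' :=
    ((contMDiffOn_const.sub hcut).mul hlev).add (hcut.mul
      ((hc.comp_contMDiffOn ((K.contMDiffOn_foot (by simp)).mono hD')).mul hr))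
  have hms : ContMDiffOn I 𝓘(ℝ, ℝ) ∞ m K.dom := by
    intro x hx
    by_cases h : x ∈ D'
    · exact ((hm₀s.congr hmD).contMDiffAt (hD'o.mem_nhds h)).contMDiffWithinAt
    · have hx' : x ∈ K.dom \ {x | x ∈ D' ∧ r x ≤ 2 / 3} := ⟨hx, fun h' => h h'.1⟩
      exact (((K.smooth_lev.mono sdiff_subset).congr hmlev).contMDiffAt
        (hcl.mem_nhds hx')).contMDiffWithinAt
  have hbound : ∀ x ∈ K.dom, 0 ≤ m x ∧ m x ≤ K.lev x := by
    intro x hx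
    have h1 := (K.lev_mem x hx).1
    by_cases h : x ∈ D'
    · rw [hmD x h]
      have ha : 0 ≤ lam x * cutoff (r x) := mul_nonneg (hlam01 x).1 (cutoff_nonneg _)
      have hb : lam x * cutoff (r x) ≤ 1 :=
        mul_le_one₀ (hlam01 x).2 (cutoff_nonneg _) (cutoff_le_one _)
      have h2 := mul_nonneg (hc0 (K.foot x)).le (hr0 x h)
      have h3 := hcr x h
      constructor
      · exact add_nonneg (mul_nonneg (sub_nonneg.2 hb) h1) (mul_nonneg ha h2)
      · have := mul_le_mul_of_nonneg_left h3 ha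
        simp only [hm₀]
        linarith
    · rw [show m x = K.lev x from if_neg h]
      exact ⟨h1, le_rfl⟩
  have hpos : ∀ x ∈ K.dom, 0 < K.lineDeriv m x := by
    intro x hx
    by_cases h : x ∈ D'
    · rw [K.lineDeriv_congr hx (show m =ᶠ[𝓝 x] m₀ by
        filter_upwards [hD'o.mem_nhds h] with y hy using hmD y hy)]
      have hA := K.hasDerivWithinAt_lineDeriv uniqueDiffOn_Ico_zero_one hD'o hr hx h
      set A' := K.lineDeriv r x
      set X' := deriv cutoff (r x)
      have hX : HasDerivWithinAt (fun l => lam x * cutoff (r (K.mov x l))) (lam x * (X' * A'))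
          (Ico 0 1) (K.lev x) := by
        have h1 : HasDerivAt cutoff X' (r (K.mov x (K.lev x))) := by
          rw [K.mov_lev x hx]
          exact (contDiff_cutoff.differentiable (by simp)).differentiableAt.hasDerivAt
        exact (HasDerivAt.comp_hasDerivWithinAt (h := fun l => r (K.mov x l)) (K.lev x) h1 hA).const_mul _
      have hd := (((hasDerivWithinAt_const (K.lev x) (Ico (0 : ℝ) 1) (1 : ℝ)).sub hX).mul
        (hasDerivWithinAt_id _ _)).add (hX.mul (hA.const_mul (c (K.foot x))))
      have hd' := hd.congr_of_mem (f₁ := fun l => m₀ (K.mov x l)) (fun l hl => by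
        simp only [hm₀, hlamm x hx l hl, K.lev_mov x hx l hl, K.foot_mov (by simp) hx hl,
          Pi.add_apply, Pi.mul_apply, Pi.sub_apply, id]) (K.lev_mem x hx)
      rw [lineDeriv, hd'.derivWithin (uniqueDiffOn_Ico_zero_one _ (K.lev_mem x hx))]
      simp only [K.mov_lev x hx, Pi.sub_apply, id]
      have hA' : 0 < A' := hrd x h
      have hX' : X' ≤ 0 := antitone_cutoff.deriv_nonpos
      have hl0 := (hlam01 x).1
      have h2 := hcr x h
      have hcx := hc0 (K.foot x)
      -- the cutoff decreases along the line while `c * r ≤ lev`, so this term helps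
      have e1 : 0 ≤ (lam x * (-X') * A') * (K.lev x - c (K.foot x) * r x) :=
        mul_nonneg (mul_nonneg (mul_nonneg hl0 (neg_nonneg.2 hX')) hA'.le) (sub_nonneg.2 h2)
      have e2 : 0 < (1 - lam x * cutoff (r x)) + lam x * cutoff (r x) * (c (K.foot x) * A') := by
        have ha : 0 ≤ lam x * cutoff (r x) := mul_nonneg hl0 (cutoff_nonneg _)
        have hb : lam x * cutoff (r x) ≤ 1 :=
          mul_le_one₀ (hlam01 x).2 (cutoff_nonneg _) (cutoff_le_one _)
        have hp : 0 < c (K.foot x) * A' := mul_pos hcx hA'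
        rcases hb.lt_or_eq with hlt | heq
        · exact add_pos_of_pos_of_nonneg (sub_pos.2 hlt) (mul_nonneg ha hp.le)
        · rw [heq]; linarith
      linarith
    · rw [K.lineDeriv_congr hx (show m =ᶠ[𝓝 x] K.lev by
        filter_upwards [hcl.mem_nhds ⟨hx, fun h' => h h'.1⟩] with y hy using hmlev hy),
        K.lineDeriv_lev uniqueDiffOn_Ico_zero_one hx]
      exact one_pos
  have hsurj : ∀ x ∈ K.dom, ∀ η ∈ Ico (0 : ℝ) 1, ∃ a ∈ Ico (0 : ℝ) 1, ∃ b ∈ Ico (0 : ℝ) 1,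
      m (K.mov x a) ≤ η ∧ η ≤ m (K.mov x b) := by
    intro x hx η hη
    have h0 : (0 : ℝ) ∈ Ico (0 : ℝ) 1 := by simp
    have hb : max η (1 / 2) ∈ Ico (0 : ℝ) 1 :=
      ⟨hη.1.trans (le_max_left _ _), max_lt hη.2 (by norm_num)⟩
    refine ⟨0, h0, max η (1 / 2), hb, ?_, ?_⟩
    · refine ((hbound _ (K.mov_mem x hx 0 h0)).2.trans_eq (K.lev_mov x hx 0 h0)).trans hη.1
    · have : m (K.mov x (max η (1 / 2))) = max η (1 / 2) := by
        rw [show m (K.mov x (max η (1 / 2))) = K.lev (K.mov x (max η (1 / 2))) from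
          if_neg (fun h' => (hD'half _ h').not_ge ?_), K.lev_mov x hx _ hb]
        rw [K.lev_mov x hx _ hb]
        exact le_max_right _ _
      rw [this]
      exact le_max_left _ _
  obtain ⟨τ, hτ, hτ'⟩ := K.exists_diffeomorph_fiberwise (convex_Ico 0 1)
    (by rw [interior_Ico]; exact nonempty_Ioo.2 one_pos) hms
    (fun x hx => ⟨(hbound x hx).1, (hbound x hx).2.trans_lt (K.lev_mem x hx).2⟩)
    (c₀ := 1 / 2) (by norm_num) (fun x hx h => by
      rw [abs_of_nonneg (K.lev_mem x hx).1] at h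
      exact if_neg (fun h' => (hD'half x h').not_ge h)) hpos hsurj
  refine ⟨τ, fun x hx => by rw [hτ x (hD' hx), hmD x hx], fun x hx => ?_, fun x hx =>
    ⟨m x, ⟨(hbound x hx).1, (hbound x hx).2.trans_lt (K.lev_mem x hx).2⟩, hτ x hx⟩⟩
  by_cases h : x ∈ K.dom
  · rw [hτ x h, show m x = K.lev x from if_neg hx, K.mov_lev x h]
  · exact hτ' x h

end Collar

namespace Collar

variable {E : Type*} [NormedAddCommGroup E] [NormedSpace ℝ E] {H : Type*} [TopologicalSpace H]
  {I : ModelWithCorners ℝ E H} {W : Type*} [TopologicalSpace W] [ChartedSpace H W]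
  (K : Collar I W (Ico 0 1))

/-- The map `x ↦ σ (point of level κ x on the line of x)`, moved back to the level of `x`. -/
def levelTransport (σ : W → W) (κ : W → ℝ) (x : W) : W :=
  K.mov (σ (K.mov x (κ x))) (K.lev x)

/-- A map of the inner third of a collar which preserves the level and the parameter `lam`, and is
the identity on the zero level. -/
structure LevelPreserving (σ : W → W) (lam : W → ℝ) : Prop where
  smooth : ContMDiffOn I I ∞ σ {x | x ∈ K.dom ∧ K.lev x < 1 / 3}
  mem : ∀ x ∈ K.dom, K.lev x < 1 / 3 → σ x ∈ K.dom
  lev : ∀ x ∈ K.dom, K.lev x < 1 / 3 → K.lev (σ x) = K.lev x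
  fix : ∀ x ∈ K.base, σ x = x
  lam : ∀ x ∈ K.dom, K.lev x < 1 / 3 → lam (σ x) = lam x

/-- The level at which a level-preserving map is read off in the construction of an extension: the
level itself for small levels and `lam = 1`, and `0` for levels from `2 / 9` on and for
`lam = 0`. -/
noncomputable def readLevel (lam : W → ℝ) (x : W) : ℝ :=
  lam x * cutoff (3 * K.lev x) * K.lev x

variable {K} {lam : W → ℝ}

theorem readLevel_bounds (hlam : ∀ x, 0 ≤ lam x ∧ lam x ≤ 1) {x : W} (hx : x ∈ K.dom) :
    0 ≤ K.readLevel lam x ∧ K.readLevel lam x ≤ K.lev x := by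
  have h0 := (K.lev_mem x hx).1
  have ha : 0 ≤ lam x * cutoff (3 * K.lev x) := mul_nonneg (hlam x).1 (cutoff_nonneg _)
  have hb : lam x * cutoff (3 * K.lev x) ≤ 1 :=
    mul_le_one₀ (hlam x).2 (cutoff_nonneg _) (cutoff_le_one _)
  exact ⟨mul_nonneg ha h0, mul_le_of_le_one_left h0 hb⟩

theorem readLevel_mem (hlam : ∀ x, 0 ≤ lam x ∧ lam x ≤ 1) {x : W} (hx : x ∈ K.dom) :
    K.readLevel lam x ∈ Ico (0 : ℝ) 1 :=
  ⟨(readLevel_bounds hlam hx).1, (readLevel_bounds hlam hx).2.trans_lt (K.lev_mem x hx).2⟩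

theorem levelTransport_of_readLevel_eq_zero {σ : W → W} (hσ : K.LevelPreserving σ lam) {x : W}
    (hx : x ∈ K.dom) (h : K.readLevel lam x = 0) :
    K.levelTransport σ (K.readLevel lam) x = x := by
  rw [levelTransport, h, show K.mov x 0 = K.foot x from rfl,
    hσ.fix _ (K.foot_mem_base (by simp) hx), K.mov_foot (by simp) hx (K.lev_mem x hx),
    K.mov_lev x hx]

/-- Moved back to the level where it was read off, the transported map is the given one. -/
theorem LevelPreserving.mem_and_mov_levelTransport (hlam : ∀ x, 0 ≤ lam x ∧ lam x ≤ 1)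
    (hlamm : ∀ x ∈ K.dom, ∀ l ∈ Ico (0 : ℝ) 1, lam (K.mov x l) = lam x) {σ : W → W}
    (hσ : K.LevelPreserving σ lam) {x : W} (hx : x ∈ K.dom) (hx3 : K.lev x < 1 / 3) :
    (K.levelTransport σ (K.readLevel lam) x ∈ K.dom ∧
      K.lev (K.levelTransport σ (K.readLevel lam) x) = K.lev x ∧
      lam (K.levelTransport σ (K.readLevel lam) x) = lam x) ∧
    K.mov (K.levelTransport σ (K.readLevel lam) x) (K.readLevel lam x) =
      σ (K.mov x (K.readLevel lam x)) := by
  have hκ := readLevel_mem hlam hx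
  have hw := K.mov_mem x hx _ hκ
  have hwl := K.lev_mov x hx _ hκ
  have hw3 : K.lev (K.mov x (K.readLevel lam x)) < 1 / 3 := by
    rw [hwl]; exact (readLevel_bounds hlam hx).2.trans_lt hx3
  have hsd := hσ.mem _ hw hw3
  refine ⟨⟨K.mov_mem _ hsd _ (K.lev_mem x hx), K.lev_mov _ hsd _ (K.lev_mem x hx), ?_⟩, ?_⟩
  · rw [levelTransport, hlamm _ hsd _ (K.lev_mem x hx), hσ.lam _ hw hw3, hlamm x hx _ hκ]
  · have : K.lev (σ (K.mov x (K.readLevel lam x))) = K.readLevel lam x := by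
      rw [hσ.lev _ hw hw3, hwl]
    rw [levelTransport, K.mov_mov _ hsd _ (K.lev_mem x hx) _ hκ]
    conv_lhs => arg 3; rw [← this]
    exact K.mov_lev _ hsd

theorem LevelPreserving.transport_transport (hlam : ∀ x, 0 ≤ lam x ∧ lam x ≤ 1)
    (hlamm : ∀ x ∈ K.dom, ∀ l ∈ Ico (0 : ℝ) 1, lam (K.mov x l) = lam x) {σ σ' : W → W}
    (hσ : K.LevelPreserving σ lam)
    (hinv : ∀ x ∈ K.dom, K.lev x < 1 / 3 → σ' (σ x) = x) {x : W} (hx : x ∈ K.dom)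
    (hx3 : K.lev x < 1 / 3) :
    K.levelTransport σ' (K.readLevel lam) (K.levelTransport σ (K.readLevel lam) x) = x := by
  have hκ := readLevel_mem hlam hx
  have hw3 : K.lev (K.mov x (K.readLevel lam x)) < 1 / 3 := by
    rw [K.lev_mov x hx _ hκ]; exact (readLevel_bounds hlam hx).2.trans_lt hx3
  obtain ⟨⟨-, h2, h3⟩, h4⟩ := hσ.mem_and_mov_levelTransport hlam hlamm hx hx3
  have h5 : K.readLevel lam (K.levelTransport σ (K.readLevel lam) x) = K.readLevel lam x := by
    rw [readLevel, h2, h3, readLevel]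
  rw [levelTransport, h5, h4, h2, hinv _ (K.mov_mem x hx _ hκ) hw3,
    K.mov_mov x hx _ hκ _ (K.lev_mem x hx), K.mov_lev x hx]

open Classical in
theorem LevelPreserving.contMDiff_transport (hlam : ∀ x, 0 ≤ lam x ∧ lam x ≤ 1)
    (hlams : ContMDiff I 𝓘(ℝ, ℝ) ∞ lam) {σ : W → W} (hσ : K.LevelPreserving σ lam) :
    ContMDiff I I ∞ (fun x => if x ∈ K.dom ∧ K.lev x < 1 / 3 then
      K.levelTransport σ (K.readLevel lam) x else x) := by
  have hO : IsOpen {x | x ∈ K.dom ∧ K.lev x < 1 / 3} :=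
    K.smooth_lev.continuousOn.isOpen_inter_preimage K.isOpen_dom isOpen_Iio
  refine contMDiff_of_isOpen_cover hO (K.closed (2 / 9) (by norm_num)).isOpen_compl
    (fun x => ?_) ?_ ?_
  · by_cases h : x ∈ K.dom ∧ K.lev x < 1 / 3
    · exact Or.inl h
    · refine Or.inr (fun h' => h ⟨h'.1, ?_⟩)
      have := (le_abs_self _).trans h'.2
      linarith
  · have hlev : ContMDiffOn I 𝓘(ℝ, ℝ) ∞ K.lev {x | x ∈ K.dom ∧ K.lev x < 1 / 3} :=
      K.smooth_lev.mono (fun x hx => hx.1)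
    have hκ : ContMDiffOn I 𝓘(ℝ, ℝ) ∞ (K.readLevel lam) {x | x ∈ K.dom ∧ K.lev x < 1 / 3} :=
      (hlams.contMDiffOn.mul (contDiff_cutoff.contMDiff.comp_contMDiffOn
        (contMDiffOn_const.mul hlev))).mul hlev
    have hw : ContMDiffOn I I ∞ (fun x => K.mov x (K.readLevel lam x))
        {x | x ∈ K.dom ∧ K.lev x < 1 / 3} :=
      K.contMDiffOn_mov contMDiffOn_id hκ (fun x hx => hx.1) (fun x hx => readLevel_mem hlam hx.1)
    have hw3 : ∀ x ∈ {x | x ∈ K.dom ∧ K.lev x < 1 / 3}, K.mov x (K.readLevel lam x) ∈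
        {x | x ∈ K.dom ∧ K.lev x < 1 / 3} := fun x hx => by
      have hκ := readLevel_mem hlam hx.1
      refine ⟨K.mov_mem x hx.1 _ hκ, ?_⟩
      rw [K.lev_mov x hx.1 _ hκ]
      exact (readLevel_bounds hlam hx.1).2.trans_lt hx.2
    have := K.contMDiffOn_mov (hσ.smooth.comp hw hw3) hlev
      (fun x hx => hσ.mem _ (hw3 x hx).1 (hw3 x hx).2) (fun x hx => K.lev_mem x hx.1)
    exact this.congr (fun x hx => if_pos hx)
  · refine contMDiffOn_id.congr (fun x hx => ?_)
    by_cases h : x ∈ K.dom ∧ K.lev x < 1 / 3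
    · rw [if_pos h]
      refine levelTransport_of_readLevel_eq_zero hσ h.1 ?_
      have h1 : 2 / 9 < K.lev x := by
        by_contra h'
        exact hx ⟨h.1, by rw [abs_of_nonneg (K.lev_mem x h.1).1]; exact not_lt.1 h'⟩
      rw [readLevel, cutoff_of_ge (by linarith)]
      simp
    · exact if_neg h

/-- A level-preserving diffeomorphism of the inner third of a collar can be cut off: on the level
`l` the cut-off diffeomorphism is what the given one is on a smaller level, and on the zero level
it is the identity. The amount of cutting off is controlled by the parameter `lam`. -/
theorem LevelPreserving.exists_diffeomorph (hlam : ∀ x, 0 ≤ lam x ∧ lam x ≤ 1)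
    (hlams : ContMDiff I 𝓘(ℝ, ℝ) ∞ lam)
    (hlamm : ∀ x ∈ K.dom, ∀ l ∈ Ico (0 : ℝ) 1, lam (K.mov x l) = lam x) {σ σ' : W → W}
    (hσ : K.LevelPreserving σ lam) (hσ' : K.LevelPreserving σ' lam)
    (hinv : ∀ x ∈ K.dom, K.lev x < 1 / 3 → σ' (σ x) = x)
    (hinv' : ∀ x ∈ K.dom, K.lev x < 1 / 3 → σ (σ' x) = x) :
    ∃ τ : W ≃ₘ^∞⟮I, I⟯ W, (∀ x ∈ K.dom, K.lev x ≤ 1 / 9 → lam x = 1 → τ x = σ x) ∧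
      (∀ x, lam x = 0 → τ x = x) ∧ (∀ x ∉ K.dom, τ x = x) ∧ (∀ x ∈ K.base, τ x = x) ∧
      (∀ x, lam (τ x) = lam x) ∧
      ∀ Z : Set W, (∀ x ∈ Z ∩ K.dom, ∀ l ∈ Ico (0 : ℝ) 1, K.mov x l ∈ Z) →
        (∀ x ∈ Z ∩ K.dom, K.lev x < 1 / 3 → σ x = x) → ∀ x ∈ Z, τ x = x := by
  classical
  have hin : ∀ x, x ∈ K.dom ∧ K.lev x < 1 / 3 →
      K.levelTransport σ (K.readLevel lam) x ∈ K.dom ∧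
        K.lev (K.levelTransport σ (K.readLevel lam) x) < 1 / 3 := fun x hx => by
    obtain ⟨⟨h1, h2, -⟩, -⟩ := hσ.mem_and_mov_levelTransport hlam hlamm hx.1 hx.2
    exact ⟨h1, h2 ▸ hx.2⟩
  have hin' : ∀ x, x ∈ K.dom ∧ K.lev x < 1 / 3 →
      K.levelTransport σ' (K.readLevel lam) x ∈ K.dom ∧
        K.lev (K.levelTransport σ' (K.readLevel lam) x) < 1 / 3 := fun x hx => by
    obtain ⟨⟨h1, h2, -⟩, -⟩ := hσ'.mem_and_mov_levelTransport hlam hlamm hx.1 hx.2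
    exact ⟨h1, h2 ▸ hx.2⟩
  have hzero : ∀ x, x ∈ K.dom → K.readLevel lam x = 0 →
      (if x ∈ K.dom ∧ K.lev x < 1 / 3 then K.levelTransport σ (K.readLevel lam) x else x) = x :=
    fun x hx h => by
      by_cases h3 : x ∈ K.dom ∧ K.lev x < 1 / 3
      · rw [if_pos h3, levelTransport_of_readLevel_eq_zero hσ hx h]
      · exact if_neg h3
  refine ⟨⟨⟨fun x => if x ∈ K.dom ∧ K.lev x < 1 / 3 then
      K.levelTransport σ (K.readLevel lam) x else x,
    fun x => if x ∈ K.dom ∧ K.lev x < 1 / 3 then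
      K.levelTransport σ' (K.readLevel lam) x else x, fun x => ?_, fun x => ?_⟩,
    hσ.contMDiff_transport hlam hlams, hσ'.contMDiff_transport hlam hlams⟩, ?_, ?_, ?_, ?_, ?_, ?_⟩
  · by_cases h : x ∈ K.dom ∧ K.lev x < 1 / 3
    · beta_reduce
      rw [if_pos h, if_pos (hin x h), hσ.transport_transport hlam hlamm hinv h.1 h.2]
    · simp only [if_neg h]
  · by_cases h : x ∈ K.dom ∧ K.lev x < 1 / 3
    · beta_reduce
      rw [if_pos h, if_pos (hin' x h), hσ'.transport_transport hlam hlamm hinv' h.1 h.2]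
    · simp only [if_neg h]
  · intro x hx hx9 hl
    have h3 : x ∈ K.dom ∧ K.lev x < 1 / 3 := ⟨hx, by linarith⟩
    refine (if_pos h3).trans ?_
    have hκ : K.readLevel lam x = K.lev x := by
      rw [readLevel, hl, cutoff_of_le (by linarith), one_mul, one_mul]
    rw [levelTransport, hκ, K.mov_lev x hx, ← hσ.lev x hx h3.2, K.mov_lev _ (hσ.mem x hx h3.2)]
  · intro x hl
    by_cases hx : x ∈ K.dom
    · exact hzero x hx (by rw [readLevel, hl, zero_mul, zero_mul])
    · exact if_neg (fun h => hx h.1)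
  · intro x hx
    exact if_neg (fun h => hx h.1)
  · intro x hx
    exact hzero x hx.1 (by rw [readLevel, hx.2, mul_zero])
  · intro x
    change lam (if x ∈ K.dom ∧ K.lev x < 1 / 3 then _ else _) = _
    by_cases h : x ∈ K.dom ∧ K.lev x < 1 / 3
    · rw [if_pos h, (hσ.mem_and_mov_levelTransport hlam hlamm h.1 h.2).1.2.2]
    · rw [if_neg h]
  · intro Z hZ hZσ x hx
    by_cases h : x ∈ K.dom ∧ K.lev x < 1 / 3
    · refine (if_pos h).trans ?_
      have hκ := readLevel_mem hlam h.1
      rw [levelTransport, hZσ _ ⟨hZ x ⟨hx, h.1⟩ _ hκ, K.mov_mem x h.1 _ hκ⟩ (by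
        rw [K.lev_mov x h.1 _ hκ]; exact (readLevel_bounds hlam h.1).2.trans_lt h.2),
        K.mov_mov x h.1 _ hκ _ (K.lev_mem x h.1), K.mov_lev x h.1]
    · exact if_neg h

end Collar

namespace Collar

variable {E : Type*} [NormedAddCommGroup E] [NormedSpace ℝ E] [FiniteDimensional ℝ E]
  {H : Type*} [TopologicalSpace H] {I : ModelWithCorners ℝ E H} {W : Type*} [TopologicalSpace W]
  [ChartedSpace H W] [IsManifold I ∞ W] [SigmaCompactSpace W] [T2Space W]
  (K : Collar I W (Ico 0 1))

/-- A germ along the zero level of a collar can be made to increase the relative level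
`lev / ε` along the lines, by the choice of a thin tube `lev < ε`. -/
theorem exists_thin_tube (φ : OpenPartialHomeomorph W W)
    (hφ : ContMDiffOn I I ∞ φ φ.source) (hφ' : ContMDiffOn I I ∞ φ.symm φ.target)
    (hdom : K.dom ⊆ φ.source) (hfix : ∀ x ∈ K.base, φ x = x) {N : Set W} (hN : IsOpen N)
    (hbN : K.base ⊆ N) :
    ∃ ε : W → ℝ, ContMDiff I 𝓘(ℝ, ℝ) ∞ ε ∧ (∀ x, 0 < ε x ∧ ε x ≤ 1 / 2) ∧
      ∀ z ∈ K.dom, K.lev z < ε (K.foot z) → z ∈ N ∧ z ∈ φ.target ∧ φ.symm z ∈ K.dom ∩ N ∧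
        K.lev (φ.symm z) < 1 / 2 ∧
        0 < K.lineDeriv (fun x => K.lev (φ x) / ε (K.foot (φ x))) (φ.symm z) := by
  have h0 : (0 : ℝ) ∈ Ico (0 : ℝ) 1 := by simp
  have hbs : K.base ⊆ φ.source := fun x hx => hdom hx.1
  set O : Set W := K.dom ∩ (φ.source ∩ φ ⁻¹' (K.dom ∩ N)) with hOdef
  have hO : IsOpen O :=
    K.isOpen_dom.inter (φ.isOpen_inter_preimage (K.isOpen_dom.inter hN))
  have hφO : ContMDiffOn I I ∞ φ O := hφ.mono (fun x hx => hx.2.1)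
  have hlevφ : ContMDiffOn I 𝓘(ℝ, ℝ) ∞ (fun x => K.lev (φ x)) O :=
    K.smooth_lev.comp hφO (fun x hx => hx.2.2.1)
  -- on `P` the level of the image increases along the lines, at the speed `α`
  set α : W → ℝ := K.lineDeriv (fun x => K.lev (φ x)) with hα
  have hαc : ContinuousOn α O :=
    (K.hasDerivWithinAt_and_continuousOn_lineDeriv uniqueDiffOn_Ico_zero_one hO hlevφ).2.mono
      (fun x hx => ⟨hx.1, hx⟩)
  set P : Set W := (O ∩ α ⁻¹' Ioi 0) ∩ (K.dom ∩ K.lev ⁻¹' Iio (1 / 2)) ∩ N with hPdef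
  have hPo : IsOpen P := ((hαc.isOpen_inter_preimage hO isOpen_Ioi).inter
    (K.smooth_lev.continuousOn.isOpen_inter_preimage K.isOpen_dom isOpen_Iio)).inter hN
  have hPO : P ⊆ O := fun x hx => hx.1.1.1
  have hbP : K.base ⊆ P := fun y hy =>
    ⟨⟨⟨⟨hy.1, hbs hy, by rw [mem_preimage, hfix y hy]; exact ⟨hy.1, hbN hy⟩⟩,
      K.lineDeriv_lev_comp_pos φ hφ hφ' hbs hfix hy⟩, hy.1, by
      rw [mem_preimage, hy.2]; norm_num⟩, hbN hy⟩
  -- the tube of thickness `e` is contained in the image of `P`; dividing the level by a function `ε`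
  -- with a small derivative keeps it increasing
  set G : Set W := φ.symm.source ∩ φ.symm ⁻¹' P with hG
  have hGo : IsOpen G := φ.symm.isOpen_inter_preimage hPo
  have hbG : K.base ⊆ G := fun y hy => by
    have h1 : φ.symm y = y := by
      conv_lhs => rw [← hfix y hy]
      exact φ.left_inv (hbs hy)
    have h2 : y ∈ φ.target := by
      have := φ.map_source (hbs hy)
      rwa [hfix y hy] at this
    exact ⟨h2, by rw [mem_preimage, h1]; exact hbP hy⟩
  obtain ⟨e, he, heG⟩ := K.exists_tube h0 hGo hbG (c₀ := 1 / 2) (by norm_num)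
  have hec : Continuous e := e.contMDiff.continuous
  have hg : ContMDiffOn I I ∞ (fun x => K.foot (φ x)) P :=
    (K.contMDiffOn_foot h0).comp (hφO.mono hPO) (fun x hx => (hPO hx).2.2.1)
  obtain ⟨ε, hεs, hε, hεd⟩ := K.exists_small_lineDeriv uniqueDiffOn_Ico_zero_one
    (e := fun x => e x / 2) (hec.div_const 2) (fun x => half_pos (he x).1)
    (P₀ := {x | x ∈ K.dom ∧ φ x ∈ K.dom ∧ K.lev (φ x) < e (K.foot (φ x)) / 2})
    hPo (fun x hx => (hPO hx).1) hg (hαc.mono hPO) (fun x hx => hx.1.1.2) (fun C hC => by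
      -- the part of the tube `lev ≤ e / 2` over `C` is compact, and so is its preimage under `φ`
      set T : Set (W × ℝ) := ((C ∩ K.base) ×ˢ Icc 0 1) ∩ {q | q.2 ≤ e q.1 / 2} with hT
      have hTc : IsCompact T := ((hC.inter_right K.isClosed_base).prod isCompact_Icc).inter_right
        (isClosed_le continuous_snd ((hec.comp continuous_fst).div_const 2))
      have hTs : T ⊆ K.dom ×ˢ Ico 0 1 := fun q hq =>
        ⟨hq.1.1.2.1, hq.1.2.1, by have h1 := hq.2; have h2 := (he q.1).2
                                  simp only [mem_ofPred_eq] at h1; linarith⟩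
      have hTG : MapsTo (fun q : W × ℝ => K.mov q.1 q.2) T G := fun q hq => by
        obtain ⟨hq1, hq2⟩ := hTs hq
        refine heG _ (K.mov_mem _ hq1 _ hq2) ?_
        rw [K.lev_mov _ hq1 _ hq2, K.foot_mov h0 hq1 hq2, K.foot_of_mem_base hq.1.1.2,
          abs_of_nonneg hq2.1]
        have h1 := hq.2
        have h2 := (he q.1).1
        simp only [mem_ofPred_eq] at h1
        linarith
      refine ⟨φ.symm '' ((fun q : W × ℝ => K.mov q.1 q.2) '' T), ?_, ?_, ?_⟩
      · rintro _ ⟨_, ⟨q, hq, rfl⟩, rfl⟩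
        exact (hTG hq).2
      · refine (hTc.image_of_continuousOn (K.smooth_mov.continuousOn.mono hTs)).image_of_continuousOn
          (φ.symm.continuousOn.mono ?_)
        rintro _ ⟨q, hq, rfl⟩
        exact (hTG hq).1
      · rintro x ⟨hx, hφx, hlt⟩ hxC
        refine ⟨φ x, ⟨(K.foot (φ x), K.lev (φ x)), ⟨⟨⟨hxC, K.foot_mem_base h0 hφx⟩,
          Ico_subset_Icc_self (K.lev_mem _ hφx)⟩, hlt.le⟩, ?_⟩, φ.left_inv (hdom hx)⟩
        change K.mov (K.foot (φ x)) (K.lev (φ x)) = φ x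
        rw [K.mov_foot h0 hφx (K.lev_mem _ hφx), K.mov_lev _ hφx])
  have hle : ∀ x, ε x ≤ 1 / 4 := fun x => by
    have h1 := (hε x).2
    have h2 := (he x).2
    linarith
  refine ⟨ε, hεs, fun x => ⟨(hε x).1, (hle x).trans (by norm_num)⟩, fun z hz hlt => ?_⟩
  have hlt2 : K.lev z < e (K.foot z) / 2 := hlt.trans_le (hε _).2
  have hzG : z ∈ G := heG z hz (by
    rw [abs_of_nonneg (K.lev_mem z hz).1]
    have := (he (K.foot z)).1
    linarith)
  have hzt : z ∈ φ.target := hzG.1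
  have hr : φ (φ.symm z) = z := φ.right_inv hzt
  have hxP : φ.symm z ∈ P := hzG.2
  set x := φ.symm z with hx
  have hxO := hPO hxP
  have hzN : z ∈ N := by
    have := hxO.2.2.2
    rwa [hr] at this
  refine ⟨hzN, hzt, ⟨hxO.1, hxP.2⟩, hxP.1.2.2, ?_⟩
  have hα0 : 0 < α x := hxP.1.1.2
  have hb := hεd x ⟨hxO.1, by rwa [hr], by rwa [hr]⟩
  have hdl := K.hasDerivWithinAt_lineDeriv uniqueDiffOn_Ico_zero_one hO hlevφ hxO.1 hxO
  have hdε := K.hasDerivWithinAt_lineDeriv uniqueDiffOn_Ico_zero_one hPo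
    (f := fun x => ε (K.foot (φ x))) (hεs.comp_contMDiffOn hg) hxO.1 hxP
  -- the quotient rule: the derivative of `ε` is at most `α`, and the level is below `ε`
  have hd := hdl.fun_div hdε (hε _).1.ne'
  rw [lineDeriv, hd.derivWithin (uniqueDiffOn_Ico_zero_one _ (K.lev_mem x hxO.1))]
  simp only [K.mov_lev x hxO.1, hr]
  have hεz := (hε (K.foot z)).1
  refine div_pos ?_ (by positivity)
  have hE : K.lineDeriv (fun x => ε (K.foot (φ x))) x ≤ α x := (le_abs_self _).trans hb.le
  have hlz := (K.lev_mem z hz).1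
  have h1 : K.lev z * K.lineDeriv (fun x => ε (K.foot (φ x))) x ≤ K.lev z * α x := by gcongr
  have h2 : K.lev z * α x < ε (K.foot z) * α x := by gcongr
  change 0 < α x * _ - _
  linarith

/-- A function which vanishes on the zero level and is below `1` on `D'` is below a large multiple
of the level. -/
theorem exists_slope_bound {r : W → ℝ} {O D' : Set W} (hO : IsOpen O) (hbO : K.base ⊆ O)
    (hr : ContMDiffOn I 𝓘(ℝ, ℝ) ∞ r O) (hr0 : ∀ x ∈ K.base, r x = 0)
    (hr1 : ∀ x ∈ D', 0 ≤ r x ∧ r x < 1) {ε : W → ℝ} (hε : Continuous ε) (hε0 : ∀ x, 0 < ε x) :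
    ∃ c : W → ℝ, ContMDiff I 𝓘(ℝ, ℝ) ∞ c ∧ (∀ x, 0 < c x ∧ c x ≤ ε x) ∧
      ∀ x ∈ K.dom, x ∈ D' → c (K.foot x) * r x ≤ K.lev x := by
  have h0 : (0 : ℝ) ∈ Ico (0 : ℝ) 1 := by simp
  set t : W → Set ℝ := fun y => {c : ℝ | 0 < c ∧ c ≤ ε y ∧
    (y ∈ K.base → ∀ l ∈ Ico (0 : ℝ) 1, K.mov y l ∈ D' → c * r (K.mov y l) ≤ l)}
  have hconv : ∀ y, Convex ℝ (t y) := fun y => by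
    refine Set.OrdConnected.convex ⟨fun a ha b hb c hc => ⟨ha.1.trans_le hc.1,
      hc.2.trans hb.2.1, fun hy l hl hD => ?_⟩⟩
    exact (mul_le_mul_of_nonneg_right hc.2 (hr1 _ hD).1).trans (hb.2.2 hy l hl hD)
  have hloc : ∀ x, ∃ c, ∀ᶠ y in 𝓝 x, c ∈ t y := fun x => by
    have hεx : ∀ᶠ y in 𝓝 x, ε x / 2 < ε y :=
      hε.continuousAt.eventually (lt_mem_nhds (half_lt_self (hε0 x)))
    have hε2 := half_pos (hε0 x)
    by_cases hx : x ∈ K.base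
    · obtain ⟨C, hC, δ, hδ, h⟩ := K.exists_linear_bound hO hr hr0 hx (hbO hx)
      refine ⟨min (1 / C) (min δ (ε x / 2)), ?_⟩
      filter_upwards [h, hεx] with y hy hεy
      refine ⟨lt_min (by positivity) (lt_min hδ hε2),
        ((min_le_right _ _).trans (min_le_right _ _)).trans hεy.le, fun hyb l hl hD => ?_⟩
      obtain ⟨hr0', hr1'⟩ := hr1 _ hD
      rcases lt_or_ge l δ with hlδ | hlδ
      · calc _ ≤ 1 / C * r (K.mov y l) := mul_le_mul_of_nonneg_right (min_le_left _ _) hr0'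
          _ ≤ 1 / C * (C * l) := by
            have := (hy hyb l hl hlδ).2
            gcongr
          _ = l := by field_simp
      · calc _ ≤ δ * r (K.mov y l) :=
              mul_le_mul_of_nonneg_right ((min_le_right _ _).trans (min_le_left _ _)) hr0'
          _ ≤ δ * 1 := by gcongr
          _ ≤ l := by linarith
    · refine ⟨ε x / 2, ?_⟩
      filter_upwards [K.isClosed_base.isOpen_compl.mem_nhds hx, hεx] with y hy hεy
      exact ⟨hε2, hεy.le, fun h => (hy h).elim⟩
  obtain ⟨c, hc⟩ := exists_contMDiffMap_forall_mem_convex_of_local_const (n := ⊤) I hconv hloc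
  refine ⟨c, c.contMDiff, fun x => ⟨(hc x).1, (hc x).2.1⟩, fun x hx hD => ?_⟩
  have h1 := K.lev_mem x hx
  have := (hc (K.foot x)).2.2 (K.foot_mem_base h0 hx) _ h1
  rw [K.mov_foot h0 hx h1, K.mov_lev x hx] at this
  exact this hD

end Collar

namespace Collar

variable {E : Type*} [NormedAddCommGroup E] [NormedSpace ℝ E]
  {H : Type*} [TopologicalSpace H] {I : ModelWithCorners ℝ E H} {W : Type*} [TopologicalSpace W]
  [ChartedSpace H W]

open Classical in
/-- The level function of a collar, extended by `1`, is continuous. -/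
theorem continuous_extended_lev (K : Collar I W (Ico 0 1)) :
    Continuous (fun x => if x ∈ K.dom then K.lev x else 1) := by
  refine continuous_iff_continuousAt.2 (fun x => ?_)
  by_cases hx : x ∈ K.dom
  · refine (K.smooth_lev.continuousOn.continuousAt (K.isOpen_dom.mem_nhds hx)).congr ?_
    filter_upwards [K.isOpen_dom.mem_nhds hx] with y hy
    exact (if_pos hy).symm
  · rw [ContinuousAt, if_neg hx]
    refine tendsto_order.2 ⟨fun a ha => ?_, fun a ha => ?_⟩
    · filter_upwards [(K.closed a ha).isOpen_compl.mem_nhds (fun h => hx h.1)] with y hy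
      by_cases hyd : y ∈ K.dom
      · rw [if_pos hyd]
        by_contra h
        exact hy ⟨hyd, by rw [abs_of_nonneg (K.lev_mem y hyd).1]; exact not_lt.1 h⟩
      · rwa [if_neg hyd]
    · refine Filter.Eventually.of_forall (fun y => ?_)
      by_cases hyd : y ∈ K.dom
      · rw [if_pos hyd]; exact (K.lev_mem y hyd).2.trans ha
      · rwa [if_neg hyd]

variable [FiniteDimensional ℝ E] [IsManifold I ∞ W] [SigmaCompactSpace W] [T2Space W]

/-- **Extension of germs.** A local diffeomorphism `φ` defined on a collar and fixing the zero level
agrees near the zero level with a diffeomorphism of the whole manifold. This diffeomorphism can be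
chosen to be supported in a given neighbourhood of the zero level, to depend on a parameter `lam`
(it extends `φ` where `lam = 1` and is the identity where `lam = 0`), and to be the identity on
those unions of lines on which `φ` is. -/
theorem exists_diffeomorph_of_germ (K : Collar I W (Ico 0 1)) (φ : OpenPartialHomeomorph W W)
    (hφ : ContMDiffOn I I ∞ φ φ.source) (hφ' : ContMDiffOn I I ∞ φ.symm φ.target)
    (hdom : K.dom ⊆ φ.source) (hfix : ∀ x ∈ K.base, φ x = x) {lam : W → ℝ}
    (hlams : ContMDiff I 𝓘(ℝ, ℝ) ∞ lam) (hlam : ∀ x, 0 ≤ lam x ∧ lam x ≤ 1)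
    (hlamm : ∀ x ∈ K.dom, ∀ l ∈ Ico (0 : ℝ) 1, lam (K.mov x l) = lam x)
    (hlamφ : ∀ x ∈ φ.source, lam (φ x) = lam x) {N : Set W} (hN : IsOpen N) (hbN : K.base ⊆ N) :
    ∃ k : W ≃ₘ^∞⟮I, I⟯ W,
      (∃ N', IsOpen N' ∧ K.base ⊆ N' ∧ ∀ x ∈ N', lam x = 1 → k x = φ x) ∧
      (∀ x, lam x = 0 → k x = x) ∧ (∀ x ∉ N, k x = x) ∧ (∀ x ∈ K.base, k x = x) ∧
      (∀ x, lam (k x) = lam x) ∧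
      ∀ Z : Set W, (∀ x ∈ Z ∩ K.dom, ∀ l ∈ Ico (0 : ℝ) 1, K.mov x l ∈ Z) →
        (∀ x ∈ Z ∩ N, φ x = x) → ∀ x ∈ Z, k x = x := by
  classical
  have h0 : (0 : ℝ) ∈ Ico (0 : ℝ) 1 := by simp
  -- Outline. On a thin tube `K'` let `r` be the relative level of `φ x`, which increases along the
  -- lines. The diffeomorphism `β` moves `x` along its line so that `r x` becomes the level, up to a
  -- factor `c`, and `α` does the same with the relative level of `x`. Then `σ = φ ∘ β⁻¹ ∘ α`
  -- preserves the relative level and is cut off to a diffeomorphism `τ`, and `τ ∘ αl⁻¹ ∘ βl` has the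
  -- germ `φ`, where `αl` and `βl` are versions of `α` and `β` with the parameter `lam`.
  obtain ⟨ε, hεs, hε, htube⟩ := K.exists_thin_tube φ hφ hφ' hdom hfix hN hbN
  have hε1 : ∀ x, 0 < ε x ∧ ε x ≤ 1 := fun x => ⟨(hε x).1, (hε x).2.trans (by norm_num)⟩
  set K' := K.shrink isLevelRange_Ico ε hεs hε1 with hK'
  have hdom' : ∀ {x}, x ∈ K'.dom → x ∈ K.dom ∧ K.lev x < ε (K.foot x) := fun {x} hx =>
    ⟨hx.1, (le_abs_self _).trans_lt hx.2⟩
  have hbase' : K'.base = K.base := by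
    ext x
    constructor
    · rintro ⟨h1, h2⟩
      refine ⟨h1.1, ?_⟩
      have h3 : K.lev x / ε (K.foot x) = 0 := h2
      exact (div_eq_zero_iff.1 h3).resolve_right (hε _).1.ne'
    · rintro ⟨h1, h2⟩
      refine ⟨⟨h1, ?_⟩, ?_⟩
      · rw [h2, abs_zero]; exact (hε _).1
      · change K.lev x / ε (K.foot x) = 0
        rw [h2, zero_div]
  -- `q x t` is the point of relative level `t` on the line of `x`
  set q : W → ℝ → W := fun x t => K.mov x (t * ε (K.foot x)) with hq
  have hqmem : ∀ x ∈ K.dom, ∀ t ∈ Ico (0 : ℝ) 1, t * ε (K.foot x) ∈ Ico (0 : ℝ) 1 :=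
    fun x _ t ht => isLevelRange_Ico.mul_mem_of_le (hε1 _) ht
  have hqlev : ∀ x ∈ K.dom, ∀ t ∈ Ico (0 : ℝ) 1, q x t ∈ K'.dom ∧ K'.lev (q x t) = t ∧
      K.foot (q x t) = K.foot x := fun x hx t ht => by
    have h1 := hqmem x hx t ht
    have h2 : K.foot (q x t) = K.foot x := K.foot_mov h0 hx h1
    have h3 : K.lev (q x t) = t * ε (K.foot x) := K.lev_mov x hx _ h1
    refine ⟨⟨K.mov_mem x hx _ h1, ?_⟩, ?_, h2⟩
    · rw [h2, h3, abs_of_nonneg h1.1]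
      exact mul_lt_of_lt_one_left (hε _).1 ht.2
    · change K.lev (q x t) / ε (K.foot (q x t)) = t
      rw [h2, h3, mul_div_cancel_right₀ _ (hε _).1.ne']
  set r : W → ℝ := fun x => K'.lev (φ x) with hr
  set D' : Set W := K.dom ∩ (φ.source ∩ φ ⁻¹' K'.dom) with hD'def
  have hD'o : IsOpen D' := K.isOpen_dom.inter (φ.isOpen_inter_preimage K'.isOpen_dom)
  have hD'mk : ∀ {x}, x ∈ K.dom → φ x ∈ K'.dom → x ∈ D' := fun hx h => ⟨hx, hdom hx, h⟩
  have hD' : ∀ x ∈ D', x ∈ K.dom ∧ φ x ∈ K'.dom ∧ x ∈ N ∧ K.lev x < 1 / 2 ∧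
      0 < K.lineDeriv r x ∧ r x ∈ Ico (0 : ℝ) 1 := fun x hx => by
    obtain ⟨hxd, hxs, hxφ⟩ := hx
    obtain ⟨-, -, h3, h4, h5⟩ := htube (φ x) (hdom' hxφ).1 (hdom' hxφ).2
    rw [φ.left_inv hxs] at h3 h4 h5
    exact ⟨hxd, hxφ, h3.2, h4, h5, K'.lev_mem _ hxφ⟩
  have hsymm : ∀ z ∈ K'.dom, z ∈ N ∧ z ∈ φ.target ∧ φ.symm z ∈ D' ∧ φ (φ.symm z) = z := by
    intro z hz
    obtain ⟨h1, h2, h3, -, -⟩ := htube z (hdom' hz).1 (hdom' hz).2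
    have h4 : φ (φ.symm z) = z := φ.right_inv h2
    exact ⟨h1, h2, hD'mk h3.1 (by rwa [h4]), h4⟩
  have hbD' : K.base ⊆ D' := fun x hx => hD'mk hx.1 (by rw [hfix x hx]; exact (hbase' ▸ hx).1)
  have hrb : ∀ x ∈ K.base, r x = 0 := fun x hx => by
    simp only [hr, hfix x hx]
    exact (hbase' ▸ hx : x ∈ K'.base).2
  have hrs : ContMDiffOn I 𝓘(ℝ, ℝ) ∞ r D' :=
    K'.smooth_lev.comp (hφ.mono (fun x hx => hx.2.1)) (fun x hx => hx.2.2)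
  obtain ⟨c, hcs, hc, hcr⟩ := K.exists_slope_bound hD'o hbD' hrs hrb
    (fun x hx => (hD' x hx).2.2.2.2.2) hεs.continuous (fun x => (hε x).1)
  -- the two regions where the normalizations are not yet standard are closed in the collar
  have hcl := K'.closed (2 / 3) (by norm_num)
  have hclr : IsOpen (K.dom \ {x | x ∈ D' ∧ r x ≤ 2 / 3}) := by
    convert! K.isOpen_dom.inter (φ.isOpen_inter_preimage hcl.isOpen_compl) using 1
    ext x
    constructor
    · rintro ⟨h1, h2⟩
      exact ⟨h1, hdom h1, fun h3 => h2 ⟨hD'mk h1 h3.1, (le_abs_self _).trans h3.2⟩⟩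
    · rintro ⟨h1, -, h2⟩
      refine ⟨h1, fun h3 => h2 ⟨h3.1.2.2, ?_⟩⟩
      rw [abs_of_nonneg (K'.lev_mem _ h3.1.2.2).1]
      exact h3.2
  have hclh : IsOpen (K.dom \ {x | x ∈ K'.dom ∧ K'.lev x ≤ 2 / 3}) := by
    convert! K.isOpen_dom.inter hcl.isOpen_compl using 1
    ext x
    constructor
    · rintro ⟨h1, h2⟩
      exact ⟨h1, fun h3 => h2 ⟨h3.1, (le_abs_self _).trans h3.2⟩⟩
    · rintro ⟨h1, h2⟩
      refine ⟨h1, fun h3 => h2 ⟨h3.1, ?_⟩⟩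
      rw [abs_of_nonneg (K'.lev_mem _ h3.1).1]
      exact h3.2
  have hhd : ∀ x ∈ K'.dom, 0 < K.lineDeriv K'.lev x := fun x hx => by
    have hxd := (hdom' hx).1
    have h1 : HasDerivWithinAt (fun l => l / ε (K.foot x)) (1 / ε (K.foot x)) (Ico (0 : ℝ) 1)
        (K.lev x) := (hasDerivWithinAt_id _ _).div_const _
    have h2 := h1.congr_of_mem (f₁ := fun l => K'.lev (K.mov x l)) (fun l hl => by
      change K.lev (K.mov x l) / ε (K.foot (K.mov x l)) = _
      rw [K.lev_mov x hxd l hl, K.foot_mov h0 hxd hl]) (K.lev_mem x hxd)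
    rw [lineDeriv, h2.derivWithin (uniqueDiffOn_Ico_zero_one _ (K.lev_mem x hxd))]
    exact one_div_pos.2 (hε _).1
  have hch : ∀ x ∈ K'.dom, c (K.foot x) * K'.lev x ≤ K.lev x := fun x hx => by
    have h1 : K'.lev x * ε (K.foot x) = K.lev x := div_mul_cancel₀ _ (hε _).1.ne'
    rw [← h1, mul_comm]
    exact mul_le_mul_of_nonneg_left (hc _).2 (K'.lev_mem x hx).1
  have hhalf : ∀ x ∈ K'.dom, K.lev x < 1 / 2 := fun x hx => (hdom' hx).2.trans_le (hε _).2
  have hone : ContMDiff I 𝓘(ℝ, ℝ) ∞ (fun _ : W => (1 : ℝ)) := contMDiff_const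
  obtain ⟨β, hβ, -, -⟩ := K.exists_diffeomorph_normalize hD'o (fun x hx => hx.1)
    (fun x hx => (hD' x hx).2.2.2.1) hrs (fun x hx => (hD' x hx).2.2.2.2.2.1)
    (fun x hx => (hD' x hx).2.2.2.2.1) hcs (fun x => (hc x).1)
    (fun x hx => hcr x hx.1 hx) hone (fun _ => ⟨zero_le_one, le_rfl⟩) (fun _ _ _ _ => rfl) hclr
  obtain ⟨α, hα, -, -⟩ := K.exists_diffeomorph_normalize K'.isOpen_dom (fun x hx => hx.1)
    hhalf K'.smooth_lev (fun x hx => (K'.lev_mem x hx).1)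
    hhd hcs (fun x => (hc x).1) hch hone (fun _ => ⟨zero_le_one, le_rfl⟩) (fun _ _ _ _ => rfl) hclh
  obtain ⟨βl, hβl, hβl', hβlm⟩ := K.exists_diffeomorph_normalize hD'o (fun x hx => hx.1)
    (fun x hx => (hD' x hx).2.2.2.1) hrs (fun x hx => (hD' x hx).2.2.2.2.2.1)
    (fun x hx => (hD' x hx).2.2.2.2.1) hcs (fun x => (hc x).1)
    (fun x hx => hcr x hx.1 hx) hlams hlam hlamm hclr
  obtain ⟨αl, hαl, hαl', hαlm⟩ := K.exists_diffeomorph_normalize K'.isOpen_dom (fun x hx => hx.1)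
    hhalf K'.smooth_lev (fun x hx => (K'.lev_mem x hx).1)
    hhd hcs (fun x => (hc x).1) hch hlams hlam hlamm hclh
  have hcrmem : ∀ x ∈ D', c (K.foot x) * r x ∈ Ico (0 : ℝ) 1 := fun x hx =>
    ⟨mul_nonneg (hc _).1.le (hD' x hx).2.2.2.2.2.1,
      (hcr x hx.1 hx).trans_lt (K.lev_mem x hx.1).2⟩
  -- near the zero level both normalizations move to the same multiple of the relative level
  have key : ∀ x ∈ D', r x < 1 / 3 → α (q x (r x)) = β x := fun x hx h3 => by
    have hrx := (hD' x hx).2.2.2.2.2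
    obtain ⟨h1, h2, h4⟩ := hqlev x hx.1 _ hrx
    rw [hα _ h1, hβ x hx, h2, h4, cutoff_of_le h3.le]
    simp only [mul_one, sub_self, zero_mul, zero_add, one_mul]
    exact K.mov_mov x hx.1 _ (hqmem x hx.1 _ hrx) _ (hcrmem x hx)
  have keyl : ∀ x ∈ D', r x < 1 / 3 → lam x = 1 → αl (q x (r x)) = βl x := fun x hx h3 hl => by
    have hrx := (hD' x hx).2.2.2.2.2
    obtain ⟨h1, h2, h4⟩ := hqlev x hx.1 _ hrx
    rw [hαl _ h1, hβl x hx, h2, h4, cutoff_of_le h3.le, hl, hlamm x hx.1 _ (hqmem x hx.1 _ hrx), hl]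
    simp only [mul_one, sub_self, zero_mul, zero_add, one_mul]
    exact K.mov_mov x hx.1 _ (hqmem x hx.1 _ hrx) _ (hcrmem x hx)
  -- every point of the tube is the point of relative level `r x` on the line of some `x`, by the
  -- intermediate value theorem on its line
  have hex : ∀ z ∈ K'.dom, ∃ x ∈ D', r x = K'.lev z ∧ z = q x (r x) := fun z hz => by
    have hzd := (hdom' hz).1
    have hsub : Icc (0 : ℝ) (1 / 2) ⊆ Ico 0 1 := fun l hl => ⟨hl.1, hl.2.trans_lt (by norm_num)⟩
    set g : ℝ → ℝ := fun l => if φ (K.mov z l) ∈ K'.dom then K'.lev (φ (K.mov z l)) else 1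
    have hg : ContinuousOn g (Icc 0 (1 / 2)) :=
      K'.continuous_extended_lev.comp_continuousOn (hφ.continuousOn.comp
        ((K.contMDiff_mov_const hzd).continuousOn.mono hsub)
        (fun l hl => hdom (K.mov_mem z hzd l (hsub hl))))
    have hft : K.foot z ∈ K.base := K.foot_mem_base h0 hzd
    have hg0 : g 0 = 0 := by
      have h1 : φ (K.mov z 0) ∈ K'.dom := (hbD' hft).2.2
      simp only [g, if_pos h1]
      exact hrb _ hft
    have hhm : (1 / 2 : ℝ) ∈ Ico (0 : ℝ) 1 := by constructor <;> norm_num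
    have hg1 : g (1 / 2) = 1 := if_neg (fun h => by
      have h1 := (hD' _ (hD'mk (K.mov_mem z hzd _ hhm) h)).2.2.2.1
      rw [K.lev_mov z hzd _ hhm] at h1
      exact lt_irrefl _ h1)
    have hzl := K'.lev_mem z hz
    obtain ⟨l, hl, hgl⟩ := intermediate_value_Icc (by norm_num : (0 : ℝ) ≤ 1 / 2) hg
      (show K'.lev z ∈ Icc (g 0) (g (1 / 2)) by
        rw [hg0, hg1]; exact Ico_subset_Icc_self hzl)
    have hφl : φ (K.mov z l) ∈ K'.dom := by
      by_contra h
      have : g l = 1 := if_neg h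
      rw [← hgl, this] at hzl
      exact lt_irrefl _ hzl.2
    have hrl : r (K.mov z l) = K'.lev z := by rw [← hgl]; exact (if_pos hφl).symm
    refine ⟨K.mov z l, hD'mk (K.mov_mem z hzd l (hsub hl)) hφl, hrl, ?_⟩
    have h1 : K'.lev z * ε (K.foot z) = K.lev z := div_mul_cancel₀ _ (hε _).1.ne'
    simp only [hq]
    rw [hrl, K.foot_mov h0 hzd (hsub hl), h1, K.mov_mov z hzd l (hsub hl) _ (K.lev_mem z hzd),
      K.mov_lev z hzd]
  set σ : W → W := fun z => φ (β.symm (α z)) with hσdef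
  set σ' : W → W := fun z => q (φ.symm z) (K'.lev z) with hσ'def
  have hσq : ∀ x ∈ D', r x < 1 / 3 → σ (q x (r x)) = φ x := fun x hx h3 => by
    simp only [hσdef, key x hx h3, β.symm_apply_apply]
  have hβsymm : ∀ x ∈ D', r x < 1 / 3 → β.symm (α (q x (r x))) = x := fun x hx h3 => by
    rw [key x hx h3, β.symm_apply_apply]
  have hq0 : ∀ x ∈ K.base, q x 0 = x := fun x hx => by
    simp only [hq, zero_mul]
    exact K.foot_of_mem_base hx
  have hσL : K'.LevelPreserving σ lam := by
    refine ⟨?_, fun z hz h3 => ?_, fun z hz h3 => ?_, fun z hz => ?_, fun z hz h3 => ?_⟩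
    · refine hφ.comp ((β.symm.contMDiff.comp α.contMDiff).contMDiffOn) (fun z hz => ?_)
      obtain ⟨x, hx, hrx, hzx⟩ := hex z hz.1
      have := hβsymm x hx (hrx ▸ hz.2)
      rw [← hzx] at this
      simp only [mem_preimage, this]
      exact hdom hx.1
    · obtain ⟨x, hx, hrx, hzx⟩ := hex z hz
      rw [hzx, hσq x hx (hrx ▸ h3)]
      exact hx.2.2
    · obtain ⟨x, hx, hrx, hzx⟩ := hex z hz
      conv_lhs => rw [hzx, hσq x hx (hrx ▸ h3)]
      exact hrx
    · rw [hbase'] at hz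
      have h1 := hσq z (hbD' hz) (by rw [hrb z hz]; norm_num)
      rwa [hrb z hz, hq0 z hz, hfix z hz] at h1
    · obtain ⟨x, hx, hrx, hzx⟩ := hex z hz
      conv_lhs => rw [hzx, hσq x hx (hrx ▸ h3), hlamφ x hx.2.1]
      rw [hzx]
      exact (hlamm x hx.1 _ (hqmem x hx.1 _ (hD' x hx).2.2.2.2.2)).symm
  have hσ'L : K'.LevelPreserving σ' lam := by
    refine ⟨?_, fun z hz h3 => ?_, fun z hz h3 => ?_, fun z hz => ?_, fun z hz h3 => ?_⟩
    · have h1 : ContMDiffOn I I ∞ φ.symm {x | x ∈ K'.dom ∧ K'.lev x < 1 / 3} :=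
        hφ'.mono (fun z hz => (hsymm z hz.1).2.1)
      have h2 : ∀ z ∈ {x | x ∈ K'.dom ∧ K'.lev x < 1 / 3}, φ.symm z ∈ K.dom :=
        fun z hz => (hsymm z hz.1).2.2.1.1
      refine K.contMDiffOn_mov h1 ((K'.smooth_lev.mono (fun z hz => hz.1)).mul
        (hεs.comp_contMDiffOn ((K.contMDiffOn_foot h0).comp h1 h2))) h2
        (fun z hz => hqmem _ (h2 z hz) _ (K'.lev_mem z hz.1))
    · exact (hqlev _ (hsymm z hz).2.2.1.1 _ (K'.lev_mem z hz)).1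
    · exact (hqlev _ (hsymm z hz).2.2.1.1 _ (K'.lev_mem z hz)).2.1
    · have hz' : z ∈ K.base := hbase' ▸ hz
      have h1 : φ.symm z = z := by
        conv_lhs => rw [← hfix z hz']
        exact φ.left_inv (hdom hz'.1)
      simp only [hσ'def, h1, hz.2, hq0 z hz']
    · obtain ⟨-, -, h1, h2⟩ := hsymm z hz
      simp only [hσ'def, hq]
      rw [hlamm _ h1.1 _ (hqmem _ h1.1 _ (K'.lev_mem z hz)), ← hlamφ _ h1.2.1, h2]
  have hinv : ∀ z ∈ K'.dom, K'.lev z < 1 / 3 → σ' (σ z) = z := fun z hz h3 => by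
    obtain ⟨x, hx, hrx, hzx⟩ := hex z hz
    conv_lhs => rw [hzx, hσq x hx (hrx ▸ h3)]
    simp only [hσ'def, φ.left_inv hx.2.1]
    exact hzx.symm
  have hinv' : ∀ z ∈ K'.dom, K'.lev z < 1 / 3 → σ (σ' z) = z := fun z hz h3 => by
    obtain ⟨-, -, h1, h2⟩ := hsymm z hz
    have h4 : r (φ.symm z) = K'.lev z := by simp only [hr, h2]
    have := hσq _ h1 (h4 ▸ h3)
    rwa [h4, h2] at this
  have hlamm' : ∀ x ∈ K'.dom, ∀ l ∈ Ico (0 : ℝ) 1, lam (K'.mov x l) = lam x := fun x hx l hl =>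
    hlamm x hx.1 _ (hqmem x hx.1 l hl)
  obtain ⟨τ, hτ1, hτ2, hτ3, hτ4, hτ5, hτ6⟩ :=
    hσL.exists_diffeomorph hlam hlams hlamm' hσ'L hinv hinv'
  have hτN : ∀ x ∉ N, τ x = x := fun x hx => hτ3 x (fun h => hx (hsymm x h).1)
  have hsym : ∀ x y, αl y = βl x → αl.symm (βl x) = y := fun x y h => by
    rw [← h, αl.symm_apply_apply]
  have hαlam : ∀ x, lam (αl x) = lam x := fun x => by
    by_cases hx : x ∈ K.dom
    · obtain ⟨l, hl, h⟩ := hαlm x hx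
      rw [h, hlamm x hx l hl]
    · rw [hαl' x (fun h => hx h.1)]
  have hβlam : ∀ x, lam (βl x) = lam x := fun x => by
    by_cases hx : x ∈ K.dom
    · obtain ⟨l, hl, h⟩ := hβlm x hx
      rw [h, hlamm x hx l hl]
    · rw [hβl' x (fun h => hx h.1)]
  have hαfix : ∀ x, (lam x = 0 ∨ x ∉ N ∨ x ∈ K.base) → αl x = x := fun x hx => by
    by_cases hxD : x ∈ K'.dom
    · rw [hαl x hxD]
      rcases hx with h | h | h
      · simp [h, K.mov_lev x hxD.1]
      · exact (h (hsymm x hxD).1).elim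
      · have h2 : K'.lev x = 0 := (hbase'.symm ▸ h : x ∈ K'.base).2
        rw [h2, h.2]
        simpa [foot] using K.foot_of_mem_base h
    · exact hαl' x hxD
  have hβfix : ∀ x, (lam x = 0 ∨ x ∉ N ∨ x ∈ K.base) → βl x = x := fun x hx => by
    by_cases hxD : x ∈ D'
    · rw [hβl x hxD]
      rcases hx with h | h | h
      · simp [h, K.mov_lev x hxD.1]
      · exact (h (hD' x hxD).2.2.1).elim
      · rw [hrb x h, h.2]
        simpa [foot] using K.foot_of_mem_base h
    · exact hβl' x hxD
  have hfixed : ∀ x, (lam x = 0 ∨ x ∉ N ∨ x ∈ K.base) → αl.symm (βl x) = x := fun x hx =>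
    hsym x x ((hαfix x hx).trans (hβfix x hx).symm)
  refine ⟨(βl.trans αl.symm).trans τ, ⟨D' ∩ r ⁻¹' Iio (1 / 9),
    hrs.continuousOn.isOpen_inter_preimage hD'o isOpen_Iio, fun x hx => ⟨hbD' hx, ?_⟩, ?_⟩,
    fun x hx => ?_, fun x hx => ?_, fun x hx => ?_, fun x => ?_, fun Z hZ hZφ x hx => ?_⟩
  · rw [mem_preimage, hrb x hx]; norm_num
  · rintro x ⟨hx, hx9⟩ hl
    rw [mem_preimage, mem_Iio] at hx9
    have hx3 : r x < 1 / 3 := by linarith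
    have hrx := (hD' x hx).2.2.2.2.2
    obtain ⟨h1, h2, -⟩ := hqlev x hx.1 _ hrx
    change τ (αl.symm (βl x)) = _
    rw [hsym x _ (keyl x hx hx3 hl), hτ1 _ h1 (by rw [h2]; exact hx9.le)
      (by rw [hlamm x hx.1 _ (hqmem x hx.1 _ hrx), hl]), hσq x hx hx3]
  · change τ (αl.symm (βl x)) = x
    rw [hfixed x (Or.inl hx), hτ2 x hx]
  · change τ (αl.symm (βl x)) = x
    rw [hfixed x (Or.inr (Or.inl hx)), hτN x hx]
  · change τ (αl.symm (βl x)) = x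
    rw [hfixed x (Or.inr (Or.inr hx)), hτ4 x (hbase' ▸ hx)]
  · change lam (τ (αl.symm (βl x))) = lam x
    rw [hτ5, ← hβlam x, ← hαlam (αl.symm (βl x)), αl.apply_symm_apply]
  · change τ (αl.symm (βl x)) = x
    -- where `φ` is the identity, both normalizations are the same and `σ` is the identity
    have hZD : ∀ x ∈ Z, (x ∈ D' ↔ x ∈ K'.dom) ∧ (x ∈ D' → φ x = x) := fun x hx => by
      have h1 : x ∈ D' → φ x = x := fun h => hZφ x ⟨hx, (hD' x h).2.2.1⟩
      refine ⟨⟨fun h => h1 h ▸ h.2.2, fun h => hD'mk h.1 ?_⟩, h1⟩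
      rwa [hZφ x ⟨hx, (hsymm x h).1⟩]
    have h1 : αl x = βl x := by
      by_cases h : x ∈ D'
      · have h2 : r x = K'.lev x := by simp only [hr, (hZD x hx).2 h]
        rw [hαl x ((hZD x hx).1.1 h), hβl x h, h2]
      · rw [hαl' x (fun h' => h ((hZD x hx).1.2 h')), hβl' x h]
    rw [hsym x x h1]
    refine hτ6 Z (fun y hy l hl => hZ y ⟨hy.1, hy.2.1⟩ _ (hqmem y hy.2.1 l hl))
      (fun y hy h3 => ?_) x hx
    have hyD := (hZD y hy.1).1.2 hy.2
    have h2 : r y = K'.lev y := by simp only [hr, (hZD y hy.1).2 hyD]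
    have h4 := hσq y hyD (h2 ▸ h3)
    have h5 : q y (r y) = y := by rw [h2]; exact K'.mov_lev y hy.2
    rwa [h5, (hZD y hy.1).2 hyD] at h4

end Collar

/-! ### Bicollars of two-sided hypersurfaces -/

section Hypersurface

variable {E : Type*} [NormedAddCommGroup E] [NormedSpace ℝ E] {N : Type*} [TopologicalSpace N]
  [ChartedSpace E N]

/-- The chart `ψ` straightens the domain `B` with boundary `A`: it maps `B` to the half space
`0 ≤ u` and `A` to the hyperplane `u = 0`, where `u` is a linear function with `u e = 1`. -/
structure IsHalfSpaceChart (A B : Set N) (ψ : OpenPartialHomeomorph N E) (u : E →L[ℝ] ℝ) (e : E) :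
    Prop where
  mem_maximalAtlas : ψ ∈ IsManifold.maximalAtlas 𝓘(ℝ, E) ∞ N
  apply_normal : u e = 1
  mem_hypersurface : ∀ z ∈ ψ.source, z ∈ A ↔ u (ψ z) = 0
  mem_domain : ∀ z ∈ ψ.source, z ∈ B ↔ 0 ≤ u (ψ z)

variable (E) in
/-- The set `B` is locally a half space along the closed set `A`, its boundary. -/
structure IsSmoothDomain (A B : Set N) : Prop where
  isClosed : IsClosed A
  exists_chart : ∀ p ∈ A, ∃ (ψ : OpenPartialHomeomorph N E) (u : E →L[ℝ] ℝ) (e : E),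
    p ∈ ψ.source ∧ IsHalfSpaceChart A B ψ u e

variable {A B : Set N}

theorem IsHalfSpaceChart.contMDiffOn {ψ : OpenPartialHomeomorph N E} {u : E →L[ℝ] ℝ} {e : E}
    (h : IsHalfSpaceChart A B ψ u e) : ContMDiffOn 𝓘(ℝ, E) 𝓘(ℝ, E) ∞ ψ ψ.source :=
  contMDiffOn_of_mem_maximalAtlas h.mem_maximalAtlas

theorem IsHalfSpaceChart.contMDiffOn_symm {ψ : OpenPartialHomeomorph N E} {u : E →L[ℝ] ℝ} {e : E}
    (h : IsHalfSpaceChart A B ψ u e) : ContMDiffOn 𝓘(ℝ, E) 𝓘(ℝ, E) ∞ ψ.symm ψ.target :=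
  contMDiffOn_symm_of_mem_maximalAtlas h.mem_maximalAtlas

variable [FiniteDimensional ℝ E] [IsManifold 𝓘(ℝ, E) ∞ N] [T2Space N] [SigmaCompactSpace N]

/-- A smooth map fixing the hypersurface, and projecting a neighbourhood of one point to it. -/
theorem IsSmoothDomain.exists_local_projection (hAB : IsSmoothDomain E A B)
    {p : N} (hp : p ∈ A) :
    ∃ q : N → N, ContMDiff 𝓘(ℝ, E) 𝓘(ℝ, E) ∞ q ∧ (∀ z ∈ A, q z = z) ∧ ∀ᶠ z in 𝓝 p, q z ∈ A := by
  classical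
  have : LocallyCompactSpace N := ChartedSpace.locallyCompactSpace E N
  obtain ⟨ψ, u, e, hpψ, hψ⟩ := hAB.exists_chart p hp
  have hu0 : u (ψ p) = 0 := (hψ.mem_hypersurface p hpψ).1 hp
  -- near `p`, partial projections along `e` stay in the chart
  obtain ⟨r, hr, hrt⟩ := Metric.isOpen_iff.1 ψ.open_target _ (ψ.map_source hpψ)
  have hV : ∀ᶠ z in 𝓝 p, z ∈ ψ.source ∧ ∀ t ∈ Icc (0 : ℝ) 1, ψ z - (t * u (ψ z)) • e ∈ ψ.target := by
    have hc : ContinuousAt ψ p := ψ.continuousAt hpψ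
    have h1 : ∀ᶠ z in 𝓝 p, ‖ψ z - ψ p‖ < r / 2 := by
      have := Metric.continuousAt_iff'.1 hc (r / 2) (half_pos hr)
      simpa only [dist_eq_norm] using this
    have h2 : ∀ᶠ z in 𝓝 p, |u (ψ z)| * ‖e‖ < r / 2 := by
      have h3 : ContinuousAt (fun z => |u (ψ z)| * ‖e‖) p :=
        ((u.continuous.continuousAt.comp hc).abs).mul_const _
      refine h3.eventually (gt_mem_nhds ?_)
      simpa only [hu0, abs_zero, zero_mul] using half_pos hr
    filter_upwards [h1, h2, ψ.open_source.mem_nhds hpψ] with z h3 h4 h5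
    refine ⟨h5, fun t ht => hrt ?_⟩
    rw [Metric.mem_ball, dist_eq_norm]
    calc ‖ψ z - (t * u (ψ z)) • e - ψ p‖ = ‖(ψ z - ψ p) - (t * u (ψ z)) • e‖ := by congr 1; abel
      _ ≤ ‖ψ z - ψ p‖ + ‖(t * u (ψ z)) • e‖ := norm_sub_le _ _
      _ ≤ ‖ψ z - ψ p‖ + |u (ψ z)| * ‖e‖ := by
          rw [norm_smul, Real.norm_eq_abs, abs_mul, abs_of_nonneg ht.1]
          have := mul_le_of_le_one_left (abs_nonneg (u (ψ z))) ht.2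
          gcongr
      _ < r := by linarith
  obtain ⟨V, hVs, hVo, hpV⟩ := eventually_nhds_iff.1 hV
  -- the amount `μ` of projection is `1` near `p` and vanishes outside `V`
  obtain ⟨t, htp, htc, htV⟩ := exists_mem_nhds_isClosed_subset (hVo.mem_nhds hpV)
  obtain ⟨μ, hμ1, hμ0, hμ⟩ := exists_contMDiffMap_one_nhds_of_subset_interior (n := ⊤) 𝓘(ℝ, E)
    (isClosed_singleton (x := p)) (singleton_subset_iff.2 (mem_interior_iff_mem_nhds.2 htp))
  rw [nhdsSet_singleton] at hμ1
  refine ⟨fun z => if z ∈ V then ψ.symm (ψ z - (μ z * u (ψ z)) • e) else z,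
    contMDiff_of_isOpen_cover hVo htc.isOpen_compl (fun z => ?_) ?_ ?_, fun z hz => ?_, ?_⟩
  · by_cases hz : z ∈ V
    · exact Or.inl hz
    · exact Or.inr (fun h => hz (htV h))
  · have h1 : ContMDiffOn 𝓘(ℝ, E) 𝓘(ℝ, E) ∞ ψ V := hψ.contMDiffOn.mono (fun z hz => (hVs z hz).1)
    have h2 : ContMDiffOn 𝓘(ℝ, E) 𝓘(ℝ, ℝ) ∞ (fun z => u (ψ z)) V :=
      u.contDiff.contMDiff.comp_contMDiffOn h1
    have h3 : ContMDiffOn 𝓘(ℝ, E) 𝓘(ℝ, E) ∞ (fun z => ψ z - (μ z * u (ψ z)) • e) V :=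
      h1.sub ((μ.contMDiff.contMDiffOn.mul h2).smul contMDiffOn_const)
    exact (hψ.contMDiffOn_symm.comp h3 (fun z hz => (hVs z hz).2 _ (hμ z))).congr
      (fun z hz => if_pos hz)
  · refine contMDiffOn_id.congr (fun z hz => ?_)
    by_cases hzV : z ∈ V
    · simp [hzV, hμ0 z hz, ψ.left_inv (hVs z hzV).1]
    · simp [hzV]
  · by_cases hzV : z ∈ V
    · simp [hzV, (hψ.mem_hypersurface z (hVs z hzV).1).1 hz, ψ.left_inv (hVs z hzV).1]
    · simp [hzV]
  · filter_upwards [hμ1, hVo.mem_nhds hpV] with z hz hzV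
    have h1 : ψ z - u (ψ z) • e ∈ ψ.target := by
      simpa using (hVs z hzV).2 1 (by simp)
    simp only [if_pos hzV, hz, one_mul]
    rw [hψ.mem_hypersurface _ (ψ.map_target h1), ψ.right_inv h1]
    simp [hψ.apply_normal]

/-- Projections to the hypersurface near its points, performed one after the other, give a
retraction of a neighbourhood of the hypersurface. -/
theorem IsSmoothDomain.exists_retraction [SecondCountableTopology N]
    (hAB : IsSmoothDomain E A B) :
    ∃ (O : Set N) (π : N → N), IsOpen O ∧ A ⊆ O ∧ ContMDiffOn 𝓘(ℝ, E) 𝓘(ℝ, E) ∞ π O ∧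
      (∀ z ∈ O, π z ∈ A) ∧ ∀ z ∈ A, π z = z := by
  classical
  choose! q hqs hqA hqn using fun p (hp : p ∈ A) => hAB.exists_local_projection hp
  obtain ⟨t, htA, htc, hcov⟩ := TopologicalSpace.countable_cover_nhdsWithin
    (s := A) (f := fun p => interior {z | q p z ∈ A})
    (fun p hp => mem_nhdsWithin_of_mem_nhds (interior_mem_nhds.2 (hqn p hp)))
  rcases t.eq_empty_or_nonempty with rfl | hne
  · simp only [mem_empty_iff_false, iUnion_of_empty, iUnion_empty, subset_empty_iff] at hcov
    subst hcov
    exact ⟨∅, id, isOpen_empty, subset_rfl, contMDiffOn_id, by simp, by simp⟩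
  obtain ⟨p, hp⟩ := htc.exists_eq_range hne
  have hpA : ∀ n, p n ∈ A := fun n => htA (hp ▸ mem_range_self n)
  set U : ℕ → Set N := fun n => interior {z | q (p n) z ∈ A}
  have hU : ∀ n z, z ∈ U n → q (p n) z ∈ A := fun n z hz =>
    (interior_subset hz : z ∈ {z | q (p n) z ∈ A})
  -- `Q n` performs the first `n` projections of a countable family, and `O n` consists of the points
  -- which the next one moves to the hypersurface
  set Q : ℕ → N → N := fun n => Nat.rec id (fun n f => q (p n) ∘ f) n
  have hQ : ∀ n z, Q (n + 1) z = q (p n) (Q n z) := fun n z => rfl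
  have hQs : ∀ n, ContMDiff 𝓘(ℝ, E) 𝓘(ℝ, E) ∞ (Q n) := fun n => by
    induction n with
    | zero => exact contMDiff_id
    | succ n ih => exact (hqs _ (hpA n)).comp ih
  have hQA : ∀ n, ∀ z ∈ A, Q n z = z := fun n z hz => by
    induction n with
    | zero => rfl
    | succ n ih => rw [hQ, ih, hqA _ (hpA n) z hz]
  set O : ℕ → Set N := fun n => Q n ⁻¹' U n
  have hO : ∀ n, IsOpen (O n) := fun n => isOpen_interior.preimage (hQs n).continuous
  have hOA : ∀ n, ∀ z ∈ O n, Q (n + 1) z ∈ A := fun n z hz => hU n _ hz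
  -- once a point has reached the hypersurface it stays there
  have hstab : ∀ n, ∀ z ∈ O n, ∀ k, Q (n + 1 + k) z = Q (n + 1) z := fun n z hz k => by
    induction k with
    | zero => rfl
    | succ k ih => rw [← add_assoc, hQ, ih, hqA _ (hpA _) _ (hOA n z hz)]
  have heq : ∀ m n z, z ∈ O m → z ∈ O n → Q (m + 1) z = Q (n + 1) z := fun m n z hm hn => by
    rcases le_total m n with h | h
    · obtain ⟨k, rfl⟩ := Nat.exists_eq_add_of_le h
      rw [← hstab m z hm k, show m + 1 + k = m + k + 1 by omega]
    · obtain ⟨k, rfl⟩ := Nat.exists_eq_add_of_le h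
      rw [← hstab n z hn k, show n + 1 + k = n + k + 1 by omega]
  have hsel : ∀ z, ∃ n, z ∈ (⋃ n, O n) → z ∈ O n := fun z => by
    by_cases h : z ∈ ⋃ n, O n
    · obtain ⟨n, hn⟩ := mem_iUnion.1 h
      exact ⟨n, fun _ => hn⟩
    · exact ⟨0, fun h' => (h h').elim⟩
  choose s hs using hsel
  refine ⟨⋃ n, O n, fun z => Q (s z + 1) z, isOpen_iUnion hO, fun z hz => ?_, fun z hz => ?_,
    fun z hz => hOA _ z (hs z hz), fun z hz => hQA (s z + 1) z hz⟩
  · obtain ⟨x, hx, hzx⟩ := mem_iUnion₂.1 (hcov hz)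
    rw [hp] at hx
    obtain ⟨n, rfl⟩ := hx
    refine mem_iUnion.2 ⟨n, ?_⟩
    change Q n z ∈ U n
    rw [hQA n z hz]
    exact hzx
  · obtain ⟨n, hn⟩ := mem_iUnion.1 hz
    refine ContMDiffAt.contMDiffWithinAt (((hQs (n + 1)).contMDiffAt).congr_of_eventuallyEq ?_)
    filter_upwards [(hO n).mem_nhds hn] with y hy
    exact heq _ _ y (hs y (mem_iUnion.2 ⟨n, hy⟩)) hy

/-- A function which is nonnegative on the domain, nonpositive outside, and increases across the
hypersurface. The last clause is stated in a chart at each point. -/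
theorem IsSmoothDomain.exists_defining_function (hAB : IsSmoothDomain E A B) :
    ∃ ρ : N → ℝ, ContMDiff 𝓘(ℝ, E) 𝓘(ℝ, ℝ) ∞ ρ ∧ (∀ z ∈ A, ρ z = 0) ∧ (∀ z ∈ B, 0 ≤ ρ z) ∧
      (∀ z ∉ B, ρ z ≤ 0) ∧
      ∀ p ∈ A, ∃ (ψ : OpenPartialHomeomorph N E) (u : E →L[ℝ] ℝ) (e : E), p ∈ ψ.source ∧
        IsHalfSpaceChart A B ψ u e ∧
        ∃ c > 0, ∀ᶠ t in 𝓝[>] (0 : ℝ), c * t ≤ ρ (ψ.symm (ψ p + t • e)) := by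
  classical
  choose ψ u e hpψ hψ using fun p : A => hAB.exists_chart p p.2
  obtain ⟨f, hf⟩ := SmoothPartitionOfUnity.exists_isSubordinate 𝓘(ℝ, E) hAB.isClosed
    (fun p : A => (ψ p).source) (fun p => (ψ p).open_source)
    (fun z hz => mem_iUnion.2 ⟨⟨z, hz⟩, hpψ ⟨z, hz⟩⟩)
  have hfs : ∀ i z, f i z ≠ 0 → z ∈ (ψ i).source := fun i z h => hf i (subset_tsupport _ h)
  have hsum : ∀ z, ∑ᶠ i, f i z • u i (ψ i z) = ∑ i ∈ f.finsupport z, f i z * u i (ψ i z) :=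
    fun z => (f.sum_finsupport_smul_eq_finsum z (fun i z => u i (ψ i z))).symm
  have hsupp : ∀ x i, i ∈ f.finsupport x ↔ f i x ≠ 0 := fun x i => by
    rw [SmoothPartitionOfUnity.mem_finsupport]; rfl
  refine ⟨fun z => ∑ᶠ i, f i z • u i (ψ i z), f.contMDiff_finsum_smul (fun i z hz => ?_),
    fun z hz => ?_, fun z hz => ?_, fun z hz => ?_, fun p hp => ?_⟩
  · exact (u i).contDiff.contMDiff.contMDiffAt.comp z
      ((hψ i).contMDiffOn.contMDiffAt ((ψ i).open_source.mem_nhds (hf i hz)))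
  · beta_reduce
    rw [hsum]
    refine Finset.sum_eq_zero (fun i hi => ?_)
    rw [((hψ i).mem_hypersurface z (hfs i z ((hsupp z i).1 hi))).1 hz, mul_zero]
  · beta_reduce
    rw [hsum]
    exact Finset.sum_nonneg (fun i hi => mul_nonneg (f.nonneg i z)
      (((hψ i).mem_domain z (hfs i z ((hsupp z i).1 hi))).1 hz))
  · beta_reduce
    rw [hsum]
    refine Finset.sum_nonpos (fun i hi => mul_nonpos_of_nonneg_of_nonpos (f.nonneg i z) ?_)
    have := mt ((hψ i).mem_domain z (hfs i z ((hsupp z i).1 hi))).2 hz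
    exact (not_le.1 this).le
  · obtain ⟨i, hi⟩ := f.exists_pos_of_mem hp
    have hpi := hfs i p hi.ne'
    refine ⟨ψ i, u i, e i, hpi, hψ i, f i p / 2, half_pos hi, ?_⟩
    have hc : ContinuousAt (fun t : ℝ => ψ i p + t • e i) 0 := by fun_prop
    have h0 : ψ i p + (0 : ℝ) • e i = ψ i p := by simp
    have h1 : ∀ᶠ t in 𝓝 (0 : ℝ), ψ i p + t • e i ∈ (ψ i).target :=
      hc (by
        simp only [h0]
        exact (ψ i).open_target.mem_nhds ((ψ i).map_source hpi))
    have h2 : ContinuousAt (fun t : ℝ => f i ((ψ i).symm (ψ i p + t • e i))) 0 := by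
      refine ((f i).contMDiff.continuous.continuousAt).comp (ContinuousAt.comp ?_ hc)
      rw [h0]
      exact (ψ i).continuousAt_symm ((ψ i).map_source hpi)
    have h3 : ∀ᶠ t in 𝓝 (0 : ℝ), f i p / 2 < f i ((ψ i).symm (ψ i p + t • e i)) := by
      refine h2.eventually (lt_mem_nhds ?_)
      simpa only [h0, (ψ i).left_inv hpi] using half_lt_self hi
    filter_upwards [nhdsWithin_le_nhds h1, nhdsWithin_le_nhds h3, self_mem_nhdsWithin]
      with t ht1 ht3 (ht : 0 < t)
    have hz := (ψ i).map_target ht1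
    have hu : u i (ψ i ((ψ i).symm (ψ i p + t • e i))) = t := by
      rw [(ψ i).right_inv ht1, map_add, ((hψ i).mem_hypersurface p hpi).1 hp, map_smul,
        (hψ i).apply_normal]
      simp
    set z := (ψ i).symm (ψ i p + t • e i)
    have hzB : z ∈ B := ((hψ i).mem_domain z hz).2 (by rw [hu]; exact ht.le)
    have hfz : f i z ≠ 0 := ((half_pos hi).trans ht3).ne'
    calc f i p / 2 * t ≤ f i z * u i (ψ i z) := by rw [hu]; gcongr
      _ ≤ ∑ j ∈ f.finsupport z, f j z * u j (ψ j z) :=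
          Finset.single_le_sum (f := fun j => f j z * u j (ψ j z))
            (fun j hj => mul_nonneg (f.nonneg j z)
              (((hψ j).mem_domain z (hfs j z ((hsupp z j).1 hj))).1 hzB)) ((hsupp z i).2 hfz)
      _ = _ := (hsum z).symm

end Hypersurface

/-- The inverse function theorem, with a smooth inverse on an open set. -/
theorem exists_smooth_localInverse {E : Type*} [NormedAddCommGroup E] [NormedSpace ℝ E]
    [FiniteDimensional ℝ E] {F : E → E} {U : Set E} (hU : IsOpen U) (hF : ContDiffOn ℝ ∞ F U)
    {a : E} (ha : a ∈ U) (hinj : Function.Injective (fderiv ℝ F a)) :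
    ∃ Fh : OpenPartialHomeomorph E E, a ∈ Fh.source ∧ Fh.source ⊆ U ∧ (∀ v, Fh v = F v) ∧
      ContDiffOn ℝ ∞ Fh.symm Fh.target := by
  have : CompleteSpace E := FiniteDimensional.complete ℝ E
  have hFa : ∀ v ∈ U, ContDiffAt ℝ ∞ F v := fun v hv => hF.contDiffAt (hU.mem_nhds hv)
  let f' : E ≃L[ℝ] E :=
    (LinearEquiv.ofInjectiveEndo (fderiv ℝ F a : E →ₗ[ℝ] E) hinj).toContinuousLinearEquiv
  have hf' : (f' : E →L[ℝ] E) = fderiv ℝ F a := by ext v; rfl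
  have hd : HasFDerivAt F (f' : E →L[ℝ] E) a := by
    rw [hf']
    exact ((hFa a ha).differentiableAt (by simp)).hasFDerivAt
  let F₀ := (hFa a ha).toOpenPartialHomeomorph F hd (by simp)
  have hF₀ : ∀ v, F₀ v = F v := fun v => rfl
  have hcont : ContinuousOn (fderiv ℝ F) U := hF.continuousOn_fderiv_of_isOpen hU (by simp)
  set T : Set E := U ∩ fderiv ℝ F ⁻¹' range ((↑) : (E ≃L[ℝ] E) → E →L[ℝ] E) with hT
  have hTo : IsOpen T := hcont.isOpen_inter_preimage hU (ContinuousLinearEquiv.isOpen)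
  refine ⟨F₀.restrOpen T hTo, ⟨(hFa a ha).mem_toOpenPartialHomeomorph_source hd (by simp), ha, f', hf'⟩,
    fun v hv => hv.2.1, fun v => rfl, fun w hw => ?_⟩
  have hv := (F₀.restrOpen T hTo).map_target hw
  set v := (F₀.restrOpen T hTo).symm w
  obtain ⟨g, hg⟩ := hv.2.2
  have hdv : HasFDerivAt F (g : E →L[ℝ] E) v := by
    rw [hg]
    exact ((hFa v hv.2.1).differentiableAt (by simp)).hasFDerivAt
  exact ((F₀.restrOpen T hTo).contDiffAt_symm (f₀' := g) hw hdv (hFa v hv.2.1)).contDiffWithinAt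

section Hypersurface

variable {E : Type*} [NormedAddCommGroup E] [NormedSpace ℝ E] {N : Type*} [TopologicalSpace N]
  [ChartedSpace E N] {A B : Set N} [FiniteDimensional ℝ E]

/-- A retraction `π` to the hypersurface and a defining function `ρ` are local coordinates: near a
point of the hypersurface `z` is a smooth function of `ψ (π z) + ρ z • e`. -/
theorem exists_local_product {O : Set N} {π : N → N} (hO : IsOpen O) (hAO : A ⊆ O)
    (hπ : ContMDiffOn 𝓘(ℝ, E) 𝓘(ℝ, E) ∞ π O) (hπA : ∀ z ∈ O, π z ∈ A) (hAπ : ∀ z ∈ A, π z = z)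
    {ρ : N → ℝ} (hρ : ContMDiff 𝓘(ℝ, E) 𝓘(ℝ, ℝ) ∞ ρ) (hρA : ∀ z ∈ A, ρ z = 0)
    {p : N} (hp : p ∈ A) {ψ : OpenPartialHomeomorph N E} {u : E →L[ℝ] ℝ} {e : E}
    (hpψ : p ∈ ψ.source) (hψ : IsHalfSpaceChart A B ψ u e)
    {c : ℝ} (hc : 0 < c) (hρc : ∀ᶠ t in 𝓝[>] (0 : ℝ), c * t ≤ ρ (ψ.symm (ψ p + t • e))) :
    ∃ (V : Set N) (T : Set E) (S : E → N), IsOpen V ∧ IsOpen T ∧ p ∈ V ∧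
      ContMDiffOn 𝓘(ℝ, E) 𝓘(ℝ, E) ∞ S T ∧
      (∀ z ∈ V, z ∈ O ∧ π z ∈ ψ.source ∧ ψ (π z) + ρ z • e ∈ T ∧ S (ψ (π z) + ρ z • e) = z) ∧
      ∀ v ∈ T, S v ∈ V ∧ ψ (π (S v)) + ρ (S v) • e = v := by
  set U₁ : Set E := ψ.symm.source ∩ ψ.symm ⁻¹' O
  have hU₁ : IsOpen U₁ := ψ.symm.isOpen_inter_preimage hO
  have hs₁ : ContMDiffOn 𝓘(ℝ, E) 𝓘(ℝ, E) ∞ ψ.symm U₁ :=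
    hψ.contMDiffOn_symm.mono inter_subset_left
  have hπs : ContMDiffOn 𝓘(ℝ, E) 𝓘(ℝ, E) ∞ (fun v => π (ψ.symm v)) U₁ :=
    hπ.comp hs₁ (fun v hv => hv.2)
  set U : Set E := U₁ ∩ (fun v => π (ψ.symm v)) ⁻¹' ψ.source
  have hU : IsOpen U := hπs.continuousOn.isOpen_inter_preimage hU₁ ψ.open_source
  set F : E → E := fun v => ψ (π (ψ.symm v)) + ρ (ψ.symm v) • e with hFdef
  have hF : ContDiffOn ℝ ∞ F U := by
    rw [← contMDiffOn_iff_contDiffOn]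
    exact (hψ.contMDiffOn.comp (hπs.mono inter_subset_left) (fun v hv => hv.2)).add
      ((hρ.comp_contMDiffOn (hs₁.mono inter_subset_left)).smul contMDiffOn_const)
  set a := ψ p with ha
  have hat : a ∈ ψ.target := ψ.map_source hpψ
  have hsa : ψ.symm a = p := ψ.left_inv hpψ
  have haU : a ∈ U := ⟨⟨hat, by rw [mem_preimage, hsa]; exact hAO hp⟩, by
    rw [mem_preimage, hsa, hAπ p hp]; exact hpψ⟩
  have hua : u a = 0 := (hψ.mem_hypersurface p hpψ).1 hp
  have hD : HasFDerivAt F (fderiv ℝ F a) a :=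
    ((hF.contDiffAt (hU.mem_nhds haU)).differentiableAt (by simp)).hasFDerivAt
  set D := fderiv ℝ F a
  have hline : ∀ w : E, HasDerivAt (fun t : ℝ => a + t • w) w 0 := fun w => by
    simpa using ((hasDerivAt_id (0 : ℝ)).smul_const w).const_add a
  have hDline : ∀ w : E, HasDerivAt (fun t : ℝ => F (a + t • w)) (D w) 0 := fun w => by
    have hD' : HasFDerivAt F D (a + (0 : ℝ) • w) := by simpa using hD
    exact hD'.comp_hasDerivAt (0 : ℝ) (hline w)
  have hnear : ∀ w : E, ∀ᶠ t in 𝓝 (0 : ℝ), a + t • w ∈ U := fun w => by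
    refine (hline w).continuousAt ?_
    simp only [zero_smul, add_zero]
    exact hU.mem_nhds haU
  -- the derivative is the identity on the hyperplane, and `e` is mapped across it, so that it is
  -- injective
  have hDtan : ∀ w : E, u w = 0 → D w = w := fun w hw => by
    refine (hDline w).unique ((hline w).congr_of_eventuallyEq ?_)
    filter_upwards [hnear w] with t ht
    have h1 : ψ.symm (a + t • w) ∈ A := by
      rw [hψ.mem_hypersurface _ (ψ.map_target ht.1.1), ψ.right_inv ht.1.1]
      simp [hua, hw]
    simp only [hFdef]
    rw [hAπ _ h1, hρA _ h1, ψ.right_inv ht.1.1, zero_smul, add_zero]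
  have huF : ∀ v ∈ U, u (F v) = ρ (ψ.symm v) := fun v hv => by
    simp only [hFdef]
    rw [map_add, (hψ.mem_hypersurface _ hv.2).1 (hπA _ hv.1.2), map_smul, hψ.apply_normal]
    simp
  have hDe : c ≤ u (D e) := by
    have h1 : HasDerivAt (fun t : ℝ => u (F (a + t • e))) (u (D e)) 0 :=
      u.hasFDerivAt.comp_hasDerivAt (0 : ℝ) (hDline e)
    have h2 := hasDerivWithinAt_iff_tendsto_slope.1 (h1.hasDerivWithinAt (s := Ioi 0))
    rw [sdiff_singleton_eq_self (by simp)] at h2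
    refine ge_of_tendsto h2 ?_
    filter_upwards [hρc, nhdsWithin_le_nhds (hnear e), self_mem_nhdsWithin] with t h3 h4
      (h5 : 0 < t)
    have h6 : u (F (a + (0 : ℝ) • e)) = 0 := by
      rw [zero_smul, add_zero, huF a haU, hsa, hρA p hp]
    rw [slope_def_field, h6, huF _ h4, sub_zero, sub_zero, le_div_iff₀ h5]
    exact h3
  have hinj : Function.Injective D := by
    refine (injective_iff_map_eq_zero D).2 (fun w hw => ?_)
    have h1 : u (w - u w • e) = 0 := by
      rw [map_sub, map_smul, hψ.apply_normal]; simp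
    have h2 : D w = (w - u w • e) + u w • D e := by
      conv_lhs => rw [← sub_add_cancel w (u w • e), map_add, hDtan _ h1, map_smul]
    have h3 : u w * u (D e) = 0 := by
      have := congrArg u h2
      rw [hw, map_zero, map_add, h1, map_smul, zero_add, smul_eq_mul] at this
      exact this.symm
    have h4 : u w = 0 := (mul_eq_zero.1 h3).resolve_right (hc.trans_le hDe).ne'
    rw [h4, zero_smul, zero_smul, sub_zero, add_zero, hw] at h2
    exact h2.symm
  obtain ⟨Fh, haF, hFU, hFF, hFs⟩ := exists_smooth_localInverse hU hF haU hinj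
  refine ⟨ψ.source ∩ ψ ⁻¹' Fh.source, Fh.target, fun v => ψ.symm (Fh.symm v),
    ψ.isOpen_inter_preimage Fh.open_source, Fh.open_target, ⟨hpψ, haF⟩, ?_, ?_, ?_⟩
  · exact hψ.contMDiffOn_symm.comp (contMDiffOn_iff_contDiffOn.2 hFs)
      (fun v hv => (hFU (Fh.map_target hv)).1.1)
  · rintro z ⟨hz, hz'⟩
    have h1 : ψ (π z) + ρ z • e = Fh (ψ z) := by
      rw [hFF]; simp only [hFdef, ψ.left_inv hz]
    refine ⟨?_, ?_, ?_, ?_⟩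
    · have := (hFU hz').1.2
      rwa [mem_preimage, ψ.left_inv hz] at this
    · have := (hFU hz').2
      rwa [mem_preimage, ψ.left_inv hz] at this
    · rw [h1]; exact Fh.map_source hz'
    · rw [h1]
      exact (congrArg ψ.symm (Fh.left_inv hz')).trans (ψ.left_inv hz)
  · intro v hv
    have h1 := Fh.map_target hv
    have h2 := (hFU h1).1.1
    refine ⟨⟨ψ.map_target h2, by rw [mem_preimage, ψ.right_inv h2]; exact h1⟩, ?_⟩
    have h3 := Fh.right_inv hv
    rw [hFF] at h3
    exact h3

/-- **Bicollars.** The boundary `A` of a smooth domain `B` has a bicollar, with `B` on the side of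
the nonnegative levels. -/
theorem IsSmoothDomain.exists_bicollar [IsManifold 𝓘(ℝ, E) ∞ N] [T2Space N]
    [SecondCountableTopology N] (hAB : IsSmoothDomain E A B) :
    ∃ K : Collar 𝓘(ℝ, E) N (Ioo (-1) 1), K.base = A ∧ ∀ z ∈ K.dom, z ∈ B ↔ 0 ≤ K.lev z := by
  classical
  have : LocallyCompactSpace N := ChartedSpace.locallyCompactSpace E N
  have : TopologicalSpace.MetrizableSpace N := Manifold.metrizableSpace 𝓘(ℝ, E) N
  let _ : MetricSpace N := TopologicalSpace.metrizableSpaceMetric N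
  obtain ⟨O, π, hO, hAO, hπ, hπA, hAπ⟩ := hAB.exists_retraction
  obtain ⟨ρ, hρ, hρA, hρB, hρB', hρc⟩ := hAB.exists_defining_function
  have hloc : ∀ p : A, ∃ (ψ : OpenPartialHomeomorph N E) (u : E →L[ℝ] ℝ) (e : E) (V : Set N)
      (T : Set E) (S : E → N), IsHalfSpaceChart A B ψ u e ∧ IsOpen V ∧ IsOpen T ∧ (p : N) ∈ V ∧
      ContMDiffOn 𝓘(ℝ, E) 𝓘(ℝ, E) ∞ S T ∧
      (∀ z ∈ V, z ∈ O ∧ π z ∈ ψ.source ∧ ψ (π z) + ρ z • e ∈ T ∧ S (ψ (π z) + ρ z • e) = z) ∧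
      ∀ v ∈ T, S v ∈ V ∧ ψ (π (S v)) + ρ (S v) • e = v := fun p => by
    obtain ⟨ψ, u, e, hpψ, hψ, c, hc, hcρ⟩ := hρc p p.2
    obtain ⟨V, T, S, h⟩ := exists_local_product hO hAO hπ hπA hAπ hρ hρA p.2 hpψ hψ hc hcρ
    exact ⟨ψ, u, e, V, T, S, hψ, h⟩
  choose ψ u e V T S hψ hVo hTo hpV hS hVS hTS using hloc
  -- a radius such that two points over `y` at smaller distance from `y` lie in one chart
  obtain ⟨η, hη⟩ : ∃ η : C^∞⟮𝓘(ℝ, E), N; 𝓘(ℝ, ℝ), ℝ⟯, ∀ y, 0 < η y ∧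
      (y ∈ A → ∃ p, Metric.ball y (η y) ⊆ V p) := by
    refine exists_contMDiffMap_forall_mem_convex_of_local_const (n := ⊤) 𝓘(ℝ, E)
      (t := fun y => {r : ℝ | 0 < r ∧ (y ∈ A → ∃ p, Metric.ball y r ⊆ V p)})
      (fun y => ?_) (fun x => ?_)
    · refine Set.OrdConnected.convex ⟨fun a ha b hb c hc => ⟨ha.1.trans_le hc.1, fun hy => ?_⟩⟩
      obtain ⟨p, h⟩ := hb.2 hy
      exact ⟨p, (Metric.ball_subset_ball hc.2).trans h⟩
    · by_cases hx : x ∈ A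
      · obtain ⟨r, hr, h⟩ := Metric.isOpen_iff.1 (hVo ⟨x, hx⟩) x (hpV ⟨x, hx⟩)
        refine ⟨r / 2, ?_⟩
        filter_upwards [Metric.ball_mem_nhds x (half_pos hr)] with y hy
        refine ⟨half_pos hr, fun _ => ⟨⟨x, hx⟩, fun z hz => h ?_⟩⟩
        rw [Metric.mem_ball] at *
        linarith [dist_triangle z y x]
      · refine ⟨1, ?_⟩
        filter_upwards [hAB.isClosed.isOpen_compl.mem_nhds hx] with y hy
        exact ⟨one_pos, fun h => (hy h).elim⟩
  set O' : Set N := O ∩ {z | dist z (π z) < η (π z)} with hO'def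
  have hO' : IsOpen O' := by
    have h := (continuous_dist.comp_continuousOn ((continuousOn_id (s := O)).prodMk hπ.continuousOn)).sub
      (η.contMDiff.continuous.comp_continuousOn hπ.continuousOn) |>.isOpen_inter_preimage hO
      (isOpen_Iio (a := (0 : ℝ)))
    convert! h using 1
    ext z
    simp [hO'def]
  have hAO' : A ⊆ O' := fun y hy => ⟨hAO hy, by
    simp only [mem_ofPred_eq, hAπ y hy, dist_self]
    exact (hη y).1⟩
  have hchart : ∀ y ∈ A, ∃ p, ∀ z ∈ O', π z = y → z ∈ V p := fun y hy => by
    obtain ⟨p, h⟩ := (hη y).2 hy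
    refine ⟨p, fun z hz hzy => h ?_⟩
    have := hz.2
    rw [mem_ofPred_eq, hzy] at this
    exact this
  have huniq : ∀ z ∈ O', ∀ z' ∈ O', π z = π z' → ρ z = ρ z' → z = z' := fun z hz z' hz' h1 h2 => by
    obtain ⟨p, h⟩ := hchart (π z) (hπA z hz.1)
    have h3 := (hVS p z (h z hz rfl)).2.2.2
    have h4 := (hVS p z' (h z' hz' h1.symm)).2.2.2
    rw [← h3, ← h4, h1, h2]
  -- the points of the bicollar will stay in an open set whose closure is in `O'`
  obtain ⟨C, hCo, hAC, hCO⟩ := normal_exists_closure_subset hAB.isClosed hO' hAO'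
  have hCO' : C ⊆ O' := subset_closure.trans hCO
  -- recovering a point from its projection and its value of `ρ`
  have hrec : ∀ p : A, ∀ y ∈ A, y ∈ (ψ p).source → ∀ l : ℝ, ψ p y + l • e p ∈ T p →
      π (S p (ψ p y + l • e p)) = y ∧ ρ (S p (ψ p y + l • e p)) = l := by
    intro p y hy hys l hl
    obtain ⟨h1, h2⟩ := hTS p _ hl
    obtain ⟨h5, h3, -, -⟩ := hVS p _ h1
    set z := S p (ψ p y + l • e p)
    have h4 : ρ z = l := by
      have := congrArg (u p) h2
      rw [map_add, map_add, ((hψ p).mem_hypersurface _ h3).1 (hπA z h5),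
        ((hψ p).mem_hypersurface _ hys).1 hy, map_smul, map_smul, (hψ p).apply_normal] at this
      simpa using this
    rw [h4] at h2
    exact ⟨(ψ p).injOn h3 hys (add_right_cancel h2), h4⟩
  -- the thickness: over `y` all values of `ρ` smaller than `ε y` are attained in `C`
  obtain ⟨ε, hε⟩ : ∃ ε : C^∞⟮𝓘(ℝ, E), N; 𝓘(ℝ, ℝ), ℝ⟯, ∀ y, 0 < ε y ∧
      (y ∈ A → ∀ l, |l| < ε y → ∃ z ∈ C, π z = y ∧ ρ z = l) := by
    refine exists_contMDiffMap_forall_mem_convex_of_local_const (n := ⊤) 𝓘(ℝ, E)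
      (t := fun y => {r : ℝ | 0 < r ∧ (y ∈ A → ∀ l, |l| < r → ∃ z ∈ C, π z = y ∧ ρ z = l)})
      (fun y => ?_) (fun x => ?_)
    · exact Set.OrdConnected.convex ⟨fun a ha b hb c hc => ⟨ha.1.trans_le hc.1,
        fun hy l hl => hb.2 hy l (hl.trans_le hc.2)⟩⟩
    · by_cases hx : x ∈ A
      · set p : A := ⟨x, hx⟩
        have hxx := hVS p x (hpV p)
        rw [hAπ x hx, hρA x hx] at hxx
        obtain ⟨-, hxs, hxT, hxS⟩ := hxx
        have h1 : ContinuousAt (fun q : N × ℝ => ψ p q.1 + q.2 • e p) (x, 0) :=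
          (ContinuousAt.comp (x := ((x, 0) : N × ℝ)) ((ψ p).continuousAt hxs) continuousAt_fst).add
            (continuousAt_snd.smul continuousAt_const)
        have h2 : ∀ᶠ v in 𝓝 (ψ p x + (0 : ℝ) • e p), v ∈ T p ∧ S p v ∈ C := by
          filter_upwards [(hTo p).mem_nhds hxT,
            ((hS p).continuousOn.continuousAt ((hTo p).mem_nhds hxT)).preimage_mem_nhds
              (by rw [hxS]; exact hCo.mem_nhds (hAC hx))] with v h3 h4
          exact ⟨h3, h4⟩
        have h3 := h1.eventually h2
        rw [nhds_prod_eq] at h3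
        obtain ⟨pa, ha, pb, hb, hab⟩ := eventually_prod_iff.1 h3
        obtain ⟨δ, hδ, hδ'⟩ := Metric.eventually_nhds_iff.1 hb
        refine ⟨δ, ?_⟩
        filter_upwards [ha, (ψ p).open_source.mem_nhds hxs] with y hy hys
        refine ⟨hδ, fun hyA l hl => ?_⟩
        obtain ⟨h4, h5⟩ := hab hy (hδ' (by simpa using hl))
        exact ⟨_, h5, hrec p y hyA hys l h4⟩
      · refine ⟨1, ?_⟩
        filter_upwards [hAB.isClosed.isOpen_compl.mem_nhds hx] with y hy
        exact ⟨one_pos, fun h => (hy h).elim⟩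
  have hεπ : ContMDiffOn 𝓘(ℝ, E) 𝓘(ℝ, ℝ) ∞ (fun z => ε (π z)) O := ε.contMDiff.comp_contMDiffOn hπ
  set D : Set N := O' ∩ {z | |ρ z| < ε (π z)} with hD
  have hDo : IsOpen D := by
    have h := (hρ.continuous.abs.continuousOn (s := O')).sub
      (hεπ.continuousOn.mono inter_subset_left) |>.isOpen_inter_preimage hO'
      (isOpen_Iio (a := (0 : ℝ)))
    convert! h using 1
    ext z
    simp [hD]
  have hDC : D ⊆ C := fun z hz => by
    obtain ⟨z', h1, h2, h3⟩ := (hε (π z)).2 (hπA z hz.1.1) _ hz.2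
    rwa [huniq z hz.1 z' (hCO' h1) h2.symm h3.symm]
  -- the bicollar has the projection `π` and the level `ρ / (ε ∘ π)`
  set mov : N → ℝ → N := fun x l =>
    if h : ∃ z ∈ C, π z = π x ∧ ρ z = l * ε (π x) then h.choose else x with hmov
  have hmv : ∀ x ∈ O, ∀ l ∈ Ioo (-1 : ℝ) 1, mov x l ∈ C ∧ π (mov x l) = π x ∧
      ρ (mov x l) = l * ε (π x) := fun x hx l hl => by
    have h : ∃ z ∈ C, π z = π x ∧ ρ z = l * ε (π x) := by
      refine (hε (π x)).2 (hπA x hx) _ ?_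
      rw [abs_mul, abs_of_pos (hε (π x)).1]
      exact mul_lt_of_lt_one_left (hε (π x)).1 (abs_lt.2 hl)
    simp only [hmov, dif_pos h]
    exact ⟨h.choose_spec.1, h.choose_spec.2⟩
  have hDO : D ⊆ O := fun z hz => hz.1.1
  have hmvD : ∀ x ∈ O, ∀ l ∈ Ioo (-1 : ℝ) 1, mov x l ∈ D := fun x hx l hl => by
    obtain ⟨h1, h2, h3⟩ := hmv x hx l hl
    refine ⟨hCO' h1, ?_⟩
    rw [mem_ofPred_eq, h2, h3, abs_mul, abs_of_pos (hε (π x)).1]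
    exact mul_lt_of_lt_one_left (hε (π x)).1 (abs_lt.2 hl)
  have hmveq : ∀ x ∈ O, ∀ l ∈ Ioo (-1 : ℝ) 1, ∀ z ∈ O', π z = π x → ρ z = l * ε (π x) →
      mov x l = z := fun x hx l hl z hz h1 h2 => by
    obtain ⟨h3, h4, h5⟩ := hmv x hx l hl
    exact huniq _ (hCO' h3) _ hz (h4.trans h1.symm) (h5.trans h2.symm)
  have hlevmem : ∀ z ∈ D, ρ z / ε (π z) ∈ Ioo (-1 : ℝ) 1 := fun z hz => by
    rw [mem_Ioo, ← abs_lt, abs_div, abs_of_pos (hε (π z)).1, div_lt_one (hε (π z)).1]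
    exact hz.2
  refine ⟨{ dom := D
            lev := fun z => ρ z / ε (π z)
            mov := mov
            isOpen_dom := hDo
            lev_mem := hlevmem
            mov_mem := fun x hx l hl => hmvD x (hDO hx) l hl
            lev_mov := fun x hx l hl => ?_
            mov_lev := fun x hx => ?_
            mov_mov := fun x hx l hl l' hl' => ?_
            smooth_lev := ?_
            smooth_mov := ?_
            closed := fun c hc => ?_ }, ?_, ?_⟩
  · obtain ⟨-, h2, h3⟩ := hmv x (hDO hx) l hl
    rw [h2, h3, mul_div_cancel_right₀ _ (hε (π x)).1.ne']
  · exact hmveq x (hDO hx) _ (hlevmem x hx) x hx.1 rfl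
      (div_mul_cancel₀ _ (hε (π x)).1.ne').symm
  · obtain ⟨-, h2, -⟩ := hmv x (hDO hx) l hl
    obtain ⟨h4, h5, h6⟩ := hmv x (hDO hx) l' hl'
    exact hmveq _ (hDO (hmvD x (hDO hx) l hl)) l' hl' _ (hCO' h4) (h5.trans h2.symm)
      (by rw [h6, h2])
  · exact (hρ.contMDiffOn).div₀ (hεπ.mono hDO) (fun z hz => (hε (π z)).1.ne')
  · rintro ⟨x₀, l₀⟩ ⟨hx₀, hl₀⟩
    have hx₀O := hDO hx₀
    obtain ⟨p, hp⟩ := hchart (π x₀) (hπA x₀ hx₀O)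
    obtain ⟨hm1, hm2, hm3⟩ := hmv x₀ hx₀O l₀ hl₀
    have hz := hVS p _ (hp _ (hCO' hm1) hm2)
    rw [hm2, hm3] at hz
    obtain ⟨-, hs, hT, hSz⟩ := hz
    have hg : ContMDiffAt (𝓘(ℝ, E).prod 𝓘(ℝ, ℝ)) 𝓘(ℝ, E) ∞
        (fun q : N × ℝ => ψ p (π q.1) + (q.2 * ε (π q.1)) • e p) (x₀, l₀) := by
      have h1 : ContMDiffAt (𝓘(ℝ, E).prod 𝓘(ℝ, ℝ)) 𝓘(ℝ, E) ∞ (fun q : N × ℝ => π q.1) (x₀, l₀) :=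
        ContMDiffAt.comp (x₀, l₀) (hπ.contMDiffAt (hO.mem_nhds hx₀O)) contMDiffAt_fst
      have h2 : ContMDiffAt 𝓘(ℝ, E) 𝓘(ℝ, E) ∞ (ψ p) (π x₀) :=
        (hψ p).contMDiffOn.contMDiffAt ((ψ p).open_source.mem_nhds hs)
      exact (ContMDiffAt.comp (x₀, l₀) h2 h1).add
        ((contMDiffAt_snd.mul (ContMDiffAt.comp (x₀, l₀) ε.contMDiff.contMDiffAt h1)).smul
          contMDiffAt_const)
    have hSg : ContMDiffAt (𝓘(ℝ, E).prod 𝓘(ℝ, ℝ)) 𝓘(ℝ, E) ∞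
        (fun q : N × ℝ => S p (ψ p (π q.1) + (q.2 * ε (π q.1)) • e p)) (x₀, l₀) :=
      ContMDiffAt.comp (x₀, l₀) ((hS p).contMDiffAt ((hTo p).mem_nhds hT)) hg
    refine ContMDiffAt.contMDiffWithinAt (hSg.congr_of_eventuallyEq ?_)
    have h1 : ∀ᶠ q : N × ℝ in 𝓝 (x₀, l₀), ψ p (π q.1) + (q.2 * ε (π q.1)) • e p ∈ T p :=
      hg.continuousAt.eventually ((hTo p).mem_nhds hT)
    have h2 : ∀ᶠ q : N × ℝ in 𝓝 (x₀, l₀),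
        S p (ψ p (π q.1) + (q.2 * ε (π q.1)) • e p) ∈ O' :=
      hSg.continuousAt.eventually (hO'.mem_nhds (by beta_reduce; rw [hSz]; exact hCO' hm1))
    have h3 : ∀ᶠ q : N × ℝ in 𝓝 (x₀, l₀), π q.1 ∈ (ψ p).source :=
      (ContinuousAt.comp (x := ((x₀, l₀) : N × ℝ)) (hπ.continuousOn.continuousAt (hO.mem_nhds hx₀O))
        continuousAt_fst).eventually ((ψ p).open_source.mem_nhds hs)
    have h4 : ∀ᶠ q : N × ℝ in 𝓝 (x₀, l₀), q.1 ∈ O ∧ q.2 ∈ Ioo (-1 : ℝ) 1 :=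
      (hO.prod isOpen_Ioo).mem_nhds ⟨hx₀O, hl₀⟩
    filter_upwards [h1, h2, h3, h4] with q h1 h2 h3 h4
    obtain ⟨h5, h6⟩ := hrec p (π q.1) (hπA _ h4.1) h3 _ h1
    exact hmveq q.1 h4.1 q.2 h4.2 _ h2 h5 h6
  · have h : {z | z ∈ D ∧ |ρ z / ε (π z)| ≤ c} = closure C ∩ {z | |ρ z| - c * ε (π z) ∈ Iic 0} := by
      ext z
      simp only [mem_ofPred_eq, mem_inter_iff, mem_Iic, sub_nonpos, abs_div,
        abs_of_pos (hε (π z)).1, div_le_iff₀ (hε (π z)).1]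
      refine ⟨fun h => ⟨subset_closure (hDC h.1), h.2⟩, fun h => ⟨⟨hCO h.1, ?_⟩, h.2⟩⟩
      exact h.2.trans_lt (mul_lt_of_lt_one_left (hε (π z)).1 hc)
    rw [h]
    refine ContinuousOn.preimage_isClosed_of_isClosed ?_ isClosed_closure isClosed_Iic
    exact (hρ.continuous.abs.continuousOn).sub
      (continuousOn_const.mul (hεπ.continuousOn.mono (hCO.trans inter_subset_left)))
  · ext z
    refine ⟨fun h => ?_, fun h => ⟨⟨hAO' h, ?_⟩, ?_⟩⟩
    · have h1 : ρ z = 0 := (div_eq_zero_iff.1 h.2).resolve_right (hε (π z)).1.ne'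
      have h2 := hπA z h.1.1.1
      have : z = π z := huniq z h.1.1 _ (hAO' h2) (hAπ _ h2).symm (h1.trans (hρA _ h2).symm)
      rwa [this]
    · rw [mem_ofPred_eq, hρA z h, abs_zero]
      exact (hε _).1
    · change ρ z / ε (π z) = 0
      rw [hρA z h, zero_div]
  · intro z hz
    change z ∈ B ↔ 0 ≤ ρ z / ε (π z)
    refine ⟨fun h => div_nonneg (hρB z h) (hε _).1.le, fun h => ?_⟩
    by_contra hzB
    have h1 : ρ z = 0 := by
      refine le_antisymm (hρB' z hzB) ?_
      rwa [le_div_iff₀ (hε (π z)).1, zero_mul] at h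
    have h2 := hπA z hz.1.1
    have h3 : z = π z := huniq z hz.1 _ (hAO' h2) (hAπ _ h2).symm (h1.trans (hρA _ h2).symm)
    rw [← h3] at h2
    obtain ⟨ψ', u', e', hzψ, hψ'⟩ := hAB.exists_chart z h2
    exact hzB ((hψ'.mem_domain z hzψ).2 ((hψ'.mem_hypersurface z hzψ).1 h2).ge)

end Hypersurface

/-! ### The image of an embedding of codimension zero as a smooth domain -/

section EmbeddedDomain

variable {n : ℕ} [NeZero n] {M : Type*} [TopologicalSpace M]
  [ChartedSpace (EuclideanHalfSpace n) M]

/-- Boundary points are detected by the charts of the maximal atlas. -/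
theorem isBoundaryPoint_iff_of_mem_maximalAtlas
    {c : OpenPartialHomeomorph M (EuclideanHalfSpace n)}
    (hc : c ∈ IsManifold.maximalAtlas (𝓡∂ n) ∞ M) {x : M} (hx : x ∈ c.source) :
    (𝓡∂ n).IsBoundaryPoint x ↔ ((𝓡∂ n) (c x)) 0 = 0 := by
  let Φ : PartialDiffeomorph (𝓡∂ n) (𝓡∂ n) M (EuclideanHalfSpace n) ∞ :=
    { toPartialEquiv := c.toPartialEquiv
      open_source := c.open_source
      open_target := c.open_target
      contMDiffOn_toFun := contMDiffOn_of_mem_maximalAtlas hc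
      contMDiffOn_invFun := contMDiffOn_symm_of_mem_maximalAtlas hc }
  have h : IsLocalDiffeomorphAt (𝓡∂ n) (𝓡∂ n) ∞ c x := ⟨Φ, hx, fun _ _ => rfl⟩
  rw [h.isBoundaryPoint_iff (by simp), ModelWithCorners.isBoundaryPoint_iff,
    frontier_range_modelWithCornersEuclideanHalfSpace]
  simp [chartAt_self_eq, eq_comm]

variable [IsManifold (𝓡∂ n) ∞ M]
  {N : Type*} [TopologicalSpace N] [ChartedSpace (EuclideanSpace ℝ (Fin n)) N]

/-- The image of a closed embedding into a manifold without boundary of the same dimension is a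
smooth domain. -/
theorem Manifold.IsSmoothEmbedding.isSmoothDomain {b : M → N}
    (hb : Manifold.IsSmoothEmbedding (𝓡∂ n) (𝓡 n) ∞ b) (hcl : IsClosed (range b)) :
    IsSmoothDomain (EuclideanSpace ℝ (Fin n)) (b '' (𝓡∂ n).boundary M) (range b) := by
  have hbc : IsClosedEmbedding b := ⟨hb.isEmbedding, hcl⟩
  refine ⟨hbc.isClosedMap _ ((𝓡∂ n).isClosed_boundary (M := M) (n := ∞) (by simp)), ?_⟩
  rintro _ ⟨p, -, rfl⟩
  obtain ⟨F, _, _, dc, cc, hpd, hpc, hdm, hcm, hsub, L, hw⟩ := hb.isImmersion.isImmersionAt p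
  have hfin : FiniteDimensional ℝ (EuclideanSpace ℝ (Fin n) × F) :=
    LinearEquiv.finiteDimensional L.symm.toLinearEquiv
  have hfinF : FiniteDimensional ℝ F :=
    Module.Finite.of_surjective (LinearMap.snd ℝ (EuclideanSpace ℝ (Fin n)) F)
      LinearMap.snd_surjective
  -- the dimensions are equal, so that the complement in the local form of the immersion is trivial
  have hF : Subsingleton F := by
    have h1 := L.toLinearEquiv.finrank_eq
    have h2 := Module.finrank_prod (R := ℝ) (M := EuclideanSpace ℝ (Fin n)) (M' := F)
    exact Module.finrank_zero_iff (R := ℝ).1 (by omega)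
  have hwr : ∀ x ∈ dc.source, cc (b x) = L ((𝓡∂ n) (dc x), 0) := fun x hx => by
    have h0 : dc.extend (𝓡∂ n) x ∈ (dc.extend (𝓡∂ n)).target :=
      (dc.extend (𝓡∂ n)).map_source (by rwa [OpenPartialHomeomorph.extend_source])
    have h1 := hw h0
    simp only [Function.comp_apply] at h1
    rw [OpenPartialHomeomorph.extend_left_inv _ hx] at h1
    simpa using h1
  have hL0 : ∀ v, L ((L.symm v).1, 0) = v := fun v => by
    conv_rhs => rw [← L.apply_symm_apply v]
    congr 1
    exact Prod.ext rfl (Subsingleton.elim _ _)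
  obtain ⟨O, hO, hOb⟩ := hb.isEmbedding.isInducing.isOpen_iff.1 dc.open_source
  obtain ⟨T, hT, hTI⟩ := (𝓡∂ n).isClosedEmbedding.isInducing.isOpen_iff.1 dc.open_target
  have hpT : (𝓡∂ n) (dc p) ∈ T := by
    rw [← mem_preimage, hTI]; exact dc.map_source hpd
  set g : EuclideanSpace ℝ (Fin n) → EuclideanSpace ℝ (Fin n) := fun v => (L.symm v).1 with hg
  have hgc : Continuous g := continuous_fst.comp L.symm.continuous
  have hgb : ∀ x ∈ dc.source, g (cc (b x)) = (𝓡∂ n) (dc x) := fun x hx => by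
    simp only [hg, hwr x hx, L.symm_apply_apply]
  set S : Set N := O ∩ (cc.source ∩ cc ⁻¹' (g ⁻¹' T)) with hS
  have hSo : IsOpen S := hO.inter (cc.isOpen_inter_preimage (hT.preimage hgc))
  let u : EuclideanSpace ℝ (Fin n) →L[ℝ] ℝ :=
    (EuclideanSpace.proj (0 : Fin n) : EuclideanSpace ℝ (Fin n) →L[ℝ] ℝ).comp
      ((ContinuousLinearMap.fst ℝ (EuclideanSpace ℝ (Fin n)) F).comp L.symm.toContinuousLinearMap)
  have hu : ∀ v, u v = (g v) 0 := fun v => rfl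
  have hsrc : ∀ x, b x ∈ S → x ∈ dc.source := fun x hx => by rw [← hOb]; exact hx.1
  -- points of the chart over the half space come from `M`
  have hex : ∀ z ∈ S, 0 ≤ u (cc z) → ∃ x, b x = z ∧ u (cc z) = ((𝓡∂ n) (dc x)) 0 := fun z hz h => by
    set w : EuclideanHalfSpace n := ⟨g (cc z), h⟩ with hw
    have hwI : (𝓡∂ n) w = g (cc z) := rfl
    have hwt : w ∈ dc.target := by
      rw [← hTI, mem_preimage, hwI]; exact hz.2.2
    have hs := dc.map_target hwt
    refine ⟨dc.symm w, ?_, ?_⟩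
    · refine cc.injOn (hsub hs) hz.2.1 ?_
      rw [hwr _ hs, dc.right_inv hwt, hwI]
      exact hL0 _
    · rw [dc.right_inv hwt, hwI, hu]
  have hrs : (cc.restr S).source = S := by
    rw [cc.restr_source, hSo.interior_eq, inter_eq_right]
    exact fun z hz => hz.2.1
  refine ⟨cc.restr S, u, L (EuclideanSpace.single 0 1, 0), ?_, ?_, ?_, ?_, ?_⟩
  · rw [hrs]
    refine ⟨?_, hpc, ?_⟩
    · rw [← mem_preimage, hOb]; exact hpd
    · rw [mem_preimage, mem_preimage, hgb p hpd]; exact hpT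
  · exact restr_mem_maximalAtlas _ hcm hSo
  · simp [hu, hg]
  · intro z hz
    rw [hrs] at hz
    change _ ↔ u (cc z) = 0
    constructor
    · rintro ⟨x, hx, rfl⟩
      rw [hu, hgb x (hsrc x hz)]
      exact (isBoundaryPoint_iff_of_mem_maximalAtlas hdm (hsrc x hz)).1 hx
    · intro h
      obtain ⟨x, rfl, hx⟩ := hex z hz h.ge
      exact ⟨x, (isBoundaryPoint_iff_of_mem_maximalAtlas hdm
        (hsrc x hz)).2 (hx.symm.trans h), rfl⟩
  · intro z hz
    rw [hrs] at hz
    change _ ↔ 0 ≤ u (cc z)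
    constructor
    · rintro ⟨x, rfl⟩
      rw [hu, hgb x (hsrc x hz)]
      exact (dc x).2
    · intro h
      obtain ⟨x, hx, -⟩ := hex z hz h
      exact ⟨x, hx⟩

end EmbeddedDomain

namespace Collar

variable {E : Type*} [NormedAddCommGroup E] [NormedSpace ℝ E] {H : Type*} [TopologicalSpace H]
  {J : ModelWithCorners ℝ E H} {N : Type*} [TopologicalSpace N] [ChartedSpace H N]

variable {E' : Type*} [NormedAddCommGroup E'] [NormedSpace ℝ E'] {H' : Type*} [TopologicalSpace H']
  {I : ModelWithCorners ℝ E' H'} {M : Type*} [TopologicalSpace M] [ChartedSpace H' M]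

/-- The half of a bicollar on the side of a domain, as a collar of that domain. The domain is the
image of `b`, with inverse map `g`. -/
def pullback (K : Collar J N (Ioo (-1) 1)) {b : M → N} {g : N → M}
    (hb : ContMDiff I J ∞ b) (hg : ContMDiffOn J I ∞ g (range b)) (hgb : ∀ x, g (b x) = x)
    (hK : ∀ z ∈ K.dom, z ∈ range b ↔ 0 ≤ K.lev z) : Collar I M (Ico 0 1) :=
  have hmov : ∀ x ∈ b ⁻¹' K.dom, ∀ l ∈ Ico (0 : ℝ) 1, K.mov (b x) l ∈ K.dom ∧
      K.lev (K.mov (b x) l) = l ∧ b (g (K.mov (b x) l)) = K.mov (b x) l := fun x hx l hl => by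
    have hl' : l ∈ Ioo (-1 : ℝ) 1 := ⟨neg_one_lt_zero.trans_le hl.1, hl.2⟩
    have h1 := K.mov_mem _ hx l hl'
    have h2 := K.lev_mov _ hx l hl'
    refine ⟨h1, h2, ?_⟩
    obtain ⟨y, hy⟩ := (hK _ h1).2 (by rw [h2]; exact hl.1)
    rw [← hy, hgb]
  { dom := b ⁻¹' K.dom
    lev := fun x => K.lev (b x)
    mov := fun x l => g (K.mov (b x) l)
    isOpen_dom := K.isOpen_dom.preimage hb.continuous
    lev_mem := fun x hx => ⟨(hK _ hx).1 (mem_range_self x), (K.lev_mem _ hx).2⟩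
    mov_mem := fun x hx l hl => by
      rw [mem_preimage, (hmov x hx l hl).2.2]
      exact (hmov x hx l hl).1
    lev_mov := fun x hx l hl => by
      rw [(hmov x hx l hl).2.2, (hmov x hx l hl).2.1]
    mov_lev := fun x hx => by rw [K.mov_lev _ hx, hgb]
    mov_mov := fun x hx l hl l' hl' => by
      rw [(hmov x hx l hl).2.2, K.mov_mov _ hx l ⟨neg_one_lt_zero.trans_le hl.1, hl.2⟩ l'
        ⟨neg_one_lt_zero.trans_le hl'.1, hl'.2⟩]
    smooth_lev := K.smooth_lev.comp hb.contMDiffOn (fun x hx => hx)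
    smooth_mov := hg.comp (K.contMDiffOn_mov (hb.comp contMDiff_fst).contMDiffOn
      contMDiff_snd.contMDiffOn (fun q hq => hq.1)
      (fun q hq => ⟨neg_one_lt_zero.trans_le hq.2.1, hq.2.2⟩))
      (fun q hq => ⟨_, (hmov q.1 hq.1 q.2 hq.2).2.2⟩)
    closed := fun c hc => (K.closed c hc).preimage hb.continuous }

end Collar

/-! ### The double as a union of two mirror images -/

section Mirror

variable {E : Type*} [NormedAddCommGroup E] [NormedSpace ℝ E] {H : Type*} [TopologicalSpace H]
  {E' : Type*} [NormedAddCommGroup E'] [NormedSpace ℝ E'] {H' : Type*} [TopologicalSpace H']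

/-- A manifold `N` which is the union of two copies `b(M)` and `j(M)` of `M` glued along the
boundary, together with a bicollar of the common boundary in which the two copies are mirror images
of each other: the folding map `q : N → M`, left inverse to `b` and to `j`, is invariant under the
reflection of the bicollar. -/
structure MirrorDouble (I : ModelWithCorners ℝ E H) (J : ModelWithCorners ℝ E' H') (M N : Type*)
    [TopologicalSpace M] [ChartedSpace H M] [TopologicalSpace N] [ChartedSpace H' N] where
  /-- The first copy of `M`. -/
  b : M → N
  /-- The second copy of `M`. -/
  j : M → N
  /-- The folding map. -/
  q : N → M
  /-- The bicollar of the common boundary, with `b(M)` on the positive side. -/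
  K : Collar J N (Ioo (-1) 1)
  smooth_b : ContMDiff I J ∞ b
  smooth_j : ContMDiff I J ∞ j
  smooth_q_b : ContMDiffOn J I ∞ q (range b)
  smooth_q_j : ContMDiffOn J I ∞ q (range j)
  q_b : ∀ x, q (b x) = x
  q_j : ∀ x, q (j x) = x
  isClosed_b : IsClosed (range b)
  isClosed_j : IsClosed (range j)
  cover : ∀ z, z ∈ range b ∨ z ∈ range j
  mem_base : ∀ z, z ∈ range b → z ∈ range j → z ∈ K.base
  mem_b : ∀ z ∈ K.dom, z ∈ range b ↔ 0 ≤ K.lev z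
  mem_j : ∀ z ∈ K.dom, z ∈ range j ↔ K.lev z ≤ 0
  q_mov : ∀ z ∈ K.dom, q (K.mov z (-K.lev z)) = q z

variable {I : ModelWithCorners ℝ E H} {J : ModelWithCorners ℝ E' H'} {M N : Type*}
  [TopologicalSpace M] [ChartedSpace H M] [TopologicalSpace N] [ChartedSpace H' N]

theorem neg_mem_Ioo_one {l : ℝ} (hl : l ∈ Ioo (-1 : ℝ) 1) : -l ∈ Ioo (-1 : ℝ) 1 :=
  ⟨neg_lt_neg hl.2, neg_lt.1 hl.1⟩

/-- Two copies of `M` glued along the boundary can be made mirror images of each other, by a change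
of the parametrization of the second copy. The change is an extension of the germ along the boundary
of the comparison between the two collars obtained from one bicollar. -/
theorem exists_mirrorDouble [FiniteDimensional ℝ E] [IsManifold I ∞ M] [T2Space M]
    [SigmaCompactSpace M] [FiniteDimensional ℝ E'] [IsManifold J ∞ N] [T2Space N]
    [SigmaCompactSpace N] {b j : M → N} (hb : ContMDiff I J ∞ b)
    (hj : ContMDiff I J ∞ j) {gb gj : N → M} (hgb : ContMDiffOn J I ∞ gb (range b))
    (hgj : ContMDiffOn J I ∞ gj (range j)) (hgbb : ∀ x, gb (b x) = x) (hgjj : ∀ x, gj (j x) = x)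
    (hclb : IsClosed (range b)) (hclj : IsClosed (range j))
    (hcov : ∀ z, z ∈ range b ∨ z ∈ range j) (K : Collar J N (Ioo (-1) 1))
    (hKb : ∀ z ∈ K.dom, z ∈ range b ↔ 0 ≤ K.lev z) (hKj : ∀ z ∈ K.dom, z ∈ range j ↔ K.lev z ≤ 0)
    (hbj : ∀ z, z ∈ range b → z ∈ range j → z ∈ K.base) (hKbj : ∀ x, b x ∈ K.base → j x = b x)  :
    ∃ D : MirrorDouble I J M N, D.b = b ∧ range D.j = range j ∧ D.K.base = K.base := by
  have hbg : ∀ z ∈ range b, b (gb z) = z := by rintro _ ⟨x, rfl⟩; rw [hgbb]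
  have hjg : ∀ z ∈ range j, j (gj z) = z := by rintro _ ⟨x, rfl⟩; rw [hgjj]
  -- the reflection of the bicollar
  set R : N → N := fun z => K.mov z (-K.lev z) with hR
  have hl : ∀ z ∈ K.dom, -K.lev z ∈ Ioo (-1 : ℝ) 1 := fun z hz => neg_mem_Ioo_one (K.lev_mem z hz)
  have hRd : ∀ z ∈ K.dom, R z ∈ K.dom := fun z hz => K.mov_mem z hz _ (hl z hz)
  have hRl : ∀ z ∈ K.dom, K.lev (R z) = -K.lev z := fun z hz => K.lev_mov z hz _ (hl z hz)
  have hRR : ∀ z ∈ K.dom, R (R z) = z := fun z hz => by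
    change K.mov (R z) (-K.lev (R z)) = z
    rw [hRl z hz, neg_neg, K.mov_mov z hz _ (hl z hz) _ (K.lev_mem z hz), K.mov_lev z hz]
  have hRs : ContMDiffOn J J ∞ R K.dom :=
    K.contMDiffOn_mov contMDiffOn_id K.smooth_lev.neg (fun z hz => hz) hl
  have hRb : ∀ z ∈ K.dom, z ∈ range b → R z ∈ range j := fun z hz h => by
    rw [hKj _ (hRd z hz), hRl z hz, neg_nonpos]; exact (hKb z hz).1 h
  have hRj : ∀ z ∈ K.dom, z ∈ range j → R z ∈ range b := fun z hz h => by
    rw [hKb _ (hRd z hz), hRl z hz, neg_nonneg]; exact (hKj z hz).1 h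
  have hR0 : ∀ z ∈ K.base, R z = z := fun z hz => by
    have h := hz.2
    change K.mov z (-K.lev z) = z
    rw [h, neg_zero, ← h, K.mov_lev z hz.1]
  -- the germ which compares `j` with the mirror image of `b`
  let φ : OpenPartialHomeomorph M M :=
    { toFun := fun x => gj (R (b x))
      invFun := fun y => gb (R (j y))
      source := b ⁻¹' K.dom
      target := j ⁻¹' K.dom
      map_source' := fun x hx => by
        rw [mem_preimage, hjg _ (hRb _ hx (mem_range_self x))]; exact hRd _ hx
      map_target' := fun x hx => by
        rw [mem_preimage, hbg _ (hRj _ hx (mem_range_self x))]; exact hRd _ hx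
      left_inv' := fun x hx => by
        rw [hjg _ (hRb _ hx (mem_range_self x)), hRR _ hx, hgbb]
      right_inv' := fun x hx => by
        rw [hbg _ (hRj _ hx (mem_range_self x)), hRR _ hx, hgjj]
      open_source := K.isOpen_dom.preimage hb.continuous
      open_target := K.isOpen_dom.preimage hj.continuous
      continuousOn_toFun := hgj.continuousOn.comp (hRs.continuousOn.comp
        hb.continuous.continuousOn (fun x hx => hx)) (fun x hx => hRb _ hx (mem_range_self x))
      continuousOn_invFun := hgb.continuousOn.comp (hRs.continuousOn.comp
        hj.continuous.continuousOn (fun x hx => hx)) (fun x hx => hRj _ hx (mem_range_self x)) }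
  have hφ : ContMDiffOn I I ∞ φ φ.source := hgj.comp (hRs.comp hb.contMDiffOn (fun x hx => hx))
    (fun x hx => hRb _ hx (mem_range_self x))
  have hφ' : ContMDiffOn I I ∞ φ.symm φ.target := hgb.comp (hRs.comp hj.contMDiffOn (fun x hx => hx))
    (fun x hx => hRj _ hx (mem_range_self x))
  obtain ⟨k, ⟨N', hN'o, hN'b, hN'⟩, -, -, hkb, -, -⟩ :=
    (K.pullback hb hgb hgbb hKb).exists_diffeomorph_of_germ φ hφ hφ' subset_rfl
      (fun x hx => by
        change gj (R (b x)) = x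
        rw [hR0 _ hx, ← hKbj x hx, hgjj])
      (contMDiff_const (c := (1 : ℝ))) (fun _ => ⟨zero_le_one, le_rfl⟩) (fun _ _ _ _ => rfl)
      (fun _ _ => rfl) isOpen_univ (subset_univ _)
  -- now `j ∘ k` is the mirror image of `b` near the boundary, and the bicollar has to be made
  -- thinner
  have hO : IsOpen (b '' N'ᶜ)ᶜ := by
    have : b '' N'ᶜ = range b ∩ gb ⁻¹' N'ᶜ := by
      ext z
      constructor
      · rintro ⟨x, hx, rfl⟩
        exact ⟨mem_range_self x, by rwa [mem_preimage, hgbb]⟩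
      · rintro ⟨⟨x, rfl⟩, hx⟩
        rw [mem_preimage, hgbb] at hx
        exact ⟨x, hx, rfl⟩
    rw [this]
    exact (hgb.continuousOn.preimage_isClosed_of_isClosed hclb hN'o.isClosed_compl).isOpen_compl
  obtain ⟨ε, hε, hεO⟩ := K.exists_tube isLevelRange_Ioo.zero_mem
    (O := (b '' N'ᶜ)ᶜ) hO (fun z hz h => by
      obtain ⟨x, hx, rfl⟩ := h
      exact hx (hN'b hz)) one_pos
  set K' := K.shrink isLevelRange_Ioo ε ε.contMDiff hε with hK'
  have hrj : range (j ∘ k) = range j := k.surjective.range_comp j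
  have hεpos : ∀ z, 0 < ε (K.foot z) := fun z => (hε _).1
  have hlev0 : ∀ z, 0 ≤ K'.lev z ↔ 0 ≤ K.lev z := fun z => by
    change 0 ≤ K.lev z / ε (K.foot z) ↔ _
    rw [le_div_iff₀ (hεpos z), zero_mul]
  have hlev0' : ∀ z, K'.lev z ≤ 0 ↔ K.lev z ≤ 0 := fun z => by
    change K.lev z / ε (K.foot z) ≤ 0 ↔ _
    rw [div_le_iff₀ (hεpos z), zero_mul]
  have hbase : K'.base = K.base := by
    ext z
    refine ⟨fun h => ⟨h.1.1, le_antisymm ((hlev0' z).1 h.2.le) ((hlev0 z).1 h.2.ge)⟩,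
      fun h => ⟨⟨h.1, ?_⟩, le_antisymm ((hlev0' z).2 h.2.le) ((hlev0 z).2 h.2.ge)⟩⟩
    rw [h.2, abs_zero]; exact hεpos z
  have hR' : ∀ z, K'.mov z (-K'.lev z) = R z := fun z => by
    change K.mov z (-(K.lev z / ε (K.foot z)) * ε (K.foot z)) = R z
    rw [neg_mul, div_mul_cancel₀ _ (hεpos z).ne']
  -- the mirror images match
  have hmir : ∀ x, b x ∈ K'.dom → j (k x) = R (b x) := fun x hx => by
    have h1 : x ∈ N' := by
      by_contra h
      exact hεO _ hx.1 hx.2 ⟨x, h, rfl⟩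
    rw [hN' x h1 rfl]
    exact hjg _ (hRb _ hx.1 (mem_range_self x))
  classical
  have hkk : ∀ x, b x ∈ K.base → k x = x := fun x hx => hkb x hx
  set q : N → M := fun z => if z ∈ range b then gb z else k.symm (gj z) with hq
  have hqb : ∀ x, q (b x) = x := fun x => by simp [hq, hgbb]
  have hqj : ∀ x, q (j (k x)) = x := fun x => by
    by_cases h : j (k x) ∈ range b
    · simp only [hq, if_pos h]
      have h1 := hbj _ h (mem_range_self _)
      obtain ⟨y, hy⟩ := h
      have h2 : b y ∈ K.base := by rwa [hy]
      have h3 : k x = y := by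
        have := hKbj y h2
        rw [hy] at this
        rw [← hgjj (k x), ← this, hgjj]
      rw [← hy, hgbb]
      exact k.injective ((hkk y h2).trans h3.symm)
    · simp only [hq, if_neg h, hgjj, k.symm_apply_apply]
  refine ⟨{ b := b, j := j ∘ k, q := q, K := K', smooth_b := hb, smooth_j := hj.comp k.contMDiff,
            smooth_q_b := hgb.congr (fun z hz => by simp only [hq, if_pos hz])
            smooth_q_j := ?_, q_b := hqb, q_j := hqj
            isClosed_b := hclb, isClosed_j := by rwa [hrj]
            cover := by rwa [hrj]
            mem_base := by rwa [hrj, hbase]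
            mem_b := fun z hz => (hKb z hz.1).trans (hlev0 z).symm
            mem_j := fun z hz => by rw [hrj]; exact (hKj z hz.1).trans (hlev0' z).symm
            q_mov := fun z hz => ?_ }, rfl, hrj, hbase⟩
  · rw [hrj]
    refine (k.symm.contMDiff.comp_contMDiffOn hgj).congr (fun z hz => ?_)
    obtain ⟨y, rfl⟩ := hz
    have := hqj (k.symm y)
    rw [k.apply_symm_apply] at this
    rw [this, Function.comp_apply, hgjj]
  · rw [hR' z]
    rcases hcov z with h | h
    · obtain ⟨x, rfl⟩ := h
      rw [← hmir x hz, hqj, hqb]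
    · obtain ⟨x, hx⟩ := hRj z hz.1 h
      have h1 : b x ∈ K'.dom := by
        rw [hx, ← hR' z]
        exact K'.mov_mem z hz _ (neg_mem_Ioo_one (K'.lev_mem z hz))
      have h2 := hmir x h1
      rw [hx, hRR z hz.1] at h2
      rw [← hx, hqb, ← h2, hqj]

end Mirror

/-! ### Bending a half plane into a wedge -/

/-- The relative increase of the square of the level in `bendLevel`, for `w = 1`: it vanishes for
small `s`, and is `1 / s ^ 2` for large `s`. -/
noncomputable def bendGain (s : ℝ) : ℝ := (1 - cutoff (4 * s ^ 2)) / s ^ 2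

theorem contDiff_bendGain : ContDiff ℝ ∞ bendGain := by
  have hc : ContDiff ℝ ∞ (fun s : ℝ => 1 - cutoff (4 * s ^ 2)) :=
    contDiff_const.sub (contDiff_cutoff.comp (by fun_prop))
  refine contDiff_iff_contDiffAt.2 (fun s => ?_)
  by_cases hs : s = 0
  · refine (contDiffAt_const (c := (0 : ℝ))).congr_of_eventuallyEq ?_
    have h : ContinuousAt (fun s : ℝ => 4 * s ^ 2) s := by fun_prop
    filter_upwards [h.eventually (gt_mem_nhds (show 4 * s ^ 2 < 1 / 3 by rw [hs]; norm_num))]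
      with s' hs'
    rw [bendGain, cutoff_of_le hs'.le]
    simp
  · exact hc.contDiffAt.div (by fun_prop) (pow_ne_zero 2 hs)

theorem bendGain_nonneg (s : ℝ) : 0 ≤ bendGain s :=
  div_nonneg (sub_nonneg.2 (cutoff_le_one _)) (sq_nonneg s)

theorem sq_mul_bendGain (s : ℝ) : s ^ 2 * bendGain s = 1 - cutoff (4 * s ^ 2) := by
  by_cases hs : s = 0
  · rw [hs, cutoff_of_le (by norm_num)]; simp
  · rw [bendGain, mul_div_cancel₀ _ (pow_ne_zero 2 hs)]

/-- A level `v` with `v ^ 2 = s ^ 2 + w` for large `s`, and `v = s` for small `s`. -/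
noncomputable def bendLevel (s w : ℝ) : ℝ := s * √(1 + w * bendGain s)

theorem continuous_bendLevel : Continuous (fun p : ℝ × ℝ => bendLevel p.1 p.2) := by
  have := contDiff_bendGain.continuous
  unfold bendLevel
  fun_prop

theorem one_le_bendLevel_radicand {w : ℝ} (hw : 0 ≤ w) (s : ℝ) : 1 ≤ 1 + w * bendGain s :=
  le_add_of_nonneg_right (mul_nonneg hw (bendGain_nonneg s))

theorem contDiffOn_bendLevel :
    ContDiffOn ℝ ∞ (fun p : ℝ × ℝ => bendLevel p.1 p.2) {p | 0 ≤ p.2} := by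
  have := contDiff_bendGain
  refine contDiff_fst.contDiffOn.mul (ContDiffOn.sqrt ?_ (fun p hp => ?_))
  · exact (contDiff_const.add (contDiff_snd.mul (this.comp contDiff_fst))).contDiffOn
  · exact (zero_lt_one.trans_le (one_le_bendLevel_radicand hp _)).ne'

theorem bendLevel_sq {w : ℝ} (hw : 0 ≤ w) (s : ℝ) :
    bendLevel s w ^ 2 = s ^ 2 + w * (1 - cutoff (4 * s ^ 2)) := by
  rw [bendLevel, mul_pow, Real.sq_sqrt (zero_le_one.trans (one_le_bendLevel_radicand hw s)),
    ← sq_mul_bendGain]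
  ring

theorem bendLevel_of_small {s w : ℝ} (hs : 4 * s ^ 2 ≤ 1 / 3) : bendLevel s w = s := by
  rw [bendLevel, bendGain, cutoff_of_le hs]; simp

theorem one_le_bendLevel_factor {w : ℝ} (hw : 0 ≤ w) (s : ℝ) : 1 ≤ √(1 + w * bendGain s) :=
  Real.one_le_sqrt.2 (one_le_bendLevel_radicand hw s)

theorem bendLevel_pos {s w : ℝ} (hw : 0 ≤ w) (hs : 0 < s) : 0 < bendLevel s w :=
  mul_pos hs (zero_lt_one.trans_le (one_le_bendLevel_factor hw s))

theorem bendLevel_nonpos {s w : ℝ} (hw : 0 ≤ w) (hs : s ≤ 0) : bendLevel s w ≤ 0 :=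
  mul_nonpos_of_nonpos_of_nonneg hs (zero_le_one.trans (one_le_bendLevel_factor hw s))

theorem abs_le_abs_bendLevel {w : ℝ} (hw : 0 ≤ w) (s : ℝ) : |s| ≤ |bendLevel s w| := by
  rw [bendLevel, abs_mul, abs_of_nonneg (Real.sqrt_nonneg _)]
  exact le_mul_of_one_le_right (abs_nonneg s) (one_le_bendLevel_factor hw s)

theorem abs_bendLevel_le {w : ℝ} (hw : 0 ≤ w) (s : ℝ) : |bendLevel s w| ≤ √(s ^ 2 + w) := by
  rw [← Real.sqrt_sq_eq_abs, bendLevel_sq hw]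
  refine Real.sqrt_le_sqrt ?_
  have := mul_le_of_le_one_right hw (sub_le_self 1 (cutoff_nonneg (4 * s ^ 2)))
  linarith

/-- The radius equals the level, except near the edge of the wedge. -/
theorem abs_bendLevel_eq {s w : ℝ} (hw : 0 ≤ w) (hw' : w ≤ 1 / 16) (h : 5 / 8 ≤ √(s ^ 2 + w)) :
    |bendLevel s w| = √(s ^ 2 + w) := by
  have h1 : (5 / 8) ^ 2 ≤ s ^ 2 + w := (Real.le_sqrt' (by norm_num)).1 h
  rw [← Real.sqrt_sq_eq_abs, bendLevel_sq hw, cutoff_of_ge (by norm_num at h1; linarith)]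
  simp

theorem deriv_bendLevel_pos {w : ℝ} (hw : 0 ≤ w) (s : ℝ) : 0 < deriv (fun s => bendLevel s w) s := by
  have hd : HasDerivAt (fun s => bendLevel s w) (deriv (fun s => bendLevel s w) s) s := by
    refine DifferentiableAt.hasDerivAt ?_
    have h1 : ContDiff ℝ ∞ (fun s => bendLevel s w) := by
      rw [← contDiffOn_univ]
      exact contDiffOn_bendLevel.comp (contDiff_id.prodMk contDiff_const).contDiffOn
        (fun _ _ => hw)
    exact h1.differentiable (by simp) s
  rcases eq_or_ne s 0 with rfl | hs
  · have h : HasDerivAt (fun s => bendLevel s w) 1 0 := by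
      refine (hasDerivAt_id (0 : ℝ)).congr_of_eventuallyEq ?_
      have h : ContinuousAt (fun s : ℝ => 4 * s ^ 2) 0 := by fun_prop
      filter_upwards [h.eventually (gt_mem_nhds (show 4 * (0 : ℝ) ^ 2 < 1 / 3 by norm_num))]
        with s hs
      exact bendLevel_of_small hs.le
    rw [h.deriv]
    exact one_pos
  · -- differentiate the square
    have hcut : HasDerivAt cutoff (deriv cutoff (4 * s ^ 2)) (4 * s ^ 2) :=
      (contDiff_cutoff.differentiable (by simp) _).hasDerivAt
    have hcneg : deriv cutoff (4 * s ^ 2) ≤ 0 := antitone_cutoff.deriv_nonpos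
    have h1 : HasDerivAt (fun s : ℝ => 4 * s ^ 2) (8 * s) s := by
      have := ((hasDerivAt_id s).pow 2).const_mul 4
      refine this.congr_deriv ?_
      simp only [id]; ring
    have h2 : HasDerivAt (fun s : ℝ => s ^ 2 + w * (1 - cutoff (4 * s ^ 2)))
        (2 * s + w * (0 - deriv cutoff (4 * s ^ 2) * (8 * s))) s := by
      have h3 : HasDerivAt (fun s : ℝ => cutoff (4 * s ^ 2)) (deriv cutoff (4 * s ^ 2) * (8 * s)) s :=
        HasDerivAt.comp (h₂ := cutoff) (h := fun s : ℝ => 4 * s ^ 2) s hcut h1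
      refine HasDerivAt.add ?_ (((hasDerivAt_const s (1 : ℝ)).sub h3).const_mul w)
      refine ((hasDerivAt_id s).pow 2).congr_deriv ?_
      simp only [id]; ring
    have h3 := hd.pow 2
    have h4 : (fun s => bendLevel s w) ^ 2 = fun s => s ^ 2 + w * (1 - cutoff (4 * s ^ 2)) :=
      funext (bendLevel_sq hw)
    rw [h4] at h3
    have h5 := h3.unique h2
    set f := √(1 + w * bendGain s)
    have hf : 0 < f := zero_lt_one.trans_le (one_le_bendLevel_factor hw s)
    have h6 : bendLevel s w = s * f := rfl
    set d := deriv (fun s => bendLevel s w) s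
    rw [h6] at h5
    have h7 : f * d = 1 + w * (4 * -deriv cutoff (4 * s ^ 2)) := by
      have : (2 * s) * (f * d) = (2 * s) * (1 + w * (4 * -deriv cutoff (4 * s ^ 2))) := by
        simp only [Nat.cast_ofNat, Nat.add_one_sub_one, pow_one] at h5
        linear_combination h5
      exact mul_left_cancel₀ (by simpa using hs) this
    have h8 : 0 < f * d := by
      rw [h7]
      have : 0 ≤ w * (4 * -deriv cutoff (4 * s ^ 2)) := by
        apply mul_nonneg hw; linarith
      linarith
    exact pos_of_mul_pos_right h8 hf.le

theorem strictMono_bendLevel {w : ℝ} (hw : 0 ≤ w) : StrictMono (fun s => bendLevel s w) :=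
  strictMono_of_deriv_pos (fun s => deriv_bendLevel_pos hw s)

theorem exists_bendLevel_eq {w : ℝ} (hw : 0 ≤ w) (v : ℝ) : ∃ s, bendLevel s w = v := by
  have hc : Continuous (fun s => bendLevel s w) :=
    continuous_bendLevel.comp (continuous_id.prodMk continuous_const)
  have h1 : v ≤ bendLevel |v| w :=
    calc v ≤ |v| := le_abs_self v
      _ ≤ |bendLevel |v| w| := by simpa using abs_le_abs_bendLevel hw |v|
      _ = _ := abs_of_nonneg (mul_nonneg (abs_nonneg v) (Real.sqrt_nonneg _))
  have h2 : bendLevel (-|v|) w ≤ v := by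
    have h3 : |bendLevel (-|v|) w| = -bendLevel (-|v|) w :=
      abs_of_nonpos (bendLevel_nonpos hw (neg_nonpos.2 (abs_nonneg v)))
    have h4 := abs_le_abs_bendLevel hw (-|v|)
    rw [h3, abs_neg, abs_abs] at h4
    linarith [neg_abs_le v]
  exact mem_range_of_exists_le_of_exists_ge hc ⟨_, h2⟩ ⟨_, h1⟩

/-- The inverse function of `bendLevel`. -/
noncomputable def unbendLevel (v w : ℝ) : ℝ :=
  Function.invFun (fun s => bendLevel s w) v

theorem bendLevel_unbendLevel {w : ℝ} (hw : 0 ≤ w) (v : ℝ) : bendLevel (unbendLevel v w) w = v :=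
  Function.invFun_eq (exists_bendLevel_eq hw v)

theorem unbendLevel_bendLevel {w : ℝ} (hw : 0 ≤ w) (s : ℝ) : unbendLevel (bendLevel s w) w = s :=
  (strictMono_bendLevel hw).injective (bendLevel_unbendLevel hw _)

theorem contDiffOn_unbendLevel :
    ContDiffOn ℝ ∞ (fun p : ℝ × ℝ => unbendLevel p.1 p.2) {p | 0 ≤ p.2} := by
  have hS : UniqueDiffOn ℝ {p : ℝ × ℝ | 0 ≤ p.2} := by
    have : {p : ℝ × ℝ | 0 ≤ p.2} = univ ×ˢ Ici 0 := by ext; simp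
    rw [this]
    exact uniqueDiffOn_univ.prod (uniqueDiffOn_Ici 0)
  refine contDiffOn_of_implicit (R := fun q : (ℝ × ℝ) × ℝ => bendLevel q.2 q.1.2) (c := Prod.fst)
    (L := univ) hS uniqueDiffOn_univ ?_ contDiff_fst.contDiffOn (fun p hp => ?_) (mapsTo_univ _ _)
    (fun p hp => ?_) (fun p hp => bendLevel_unbendLevel hp p.1)
  · exact contDiffOn_bendLevel.comp (f := fun q : (ℝ × ℝ) × ℝ => (q.2, q.1.2))
      (by fun_prop) (fun q hq => hq.1)
  · have hlt : ∀ a, ContinuousAt (fun p : ℝ × ℝ => bendLevel a p.2 - p.1) p := fun a =>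
      ((continuous_bendLevel.comp (continuous_const.prodMk continuous_snd)).sub
        continuous_fst).continuousAt
    refine tendsto_order.2 ⟨fun a ha => ?_, fun a ha => ?_⟩
    · have h1 : bendLevel a p.2 - p.1 < 0 := by
        have := strictMono_bendLevel hp ha
        simp only [bendLevel_unbendLevel hp] at this
        linarith
      filter_upwards [nhdsWithin_le_nhds ((hlt a).eventually (gt_mem_nhds h1)),
        self_mem_nhdsWithin] with p' h2 (hp' : 0 ≤ p'.2)
      refine (strictMono_bendLevel hp').lt_iff_lt.1 ?_
      simp only [bendLevel_unbendLevel hp']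
      linarith
    · have h1 : 0 < bendLevel a p.2 - p.1 := by
        have := strictMono_bendLevel hp ha
        simp only [bendLevel_unbendLevel hp] at this
        linarith
      filter_upwards [nhdsWithin_le_nhds ((hlt a).eventually (lt_mem_nhds h1)),
        self_mem_nhdsWithin] with p' h2 (hp' : 0 ≤ p'.2)
      refine (strictMono_bendLevel hp').lt_iff_lt.1 ?_
      simp only [bendLevel_unbendLevel hp']
      linarith
  · rw [derivWithin_univ]
    exact (deriv_bendLevel_pos hp _).ne'

/-- The time at the point `(r, h)` of the wedge `0 ≤ 2 * h ≤ r`. It vanishes on the two faces. The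
bending is in polar coordinates: near the edge, where the level is `s = r - 4 * h`, the time `t`
is given by `r ^ 2 = s ^ 2 + t / 16`. Far from the edge `bendLevel` makes the level equal to `r` or
`-r`, so that there the bending does not move points along the lines of the bicollar. -/
noncomputable def bendTime (r h : ℝ) : ℝ := 128 * h * (r - 2 * h)

/-- The level at the point `(r, h)` of the wedge `0 ≤ 2 * h ≤ r`. It is positive on the face
`h = 0` and negative on the other one. -/
noncomputable def bendHeightLevel (r h : ℝ) : ℝ := bendLevel (r - 4 * h) (bendTime r h / 16)

/-- The distance from the edge of the wedge, of the point with level `v` at time `t`. -/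
noncomputable def bendRadius (v t : ℝ) : ℝ := √(unbendLevel v (t / 16) ^ 2 + t / 16)

/-- The height in the wedge of the point with level `v` at time `t`. -/
noncomputable def bendHeight (v t : ℝ) : ℝ := (bendRadius v t - unbendLevel v (t / 16)) / 4

theorem bendTime_nonneg {r h : ℝ} (h0 : 0 ≤ h) (hr : 2 * h ≤ r) : 0 ≤ bendTime r h :=
  mul_nonneg (by linarith) (by linarith)

theorem sq_add_bendTime (r h : ℝ) : (r - 4 * h) ^ 2 + bendTime r h / 16 = r ^ 2 := by
  rw [bendTime]; ring

theorem bendRadius_of_wedge {r h : ℝ} (h0 : 0 ≤ h) (hr : 2 * h ≤ r) :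
    bendRadius (bendHeightLevel r h) (bendTime r h) = r := by
  have ht := bendTime_nonneg h0 hr
  rw [bendRadius, bendHeightLevel, unbendLevel_bendLevel (by linarith), sq_add_bendTime,
    Real.sqrt_sq (by linarith)]

theorem bendHeight_of_wedge {r h : ℝ} (h0 : 0 ≤ h) (hr : 2 * h ≤ r) :
    bendHeight (bendHeightLevel r h) (bendTime r h) = h := by
  have ht := bendTime_nonneg h0 hr
  rw [bendHeight, bendRadius_of_wedge h0 hr, bendHeightLevel, unbendLevel_bendLevel (by linarith)]
  ring

theorem bendTime_pos_or {r h : ℝ} (h0 : 0 ≤ h) (hr : 2 * h < r) :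
    0 < bendTime r h ∨ 0 < bendHeightLevel r h := by
  rcases h0.eq_or_lt with rfl | h1
  · refine Or.inr (bendLevel_pos (by simp [bendTime]) (by linarith))
  · exact Or.inl (mul_pos (by linarith) (by linarith))

theorem bendTime_of_face {r h : ℝ} (hr : 2 * h = r) : bendTime r h = 0 := by
  rw [bendTime, hr]; simp

theorem bendHeightLevel_of_face {r h : ℝ} (h0 : 0 ≤ h) (hr : 2 * h = r) :
    bendHeightLevel r h ≤ 0 :=
  bendLevel_nonpos (by rw [bendTime_of_face hr]; simp) (by linarith)

theorem abs_bendHeightLevel_le {r h : ℝ} (h0 : 0 ≤ h) (hr : 2 * h ≤ r) :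
    |bendHeightLevel r h| ≤ r := by
  have ht := bendTime_nonneg h0 hr
  have := abs_bendLevel_le (w := bendTime r h / 16) (by linarith) (r - 4 * h)
  rwa [sq_add_bendTime, Real.sqrt_sq (by linarith)] at this

theorem abs_bendHeightLevel_eq {r h : ℝ} (h0 : 0 ≤ h) (hr : 2 * h ≤ r) (ht1 : bendTime r h ≤ 1)
    (hr' : 5 / 8 ≤ r) : |bendHeightLevel r h| = r := by
  have ht := bendTime_nonneg h0 hr
  have hs : √((r - 4 * h) ^ 2 + bendTime r h / 16) = r := by
    rw [sq_add_bendTime, Real.sqrt_sq (by linarith)]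
  have := abs_bendLevel_eq (s := r - 4 * h) (w := bendTime r h / 16) (by linarith) (by linarith)
    (by rwa [hs])
  rwa [hs] at this

theorem abs_unbendLevel_le_bendRadius {v t : ℝ} (ht : 0 ≤ t) :
    |unbendLevel v (t / 16)| ≤ bendRadius v t := by
  rw [← Real.sqrt_sq_eq_abs]
  exact Real.sqrt_le_sqrt (by linarith)

theorem bendRadius_sq {v t : ℝ} (ht : 0 ≤ t) :
    bendRadius v t ^ 2 = unbendLevel v (t / 16) ^ 2 + t / 16 :=
  Real.sq_sqrt (by positivity)

theorem bendHeight_nonneg {v t : ℝ} (ht : 0 ≤ t) : 0 ≤ bendHeight v t := by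
  have := (le_abs_self _).trans (abs_unbendLevel_le_bendRadius (v := v) ht)
  rw [bendHeight]; linarith

theorem two_mul_bendHeight_le {v t : ℝ} (ht : 0 ≤ t) : 2 * bendHeight v t ≤ bendRadius v t := by
  have := (neg_abs_le _).trans' (neg_le_neg (abs_unbendLevel_le_bendRadius (v := v) ht))
  rw [bendHeight]; linarith

theorem bendTime_bendHeight {v t : ℝ} (ht : 0 ≤ t) :
    bendTime (bendRadius v t) (bendHeight v t) = t := by
  have := bendRadius_sq (v := v) ht
  rw [bendTime, bendHeight]
  linear_combination 16 * this

theorem bendHeightLevel_bendHeight {v t : ℝ} (ht : 0 ≤ t) :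
    bendHeightLevel (bendRadius v t) (bendHeight v t) = v := by
  rw [bendHeightLevel, bendTime_bendHeight ht]
  have : bendRadius v t - 4 * bendHeight v t = unbendLevel v (t / 16) := by rw [bendHeight]; ring
  rw [this, bendLevel_unbendLevel (by linarith)]

theorem two_mul_bendHeight_lt {v t : ℝ} (ht : 0 ≤ t) (h : 0 < t ∨ 0 < v) :
    2 * bendHeight v t < bendRadius v t := by
  refine (two_mul_bendHeight_le ht).lt_of_ne (fun he => ?_)
  have h1 := bendTime_of_face he
  have h2 := bendHeightLevel_of_face (bendHeight_nonneg ht) he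
  rw [bendTime_bendHeight ht] at h1
  rw [bendHeightLevel_bendHeight ht] at h2
  rcases h with h | h <;> linarith

theorem abs_le_bendRadius {v t : ℝ} (ht : 0 ≤ t) : |v| ≤ bendRadius v t := by
  have := abs_bendHeightLevel_le (bendHeight_nonneg (v := v) ht) (two_mul_bendHeight_le ht)
  rwa [bendHeightLevel_bendHeight ht] at this

theorem abs_eq_bendRadius {v t : ℝ} (ht : 0 ≤ t) (ht1 : t ≤ 1) (h : 5 / 8 ≤ bendRadius v t) :
    |v| = bendRadius v t := by
  have := abs_bendHeightLevel_eq (bendHeight_nonneg (v := v) ht) (two_mul_bendHeight_le ht)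
    (by rwa [bendTime_bendHeight ht]) h
  rwa [bendHeightLevel_bendHeight ht] at this

theorem contDiffOn_bendRadius : ContDiffOn ℝ ∞ (fun p : ℝ × ℝ => bendRadius p.1 p.2)
    {p | 0 ≤ p.2 ∧ (0 < p.2 ∨ 0 < p.1)} := by
  have h1 : ContDiffOn ℝ ∞ (fun p : ℝ × ℝ => unbendLevel p.1 (p.2 / 16)) {p | 0 ≤ p.2} :=
    contDiffOn_unbendLevel.comp (f := fun p : ℝ × ℝ => (p.1, p.2 / 16)) (by fun_prop)
      (fun p (hp : 0 ≤ p.2) => show 0 ≤ p.2 / 16 by linarith)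
  refine ContDiffOn.sqrt ?_ (fun p hp => ?_)
  · exact ((h1.mono (fun p hp => hp.1)).pow 2).add (by fun_prop)
  · have h2 : 0 < bendRadius p.1 p.2 := by
      have := two_mul_bendHeight_lt hp.1 hp.2
      have := bendHeight_nonneg (v := p.1) hp.1
      linarith
    exact (Real.sqrt_pos.1 h2).ne'

theorem contDiffOn_bendHeight : ContDiffOn ℝ ∞ (fun p : ℝ × ℝ => bendHeight p.1 p.2)
    {p | 0 ≤ p.2 ∧ (0 < p.2 ∨ 0 < p.1)} := by
  have h1 : ContDiffOn ℝ ∞ (fun p : ℝ × ℝ => unbendLevel p.1 (p.2 / 16)) {p | 0 ≤ p.2} :=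
    contDiffOn_unbendLevel.comp (f := fun p : ℝ × ℝ => (p.1, p.2 / 16)) (by fun_prop)
      (fun p (hp : 0 ≤ p.2) => show 0 ≤ p.2 / 16 by linarith)
  exact (contDiffOn_bendRadius.sub (h1.mono (fun p hp => hp.1))).div_const 4

theorem contDiff_bendTime : ContDiff ℝ ∞ (fun p : ℝ × ℝ => bendTime p.1 p.2) := by
  unfold bendTime; fun_prop

theorem contDiffOn_bendHeightLevel : ContDiffOn ℝ ∞ (fun p : ℝ × ℝ => bendHeightLevel p.1 p.2)
    {p | 0 ≤ p.2 ∧ 2 * p.2 ≤ p.1} := by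
  have := contDiff_bendTime
  exact contDiffOn_bendLevel.comp (f := fun p : ℝ × ℝ => (p.1 - 4 * p.2, bendTime p.1 p.2 / 16))
    (by fun_prop) (fun p hp => show 0 ≤ bendTime p.1 p.2 / 16 by
      have := bendTime_nonneg hp.1 hp.2; linarith)

/-! ### The bend map from a cylinder over the double to the cylinder over one half -/

/-- An odd function which is the identity for small `l` and the sign for large `l`. -/
noncomputable def saturate (l : ℝ) : ℝ :=
  cutoff (2 * l ^ 2 - 4 / 5) * l + (1 - cutoff (2 * l ^ 2 - 4 / 5)) * Real.sign l

theorem saturate_of_small {l : ℝ} (hl : |l| ≤ 3 / 4) : saturate l = l := by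
  have h : l ^ 2 ≤ 9 / 16 := by
    rw [← sq_abs]; nlinarith [abs_nonneg l]
  rw [saturate, cutoff_of_le (by linarith)]
  ring

theorem saturate_of_large {l : ℝ} (hl : 7 / 8 ≤ |l|) : saturate l = Real.sign l := by
  have h : 49 / 64 ≤ l ^ 2 := by
    rw [← sq_abs]; nlinarith [abs_nonneg l]
  rw [saturate, cutoff_of_ge (by linarith)]
  ring

theorem saturate_neg (l : ℝ) : saturate (-l) = -saturate l := by
  rw [saturate, saturate, Real.sign_neg, neg_sq]; ring

theorem saturate_mem {l : ℝ} (h0 : 0 < l) (h1 : l < 1) : saturate l ∈ Icc l 1 := by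
  have h2 := cutoff_nonneg (2 * l ^ 2 - 4 / 5)
  have h3 := cutoff_le_one (2 * l ^ 2 - 4 / 5)
  rw [saturate, Real.sign_of_pos h0]
  constructor <;> nlinarith

theorem contDiff_saturate : ContDiff ℝ ∞ saturate := by
  have hc : ContDiff ℝ ∞ (fun l : ℝ => cutoff (2 * l ^ 2 - 4 / 5)) :=
    contDiff_cutoff.comp (by fun_prop)
  refine contDiff_iff_contDiffAt.2 (fun l => ?_)
  rcases lt_trichotomy l 0 with h | h | h
  · have h1 : ContDiff ℝ ∞ (fun l : ℝ => cutoff (2 * l ^ 2 - 4 / 5) * l +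
        (1 - cutoff (2 * l ^ 2 - 4 / 5)) * (-1)) := by fun_prop
    refine h1.contDiffAt.congr_of_eventuallyEq ?_
    filter_upwards [gt_mem_nhds h] with l' hl'
    rw [saturate, Real.sign_of_neg hl']
  · refine contDiffAt_id.congr_of_eventuallyEq ?_
    have h1 : ContinuousAt (fun l : ℝ => |l|) l := continuous_abs.continuousAt
    filter_upwards [h1.eventually (gt_mem_nhds (show |l| < 3 / 4 by rw [h]; norm_num))] with l' hl'
    exact saturate_of_small hl'.le
  · have h1 : ContDiff ℝ ∞ (fun l : ℝ => cutoff (2 * l ^ 2 - 4 / 5) * l +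
        (1 - cutoff (2 * l ^ 2 - 4 / 5)) * 1) := by fun_prop
    refine h1.contDiffAt.congr_of_eventuallyEq ?_
    filter_upwards [lt_mem_nhds h] with l' hl'
    rw [saturate, Real.sign_of_pos hl']

/-- Smoothness on a set can be checked on two relatively open parts. -/
theorem contMDiffOn_of_inter_isOpen {𝕜 : Type*} [NontriviallyNormedField 𝕜]
    {E : Type*} [NormedAddCommGroup E] [NormedSpace 𝕜 E] {H : Type*} [TopologicalSpace H]
    {E' : Type*} [NormedAddCommGroup E'] [NormedSpace 𝕜 E'] {H' : Type*} [TopologicalSpace H']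
    {I : ModelWithCorners 𝕜 E H} {J : ModelWithCorners 𝕜 E' H'} {X Y : Type*} [TopologicalSpace X]
    [ChartedSpace H X] [TopologicalSpace Y] [ChartedSpace H' Y] {f : X → Y} {s U V : Set X}
    {n : WithTop ℕ∞} (hU : IsOpen U) (hV : IsOpen V) (hs : s ⊆ U ∪ V)
    (hfU : ContMDiffOn I J n f (s ∩ U)) (hfV : ContMDiffOn I J n f (s ∩ V)) :
    ContMDiffOn I J n f s := fun x hx => by
  rcases hs hx with h | h
  · exact (hfU x ⟨hx, h⟩).mono_of_mem_nhdsWithin (inter_mem_nhdsWithin s (hU.mem_nhds h))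
  · exact (hfV x ⟨hx, h⟩).mono_of_mem_nhdsWithin (inter_mem_nhdsWithin s (hV.mem_nhds h))

namespace MirrorDouble

variable {E : Type*} [NormedAddCommGroup E] [NormedSpace ℝ E] {H : Type*} [TopologicalSpace H]
  {E' : Type*} [NormedAddCommGroup E'] [NormedSpace ℝ E'] {H' : Type*} [TopologicalSpace H']
  {I : ModelWithCorners ℝ E H} {J : ModelWithCorners ℝ E' H'} {M N : Type*}
  [TopologicalSpace M] [ChartedSpace H M] [TopologicalSpace N] [ChartedSpace H' N]
  (D : MirrorDouble I J M N)

theorem b_q {z : N} (hz : z ∈ range D.b) : D.b (D.q z) = z := by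
  obtain ⟨x, rfl⟩ := hz; rw [D.q_b]

theorem j_q {z : N} (hz : z ∈ range D.j) : D.j (D.q z) = z := by
  obtain ⟨x, rfl⟩ := hz; rw [D.q_j]

theorem reflect_b {x : M} (hx : D.b x ∈ D.K.dom) :
    D.K.mov (D.b x) (-D.K.lev (D.b x)) = D.j x := by
  have hl := neg_mem_Ioo_one (D.K.lev_mem _ hx)
  have h1 : D.K.mov (D.b x) (-D.K.lev (D.b x)) ∈ range D.j := by
    rw [D.mem_j _ (D.K.mov_mem _ hx _ hl), D.K.lev_mov _ hx _ hl, neg_nonpos]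
    exact (D.mem_b _ hx).1 (mem_range_self x)
  rw [← D.j_q h1, D.q_mov _ hx, D.q_b]

theorem b_mem_dom_iff (x : M) : D.b x ∈ D.K.dom ↔ D.j x ∈ D.K.dom := by
  constructor
  · intro hx
    rw [← D.reflect_b hx]
    exact D.K.mov_mem _ hx _ (neg_mem_Ioo_one (D.K.lev_mem _ hx))
  · intro hx
    have hl := neg_mem_Ioo_one (D.K.lev_mem _ hx)
    have h0 := D.K.mov_mem _ hx _ hl
    have h1 : D.K.mov (D.j x) (-D.K.lev (D.j x)) ∈ range D.b := by
      rw [D.mem_b _ h0, D.K.lev_mov _ hx _ hl, neg_nonneg]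
      exact (D.mem_j _ hx).1 (mem_range_self x)
    rw [← D.b_q h1, D.q_mov _ hx, D.q_j] at h0
    exact h0

theorem lev_j {x : M} (hx : D.b x ∈ D.K.dom) : D.K.lev (D.j x) = -D.K.lev (D.b x) := by
  rw [← D.reflect_b hx, D.K.lev_mov _ hx _ (neg_mem_Ioo_one (D.K.lev_mem _ hx))]

open Classical in
/-- A function on all of `N` which measures on which side, and how far from the common boundary a
point is. Away from the bicollar it is `1` or `-1`. -/
noncomputable def height (z : N) : ℝ :=
  if z ∈ D.K.dom then saturate (D.K.lev z) else if z ∈ range D.b then 1 else -1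

theorem height_of_mem {z : N} (hz : z ∈ D.K.dom) : D.height z = saturate (D.K.lev z) := if_pos hz

theorem lev_eq_height_of_lt {z : N} (hz : |D.height z| < 3 / 4) :
    z ∈ D.K.dom ∧ D.height z = D.K.lev z := by
  by_cases h : z ∈ D.K.dom
  · refine ⟨h, ?_⟩
    rw [D.height_of_mem h] at hz ⊢
    have hl := D.K.lev_mem z h
    rcases lt_trichotomy (D.K.lev z) 0 with h0 | h0 | h0
    · have h1 := saturate_mem (l := -D.K.lev z) (by linarith) (by linarith [hl.1])
      rw [saturate_neg] at h1
      have h2 := neg_abs_le (saturate (D.K.lev z))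
      exact saturate_of_small (by rw [abs_of_neg h0]; linarith [h1.1])
    · rw [h0]; exact saturate_of_small (by norm_num)
    · have h1 := saturate_mem h0 hl.2
      have h2 := le_abs_self (saturate (D.K.lev z))
      exact saturate_of_small (by rw [abs_of_pos h0]; linarith [h1.1])
  · rw [height, if_neg h] at hz
    split_ifs at hz <;> norm_num at hz

theorem height_j (x : M) : D.height (D.j x) = -D.height (D.b x) := by
  by_cases h : D.b x ∈ D.K.dom
  · rw [D.height_of_mem h, D.height_of_mem ((D.b_mem_dom_iff x).1 h), D.lev_j h, saturate_neg]
  · have h' : D.j x ∉ D.K.dom := fun h' => h ((D.b_mem_dom_iff x).2 h')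
    have h1 : D.j x ∉ range D.b := fun h1 => h' (D.mem_base _ h1 (mem_range_self x)).1
    rw [height, height, if_neg h, if_neg h', if_neg h1, if_pos (mem_range_self x)]

theorem height_b_mem (x : M) : D.height (D.b x) ∈ Icc (0 : ℝ) 1 := by
  by_cases h : D.b x ∈ D.K.dom
  · rw [D.height_of_mem h]
    rcases ((D.mem_b _ h).1 (mem_range_self x)).eq_or_lt with h0 | h0
    · rw [← h0, saturate_of_small (by norm_num)]; simp
    · have h1 := saturate_mem h0 (D.K.lev_mem _ h).2
      exact ⟨h0.le.trans h1.1, h1.2⟩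
  · rw [height, if_neg h, if_pos (mem_range_self x)]; simp

theorem height_b_eq_zero_iff (x : M) : D.height (D.b x) = 0 ↔ D.b x ∈ D.K.base := by
  constructor
  · intro h
    obtain ⟨h1, h2⟩ := D.lev_eq_height_of_lt (z := D.b x) (by rw [h]; norm_num)
    exact ⟨h1, h2.symm.trans h⟩
  · intro h
    rw [D.height_of_mem h.1, h.2, saturate_of_small (by norm_num)]

theorem abs_height_le (z : N) : |D.height z| ≤ 1 := by
  rcases D.cover z with ⟨x, rfl⟩ | ⟨x, rfl⟩
  · have := D.height_b_mem x
    rw [abs_of_nonneg this.1]; exact this.2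
  · have := D.height_b_mem x
    rw [D.height_j, abs_neg, abs_of_nonneg this.1]; exact this.2

theorem mem_b_of_height_pos {z : N} (hz : 0 < D.height z) : z ∈ range D.b := by
  rcases D.cover z with h | ⟨x, rfl⟩
  · exact h
  · have := D.height_b_mem x
    rw [D.height_j] at hz
    linarith [this.1]

theorem mem_j_of_height_neg {z : N} (hz : D.height z < 0) : z ∈ range D.j := by
  rcases D.cover z with ⟨x, rfl⟩ | h
  · have := D.height_b_mem x
    linarith [this.1]
  · exact h

theorem height_q (z : N) : D.height (D.b (D.q z)) = |D.height z| := by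
  rcases D.cover z with ⟨x, rfl⟩ | ⟨x, rfl⟩
  · rw [D.q_b, abs_of_nonneg (D.height_b_mem x).1]
  · rw [D.q_j, D.height_j, abs_neg, abs_of_nonneg (D.height_b_mem x).1]

theorem contMDiff_height : ContMDiff J 𝓘(ℝ, ℝ) ∞ D.height := by
  have hC := (D.K.closed (7 / 8) (by norm_num)).isOpen_compl
  rw [← contMDiffOn_univ]
  refine contMDiffOn_of_inter_isOpen D.K.isOpen_dom hC (fun z _ => ?_) ?_ ?_
  · by_cases h : z ∈ D.K.dom
    · exact Or.inl h
    · exact Or.inr (fun h' => h h'.1)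
  · rw [univ_inter]
    exact (contDiff_saturate.contMDiff.comp_contMDiffOn D.K.smooth_lev).congr
      (fun z hz => D.height_of_mem hz)
  · -- away from the bicollar the two sides are separated, and the function is constant on each
    have key : ∀ z ∈ {z | z ∈ D.K.dom ∧ |D.K.lev z| ≤ 7 / 8}ᶜ, z ∈ range D.b → z ∉ range D.j ∧
        D.height z = 1 := fun z hz hb => by
      refine ⟨fun hj => hz ?_, ?_⟩
      · have := D.mem_base z hb hj
        exact ⟨this.1, by rw [this.2]; norm_num⟩
      · by_cases h : z ∈ D.K.dom
        · have h1 := (D.mem_b z h).1 hb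
          have h2 : 7 / 8 < |D.K.lev z| := not_le.1 (fun h3 => hz ⟨h, h3⟩)
          rw [D.height_of_mem h, saturate_of_large h2.le]
          rw [abs_of_nonneg h1] at h2
          exact Real.sign_of_pos (by linarith)
        · rw [height, if_neg h, if_pos hb]
    have key' : ∀ z ∈ {z | z ∈ D.K.dom ∧ |D.K.lev z| ≤ 7 / 8}ᶜ, z ∈ range D.j → z ∉ range D.b ∧
        D.height z = -1 := fun z hz hj => by
      have hb : z ∉ range D.b := fun hb => (key z hz hb).1 hj
      refine ⟨hb, ?_⟩
      by_cases h : z ∈ D.K.dom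
      · have h1 := (D.mem_j z h).1 hj
        have h2 : 7 / 8 < |D.K.lev z| := not_le.1 (fun h3 => hz ⟨h, h3⟩)
        rw [D.height_of_mem h, saturate_of_large h2.le]
        rw [abs_of_nonpos h1] at h2
        exact Real.sign_of_neg (by linarith)
      · rw [height, if_neg h, if_neg hb]
    refine contMDiffOn_of_inter_isOpen (D.isClosed_j.isOpen_compl) (D.isClosed_b.isOpen_compl)
      (fun z hz => ?_) ?_ ?_
    · by_cases h : z ∈ range D.j
      · exact Or.inr (key' z hz.2 h).1
      · exact Or.inl h
    · exact (contMDiffOn_const (c := (1 : ℝ))).congr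
        (fun z hz => (key z hz.1.2 ((D.cover z).resolve_right hz.2)).2)
    · exact (contMDiffOn_const (c := (-1 : ℝ))).congr
        (fun z hz => (key' z hz.1.2 ((D.cover z).resolve_left hz.2)).2)

/-- The folding map is not smooth on the common boundary. -/
theorem contMDiffOn_q : ContMDiffOn J I ∞ D.q {z | D.height z ≠ 0} := by
  have h1 : IsOpen {z | 0 < D.height z} := isOpen_lt continuous_const D.contMDiff_height.continuous
  have h2 : IsOpen {z | D.height z < 0} := isOpen_lt D.contMDiff_height.continuous continuous_const
  exact contMDiffOn_of_inter_isOpen h1 h2 (fun z hz => (lt_or_gt_of_ne hz).symm)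
    (D.smooth_q_b.mono (fun z hz => D.mem_b_of_height_pos hz.2))
    (D.smooth_q_j.mono (fun z hz => D.mem_j_of_height_neg hz.2))

end MirrorDouble

namespace MirrorDouble

variable {E : Type*} [NormedAddCommGroup E] [NormedSpace ℝ E] {H : Type*} [TopologicalSpace H]
  {E' : Type*} [NormedAddCommGroup E'] [NormedSpace ℝ E'] {H' : Type*} [TopologicalSpace H']
  {I : ModelWithCorners ℝ E H} {J : ModelWithCorners ℝ E' H'} {M N : Type*}
  [TopologicalSpace M] [ChartedSpace H M] [TopologicalSpace N] [ChartedSpace H' N]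
  (D : MirrorDouble I J M N)

/-- The part of `N × [0, 1]` on which the bend map is a diffeomorphism: the closed second half of
`N × 0`, and all of `N × 1`, are removed. -/
def bendSource : Set (N × unitInterval) := {p | (p.2 : ℝ) < 1 ∧ (0 < (p.2 : ℝ) ∨ 0 < D.height p.1)}

/-- The image of `bendSource` under the bend map. -/
def bendTarget : Set (M × unitInterval) :=
  {z | 2 * (z.2 : ℝ) < D.height (D.b z.1) ∧ bendTime (D.height (D.b z.1)) z.2 < 1}

/-- The bend map: it maps `b(M) × 0` to the bottom of `M × [0, 1]`, and the other half of `N × 0`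
to a graph over `M`, touching the bottom along the boundary. Far from the common boundary the first
coordinate is just folded. -/
noncomputable def bend (p : N × unitInterval) : M × unitInterval :=
  (if |D.height p.1| < 3 / 4 then D.q (D.K.mov p.1 (bendRadius (D.height p.1) p.2)) else D.q p.1,
    projIcc 0 1 zero_le_one (bendHeight (D.height p.1) p.2))

/-- The inverse of the bend map. -/
noncomputable def unbend (z : M × unitInterval) : N × unitInterval :=
  (if D.height (D.b z.1) < 3 / 4 then
      D.K.mov (D.b z.1) (bendHeightLevel (D.height (D.b z.1)) z.2)
    else if 0 < bendHeightLevel (D.height (D.b z.1)) z.2 then D.b z.1 else D.j z.1,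
    projIcc 0 1 zero_le_one (bendTime (D.height (D.b z.1)) z.2))

theorem isOpen_bendTarget : IsOpen D.bendTarget := by
  have h1 : Continuous (fun z : M × unitInterval => D.height (D.b z.1)) :=
    D.contMDiff_height.continuous.comp (D.smooth_b.continuous.comp continuous_fst)
  have h2 : Continuous (fun z : M × unitInterval => bendTime (D.height (D.b z.1)) z.2) :=
    contDiff_bendTime.continuous.comp (h1.prodMk (by fun_prop))
  exact (isOpen_lt (by fun_prop) h1).inter (isOpen_lt h2 continuous_const)

theorem bendRadius_le_one (z : N) (t : unitInterval) : bendRadius (D.height z) t ≤ 1 := by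
  by_contra h
  have h1 := abs_eq_bendRadius (v := D.height z) t.2.1 t.2.2 (by linarith)
  linarith [D.abs_height_le z]

theorem bendRadius_lt {z : N} (hz : |D.height z| < 3 / 4) (t : unitInterval) :
    0 ≤ bendRadius (D.height z) t ∧ bendRadius (D.height z) t < 3 / 4 := by
  refine ⟨Real.sqrt_nonneg _, ?_⟩
  by_contra h
  have h1 := abs_eq_bendRadius (v := D.height z) t.2.1 t.2.2 (by linarith)
  linarith

theorem bendHeight_mem (z : N) (t : unitInterval) :
    bendHeight (D.height z) t ∈ Icc (0 : ℝ) 1 :=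
  ⟨bendHeight_nonneg t.2.1, by
    linarith [D.bendRadius_le_one z t, two_mul_bendHeight_le (v := D.height z) t.2.1,
      bendHeight_nonneg (v := D.height z) t.2.1]⟩

theorem coe_bend_snd (p : N × unitInterval) :
    ((D.bend p).2 : ℝ) = bendHeight (D.height p.1) p.2 := by
  change ((projIcc 0 1 zero_le_one (bendHeight (D.height p.1) p.2) : unitInterval) : ℝ) = _
  rw [projIcc_of_mem zero_le_one (D.bendHeight_mem p.1 p.2)]

theorem mov_radius_mem {p : N} (hp : |D.height p| < 3 / 4) (t : unitInterval) :
    D.K.mov p (bendRadius (D.height p) t) ∈ range D.b ∧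
      D.height (D.K.mov p (bendRadius (D.height p) t)) = bendRadius (D.height p) t := by
  obtain ⟨h1, -⟩ := D.lev_eq_height_of_lt hp
  obtain ⟨h2, h3⟩ := D.bendRadius_lt hp t
  have hl : bendRadius (D.height p) t ∈ Ioo (-1 : ℝ) 1 := ⟨by linarith, by linarith⟩
  have h4 := D.K.mov_mem _ h1 _ hl
  have h5 := D.K.lev_mov _ h1 _ hl
  refine ⟨(D.mem_b _ h4).2 (by rwa [h5]), ?_⟩
  rw [D.height_of_mem h4, h5, saturate_of_small (by rw [abs_of_nonneg h2]; exact h3.le)]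

theorem height_bend_fst (p : N × unitInterval) :
    D.height (D.b (D.bend p).1) = bendRadius (D.height p.1) p.2 := by
  by_cases h : |D.height p.1| < 3 / 4
  · obtain ⟨h1, h2⟩ := D.mov_radius_mem h p.2
    simp only [bend, if_pos h]
    rw [D.b_q h1, h2]
  · simp only [bend, if_neg h]
    rw [D.height_q]
    refine abs_eq_bendRadius p.2.2.1 p.2.2.2 ?_
    have := abs_le_bendRadius (v := D.height p.1) p.2.2.1
    linarith

theorem mapsTo_bend : MapsTo D.bend D.bendSource D.bendTarget := fun p hp => by
  refine ⟨?_, ?_⟩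
  · rw [D.height_bend_fst, D.coe_bend_snd]
    exact two_mul_bendHeight_lt p.2.2.1 hp.2
  · rw [D.height_bend_fst, D.coe_bend_snd, bendTime_bendHeight p.2.2.1]
    exact hp.1

theorem unbend_bend (p : N × unitInterval) : D.unbend (D.bend p) = p := by
  have hv : bendHeightLevel (D.height (D.b (D.bend p).1)) (D.bend p).2 = D.height p.1 := by
    rw [D.height_bend_fst, D.coe_bend_snd, bendHeightLevel_bendHeight p.2.2.1]
  have ht : bendTime (D.height (D.b (D.bend p).1)) (D.bend p).2 = p.2 := by
    rw [D.height_bend_fst, D.coe_bend_snd, bendTime_bendHeight p.2.2.1]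
  refine Prod.ext ?_ ?_
  · simp only [unbend]
    rw [hv, D.height_bend_fst]
    by_cases h : |D.height p.1| < 3 / 4
    · obtain ⟨h1, h2⟩ := D.lev_eq_height_of_lt h
      obtain ⟨h3, h4⟩ := D.bendRadius_lt h p.2
      rw [if_pos h4]
      simp only [bend, if_pos h]
      rw [D.b_q (D.mov_radius_mem h p.2).1, D.K.mov_mov _ h1 _ ⟨by linarith, by linarith⟩ _
        (by rw [h2]; exact D.K.lev_mem _ h1), h2, D.K.mov_lev _ h1]
    · have h1 := abs_le_bendRadius (v := D.height p.1) p.2.2.1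
      rw [if_neg (by linarith)]
      simp only [bend, if_neg h]
      split_ifs with h2
      · exact D.b_q (D.mem_b_of_height_pos h2)
      · refine D.j_q (D.mem_j_of_height_neg (lt_of_le_of_ne (not_lt.1 h2) (fun h3 => h ?_)))
        rw [h3]; norm_num
  · simp only [unbend, ht]
    exact projIcc_val zero_le_one p.2

/-- The closed wedge, on which the inverse of the bend map is still defined. -/
def wedge : Set (M × unitInterval) :=
  {z | 2 * (z.2 : ℝ) ≤ D.height (D.b z.1) ∧ bendTime (D.height (D.b z.1)) z.2 ≤ 1}

theorem bendTarget_subset_wedge : D.bendTarget ⊆ D.wedge := fun _ hz => ⟨hz.1.le, hz.2.le⟩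

theorem isClosed_wedge : IsClosed D.wedge := by
  have h1 : Continuous (fun z : M × unitInterval => D.height (D.b z.1)) :=
    D.contMDiff_height.continuous.comp (D.smooth_b.continuous.comp continuous_fst)
  have h2 : Continuous (fun z : M × unitInterval => bendTime (D.height (D.b z.1)) z.2) :=
    contDiff_bendTime.continuous.comp (h1.prodMk (by fun_prop))
  exact (isClosed_le (by fun_prop) h1).inter (isClosed_le h2 continuous_const)

theorem coe_unbend_snd {z : M × unitInterval} (hz : z ∈ D.wedge) :
    ((D.unbend z).2 : ℝ) = bendTime (D.height (D.b z.1)) z.2 := by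
  change ((projIcc 0 1 zero_le_one (bendTime (D.height (D.b z.1)) z.2) : unitInterval) : ℝ) = _
  rw [projIcc_of_mem zero_le_one ⟨bendTime_nonneg z.2.2.1 hz.1, hz.2⟩]

theorem bendHeightLevel_of_small {z : M × unitInterval} (hz : z ∈ D.wedge)
    (h : D.height (D.b z.1) < 3 / 4) : D.b z.1 ∈ D.K.dom ∧
      D.height (D.b z.1) = D.K.lev (D.b z.1) ∧
      |bendHeightLevel (D.height (D.b z.1)) z.2| < 3 / 4 := by
  have h1 := D.lev_eq_height_of_lt (z := D.b z.1)
    (by rwa [abs_of_nonneg (D.height_b_mem z.1).1])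
  exact ⟨h1.1, h1.2, (abs_bendHeightLevel_le z.2.2.1 hz.1).trans_lt h⟩

theorem height_unbend_fst {z : M × unitInterval} (hz : z ∈ D.wedge) :
    D.height (D.unbend z).1 = bendHeightLevel (D.height (D.b z.1)) z.2 := by
  by_cases h : D.height (D.b z.1) < 3 / 4
  · obtain ⟨h1, h2, h3⟩ := D.bendHeightLevel_of_small hz h
    simp only [unbend, if_pos h]
    have hl : bendHeightLevel (D.height (D.b z.1)) z.2 ∈ Ioo (-1 : ℝ) 1 :=
      abs_lt.1 (h3.trans (by norm_num))
    rw [D.height_of_mem (D.K.mov_mem _ h1 _ hl), D.K.lev_mov _ h1 _ hl, saturate_of_small h3.le]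
  · have h1 := abs_bendHeightLevel_eq z.2.2.1 hz.1 hz.2 (by linarith)
    simp only [unbend, if_neg h]
    split_ifs with h2
    · rw [abs_of_pos h2] at h1
      exact h1.symm
    · rw [abs_of_nonpos (not_lt.1 h2)] at h1
      rw [D.height_j]
      linarith

theorem mapsTo_unbend : MapsTo D.unbend D.bendTarget D.bendSource := fun z hz => by
  have hz' := D.bendTarget_subset_wedge hz
  refine ⟨?_, ?_⟩
  · rw [D.coe_unbend_snd hz']
    exact hz.2
  · rw [D.coe_unbend_snd hz', D.height_unbend_fst hz']
    exact bendTime_pos_or z.2.2.1 hz.1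

theorem bend_unbend {z : M × unitInterval} (hz : z ∈ D.wedge) : D.bend (D.unbend z) = z := by
  have hr : bendRadius (D.height (D.unbend z).1) (D.unbend z).2 = D.height (D.b z.1) := by
    rw [D.coe_unbend_snd hz, D.height_unbend_fst hz, bendRadius_of_wedge z.2.2.1 hz.1]
  refine Prod.ext ?_ ?_
  · simp only [bend, hr]
    rw [D.height_unbend_fst hz]
    by_cases h : D.height (D.b z.1) < 3 / 4
    · obtain ⟨h1, h2, h3⟩ := D.bendHeightLevel_of_small hz h
      have hl : bendHeightLevel (D.height (D.b z.1)) z.2 ∈ Ioo (-1 : ℝ) 1 :=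
        abs_lt.1 (h3.trans (by norm_num))
      rw [if_pos h3]
      simp only [unbend, if_pos h]
      rw [D.K.mov_mov _ h1 _ hl _ (by rw [h2]; exact D.K.lev_mem _ h1), h2, D.K.mov_lev _ h1, D.q_b]
    · have h1 := abs_bendHeightLevel_eq z.2.2.1 hz.1 hz.2 (by linarith)
      rw [if_neg (by rwa [h1])]
      simp only [unbend, if_neg h]
      split_ifs
      · exact D.q_b _
      · exact D.q_j _
  · refine Subtype.ext ?_
    rw [D.coe_bend_snd, D.coe_unbend_snd hz, D.height_unbend_fst hz,
      bendHeight_of_wedge z.2.2.1 hz.1]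

theorem contMDiff_height_fst : ContMDiff (J.prod (𝓡∂ 1)) 𝓘(ℝ, ℝ) ∞
    (fun p : N × unitInterval => D.height p.1) :=
  D.contMDiff_height.comp contMDiff_fst

theorem contMDiff_height_time : ContMDiff (J.prod (𝓡∂ 1)) 𝓘(ℝ, ℝ × ℝ) ∞
    (fun p : N × unitInterval => (D.height p.1, (p.2 : ℝ))) :=
  D.contMDiff_height_fst.prodMk_space (contMDiff_subtypeVal_Icc.comp contMDiff_snd)

theorem contMDiffOn_bendRadius_height : ContMDiffOn (J.prod (𝓡∂ 1)) 𝓘(ℝ, ℝ) ∞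
    (fun p : N × unitInterval => bendRadius (D.height p.1) p.2) D.bendSource :=
  contDiffOn_bendRadius.contMDiffOn.comp D.contMDiff_height_time.contMDiffOn
    (fun p hp => ⟨p.2.2.1, hp.2⟩)

theorem contMDiffOn_bend_snd : ContMDiffOn (J.prod (𝓡∂ 1)) (𝓡∂ 1) ∞
    (fun p => (D.bend p).2) D.bendSource := by
  have hT : ContMDiffOn (J.prod (𝓡∂ 1)) 𝓘(ℝ, ℝ) ∞
      (fun p : N × unitInterval => bendHeight (D.height p.1) p.2) D.bendSource :=
    ContMDiffOn.comp (I' := 𝓘(ℝ, ℝ × ℝ)) (g := fun p : ℝ × ℝ => bendHeight p.1 p.2)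
      (t := {p | 0 ≤ p.2 ∧ (0 < p.2 ∨ 0 < p.1)})
      (f := fun p : N × unitInterval => (D.height p.1, (p.2 : ℝ)))
      (contMDiffOn_iff_contDiffOn.2 contDiffOn_bendHeight)
      D.contMDiff_height_time.contMDiffOn (fun p hp => ⟨p.2.2.1, hp.2⟩)
  exact contMDiffOn_projIcc.comp hT (fun p _ => D.bendHeight_mem p.1 p.2)

theorem contMDiffOn_bend_fst_near : ContMDiffOn (J.prod (𝓡∂ 1)) I ∞
    (fun p => (D.bend p).1) (D.bendSource ∩ {p | |D.height p.1| < 3 / 4}) := by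
  have h1 : ContMDiffOn (J.prod (𝓡∂ 1)) J ∞
      (fun p : N × unitInterval => D.K.mov p.1 (bendRadius (D.height p.1) p.2))
      (D.bendSource ∩ {p | |D.height p.1| < 3 / 4}) := by
    refine D.K.contMDiffOn_mov contMDiff_fst.contMDiffOn
      (D.contMDiffOn_bendRadius_height.mono inter_subset_left)
      (fun p hp => (D.lev_eq_height_of_lt hp.2).1) (fun p hp => ?_)
    obtain ⟨h1, h2⟩ := D.bendRadius_lt hp.2 p.2
    exact ⟨by linarith, by linarith⟩
  exact (D.smooth_q_b.comp h1 (fun p hp => (D.mov_radius_mem hp.2 p.2).1)).congr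
    (fun p hp => if_pos hp.2)

theorem contMDiffOn_bend_fst_far : ContMDiffOn (J.prod (𝓡∂ 1)) I ∞
    (fun p => (D.bend p).1) (D.bendSource ∩ {p | 5 / 8 < |D.height p.1|}) := by
  have h1 : ContMDiffOn (J.prod (𝓡∂ 1)) I ∞ (fun p : N × unitInterval => D.q p.1)
      (D.bendSource ∩ {p | 5 / 8 < |D.height p.1|}) := by
    refine D.contMDiffOn_q.comp contMDiff_fst.contMDiffOn (fun p hp => ?_)
    have h : 5 / 8 < |D.height p.1| := hp.2
    intro h0
    rw [h0, abs_zero] at h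
    linarith
  refine h1.congr (fun p hp => ?_)
  -- in the region between the two zones the point is not moved, or reflected
  have h0 : 5 / 8 < |D.height p.1| := hp.2
  by_cases h : |D.height p.1| < 3 / 4
  · obtain ⟨h1, h2⟩ := D.lev_eq_height_of_lt h
    have h3 : |D.height p.1| = bendRadius (D.height p.1) p.2 :=
      abs_eq_bendRadius p.2.2.1 p.2.2.2 (h0.le.trans (abs_le_bendRadius p.2.2.1))
    simp only [bend, if_pos h]
    rw [← h3, h2]
    rcases abs_cases (D.K.lev p.1) with h4 | h4
    · rw [h4.1, D.K.mov_lev _ h1]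
    · rw [h4.1, D.q_mov _ h1]
  · simp only [bend, if_neg h]

theorem contMDiffOn_bend :
    ContMDiffOn (J.prod (𝓡∂ 1)) (I.prod (𝓡∂ 1)) ∞ D.bend D.bendSource := by
  have hva : Continuous (fun p : N × unitInterval => |D.height p.1|) :=
    D.contMDiff_height_fst.continuous.abs
  have h1 : ContMDiffOn (J.prod (𝓡∂ 1)) I ∞ (fun p => (D.bend p).1) D.bendSource := by
    refine contMDiffOn_of_inter_isOpen (isOpen_lt hva (continuous_const (y := (3 / 4 : ℝ))))
      (isOpen_lt (continuous_const (y := (5 / 8 : ℝ))) hva) (fun p _ => ?_)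
      D.contMDiffOn_bend_fst_near D.contMDiffOn_bend_fst_far
    rcases lt_or_ge |D.height p.1| (3 / 4) with h | h
    · exact Or.inl h
    · exact Or.inr (show 5 / 8 < |D.height p.1| by linarith)
  exact h1.prodMk D.contMDiffOn_bend_snd

theorem contMDiffOn_unbend : ContMDiffOn (I.prod (𝓡∂ 1)) (J.prod (𝓡∂ 1)) ∞ D.unbend D.wedge := by
  have hb : ContMDiff (I.prod (𝓡∂ 1)) J ∞ (fun z : M × unitInterval => D.b z.1) :=
    D.smooth_b.comp contMDiff_fst
  have hv : ContMDiff (I.prod (𝓡∂ 1)) 𝓘(ℝ, ℝ) ∞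
      (fun z : M × unitInterval => D.height (D.b z.1)) := D.contMDiff_height.comp hb
  have hvt : ContMDiff (I.prod (𝓡∂ 1)) 𝓘(ℝ, ℝ × ℝ) ∞
      (fun z : M × unitInterval => (D.height (D.b z.1), (z.2 : ℝ))) :=
    hv.prodMk_space (contMDiff_subtypeVal_Icc.comp contMDiff_snd)
  have hT : ContMDiff (I.prod (𝓡∂ 1)) 𝓘(ℝ, ℝ) ∞
      (fun z : M × unitInterval => bendTime (D.height (D.b z.1)) z.2) :=
    contDiff_bendTime.contMDiff.comp hvt
  have hV : ContMDiffOn (I.prod (𝓡∂ 1)) 𝓘(ℝ, ℝ) ∞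
      (fun z : M × unitInterval => bendHeightLevel (D.height (D.b z.1)) z.2) D.wedge :=
    contDiffOn_bendHeightLevel.contMDiffOn.comp hvt.contMDiffOn (fun z hz => ⟨z.2.2.1, hz.1⟩)
  refine ContMDiffOn.prodMk ?_ (contMDiffOn_projIcc.comp hT.contMDiffOn
    (fun z hz => ⟨bendTime_nonneg z.2.2.1 hz.1, hz.2⟩))
  refine contMDiffOn_of_inter_isOpen
    (isOpen_lt hv.continuous (continuous_const (y := (3 / 4 : ℝ))))
    (isOpen_lt (continuous_const (y := (5 / 8 : ℝ))) hv.continuous) (fun z _ => ?_) ?_ ?_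
  · rcases lt_or_ge (D.height (D.b z.1)) (3 / 4) with h | h
    · exact Or.inl h
    · exact Or.inr (show 5 / 8 < D.height (D.b z.1) by linarith)
  · exact (D.K.contMDiffOn_mov hb.contMDiffOn (hV.mono inter_subset_left)
      (fun z hz => (D.bendHeightLevel_of_small hz.1 hz.2).1)
      (fun z hz => abs_lt.1 ((D.bendHeightLevel_of_small hz.1 hz.2).2.2.trans (by norm_num)))).congr
      (fun z hz => if_pos hz.2)
  · -- here the sign of the level is locally constant
    have habs : ∀ z ∈ D.wedge ∩ {z | 5 / 8 < D.height (D.b z.1)},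
        |bendHeightLevel (D.height (D.b z.1)) z.2| = D.height (D.b z.1) := fun z hz =>
      abs_bendHeightLevel_eq z.2.2.1 hz.1.1 hz.1.2 (le_of_lt hz.2)
    have hpos : ∀ z ∈ D.wedge ∩ {z | 5 / 8 < D.height (D.b z.1)},
        0 < bendHeightLevel (D.height (D.b z.1)) z.2 → (D.unbend z).1 = D.b z.1 := fun z hz h => by
      by_cases h1 : D.height (D.b z.1) < 3 / 4
      · obtain ⟨h2, h3, -⟩ := D.bendHeightLevel_of_small hz.1 h1
        have h4 := habs z hz
        rw [abs_of_pos h] at h4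
        simp only [unbend, if_pos h1]
        rw [h4, h3, D.K.mov_lev _ h2]
      · simp only [unbend, if_neg h1, if_pos h]
    have hneg : ∀ z ∈ D.wedge ∩ {z | 5 / 8 < D.height (D.b z.1)},
        bendHeightLevel (D.height (D.b z.1)) z.2 < 0 → (D.unbend z).1 = D.j z.1 := fun z hz h => by
      by_cases h1 : D.height (D.b z.1) < 3 / 4
      · obtain ⟨h2, h3, -⟩ := D.bendHeightLevel_of_small hz.1 h1
        have h4 := habs z hz
        rw [abs_of_neg h] at h4
        have h5 : bendHeightLevel (D.height (D.b z.1)) z.2 = -D.K.lev (D.b z.1) := by linarith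
        simp only [unbend, if_pos h1]
        rw [h5, D.reflect_b h2]
      · simp only [unbend, if_neg h1, if_neg (not_lt.2 h.le)]
    intro z hz
    have hV' := (hV.mono (inter_subset_left (t := {z | 5 / 8 < D.height (D.b z.1)}))).continuousOn z hz
    rcases lt_trichotomy (bendHeightLevel (D.height (D.b z.1)) z.2) 0 with h | h | h
    · refine (ContMDiffAt.contMDiffWithinAt ((D.smooth_j.comp contMDiff_fst)
        z)).congr_of_eventuallyEq_of_mem ?_ hz
      filter_upwards [hV'.eventually (gt_mem_nhds h), self_mem_nhdsWithin] with y hy hy'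
      exact hneg y hy' hy
    · have h1 := habs z hz
      have h2 : 5 / 8 < D.height (D.b z.1) := hz.2
      rw [h, abs_zero] at h1
      linarith
    · refine (ContMDiffAt.contMDiffWithinAt (hb z)).congr_of_eventuallyEq_of_mem ?_ hz
      filter_upwards [hV'.eventually (lt_mem_nhds h), self_mem_nhdsWithin] with y hy hy'
      exact hpos y hy' hy

/-- A diffeomorphism of `N × [0, 1]` which is the identity away from `b(M) × 0` and the interior
gives a diffeomorphism of `M × [0, 1]`, by the bend map. -/
theorem exists_bent_diffeomorph (Θ : (N × unitInterval) ≃ₘ^∞⟮J.prod (𝓡∂ 1), J.prod (𝓡∂ 1)⟯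
    (N × unitInterval)) {S : Set (N × unitInterval)} (hSc : IsClosed S) (hSU : S ⊆ D.bendSource)
    (hS : ∀ p ∉ S, Θ p = p) :
    ∃ Ψ : (M × unitInterval) ≃ₘ^∞⟮I.prod (𝓡∂ 1), I.prod (𝓡∂ 1)⟯ (M × unitInterval),
      (∀ p ∈ D.bendSource, Ψ (D.bend p) = D.bend (Θ p)) ∧ ∀ z ∉ D.bendTarget, Ψ z = z := by
  have himg : D.bend '' S = D.wedge ∩ D.unbend ⁻¹' S := by
    ext z
    constructor
    · rintro ⟨p, hp, rfl⟩
      refine ⟨D.bendTarget_subset_wedge (D.mapsTo_bend (hSU hp)), ?_⟩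
      rwa [mem_preimage, D.unbend_bend]
    · rintro ⟨hz, hz'⟩
      exact ⟨_, hz', D.bend_unbend hz⟩
  obtain ⟨Ψ, h1, h2⟩ := exists_diffeomorph_transport D.isOpen_bendTarget D.contMDiffOn_bend
    (D.contMDiffOn_unbend.mono D.bendTarget_subset_wedge) D.mapsTo_bend D.mapsTo_unbend
    (fun p _ => D.unbend_bend p) (fun z hz => D.bend_unbend (D.bendTarget_subset_wedge hz)) Θ hSU hS
    (by rw [himg]; exact D.contMDiffOn_unbend.continuousOn.preimage_isClosed_of_isClosed
          D.isClosed_wedge hSc)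
  exact ⟨Ψ, h1, fun z hz => h2 z (fun ⟨p, hp, hpz⟩ => hz (hpz ▸ D.mapsTo_bend (hSU hp)))⟩

theorem bend_bottom {x : M} (hx : 0 < D.height (D.b x)) : D.bend (D.b x, 0) = (x, 0) := by
  have h : ((x, 0) : M × unitInterval) ∈ D.wedge := by
    refine ⟨?_, ?_⟩
    · simpa using hx.le
    · simp [bendTime]
  rw [← D.bend_unbend h]
  congr 1
  refine Prod.ext ?_ ?_
  · have h1 : bendHeightLevel (D.height (D.b x)) ((0 : unitInterval) : ℝ) = D.height (D.b x) := by
      simp [bendHeightLevel, bendTime, bendLevel]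
    simp only [unbend]
    rw [h1, if_pos hx]
    split_ifs with h2
    · obtain ⟨h3, h4, -⟩ := D.bendHeightLevel_of_small h h2
      change D.b x = D.K.mov (D.b x) _
      rw [h4, D.K.mov_lev _ h3]
    · rfl
  · simp [unbend, bendTime]

end MirrorDouble

/-! ### Diffeomorphisms which are the identity near the boundary -/

section Slice

variable {E : Type*} [NormedAddCommGroup E] [NormedSpace ℝ E] {H : Type*} [TopologicalSpace H]
  {I : ModelWithCorners ℝ E H} {M : Type*} [TopologicalSpace M] [ChartedSpace H M]
  {E' : Type*} [NormedAddCommGroup E'] [NormedSpace ℝ E'] {H' : Type*} [TopologicalSpace H']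
  {J : ModelWithCorners ℝ E' H'} {N : Type*} [TopologicalSpace N] [ChartedSpace H' N]

/-- A diffeomorphism preserving the image of an embedding restricts to the source. -/
theorem exists_diffeomorph_restrict {f : M → N} {g : N → M} (hf : ContMDiff I J ∞ f)
    (hg : ContMDiffOn J I ∞ g (range f)) (hgf : ∀ x, g (f x) = x) (Φ : N ≃ₘ^∞⟮J, J⟯ N)
    (hΦ : ∀ z, Φ z ∈ range f ↔ z ∈ range f) :
    ∃ Ψ : M ≃ₘ^∞⟮I, I⟯ M, ∀ x, f (Ψ x) = Φ (f x) := by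
  have hfg : ∀ z ∈ range f, f (g z) = z := by rintro _ ⟨x, rfl⟩; rw [hgf]
  have h1 : ∀ x, Φ (f x) ∈ range f := fun x => (hΦ _).2 (mem_range_self x)
  have h2 : ∀ x, Φ.symm (f x) ∈ range f := fun x => by
    rw [← hΦ, Φ.apply_symm_apply]; exact mem_range_self x
  refine ⟨{ toFun := fun x => g (Φ (f x))
            invFun := fun x => g (Φ.symm (f x))
            left_inv := fun x => by
              simp only
              rw [hfg _ (h1 x), Φ.symm_apply_apply, hgf]
            right_inv := fun x => by
              simp only
              rw [hfg _ (h2 x), Φ.apply_symm_apply, hgf]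
            contMDiff_toFun := ?_
            contMDiff_invFun := ?_ }, fun x => hfg _ (h1 x)⟩
  · rw [← contMDiffOn_univ]
    exact hg.comp (Φ.contMDiff.comp hf).contMDiffOn (fun x _ => h1 x)
  · rw [← contMDiffOn_univ]
    exact hg.comp (Φ.symm.contMDiff.comp hf).contMDiffOn (fun x _ => h2 x)

/-- A diffeomorphism of a cylinder preserving a slice restricts to the slice. -/
theorem exists_diffeomorph_slice (Φ : (M × unitInterval) ≃ₘ^∞⟮I.prod (𝓡∂ 1), I.prod (𝓡∂ 1)⟯
    (M × unitInterval)) (t : unitInterval) (h : ∀ z, (Φ z).2 = t ↔ z.2 = t) :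
    ∃ φ : M ≃ₘ^∞⟮I, I⟯ M, ∀ x, Φ (x, t) = (φ x, t) := by
  have hr : range (fun x : M => (x, t)) = {z : M × unitInterval | z.2 = t} := by
    ext z
    exact ⟨fun ⟨x, hx⟩ => hx ▸ rfl, fun hz => ⟨z.1, Prod.ext rfl hz.symm⟩⟩
  obtain ⟨φ, hφ⟩ := exists_diffeomorph_restrict (f := fun x : M => (x, t)) (g := Prod.fst)
    (contMDiff_id.prodMk contMDiff_const) contMDiff_fst.contMDiffOn (fun _ => rfl) Φ
    (fun z => by rw [hr]; exact h z)
  exact ⟨φ, fun x => (hφ x).symm⟩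

end Slice

/-- The diffeomorphism `f` is the identity on a neighbourhood of `A`. -/
def IsIdNear {X : Type*} [TopologicalSpace X] (A : Set X) (f : X → X) : Prop :=
  ∃ O, IsOpen O ∧ A ⊆ O ∧ ∀ x ∈ O, f x = x

section Boundary

variable {E : Type*} [NormedAddCommGroup E] [NormedSpace ℝ E] [FiniteDimensional ℝ E]
  {H : Type*} [TopologicalSpace H]
  {I : ModelWithCorners ℝ E H} {M : Type*} [TopologicalSpace M] [ChartedSpace H M]
  [IsManifold I ∞ M] [T2Space M] [SigmaCompactSpace M]

/-- Every diffeomorphism fixing the base of a collar is pseudo-isotopic to one which is the identity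
near the base: the germ of the inverse along the base extends, with the time as parameter. -/
theorem Collar.exists_isIdNear (K : Collar I M (Ico 0 1)) (φ : DiffRel I K.base) :
    ∃ φ' : DiffRel I K.base, PseudoIsotopic φ φ' ∧ IsIdNear K.base φ' := by
  set P : (M × unitInterval) ≃ₘ^∞⟮I.prod (𝓡∂ 1), I.prod (𝓡∂ 1)⟯ (M × unitInterval) :=
    φ.1.prodCongr (Diffeomorph.refl (𝓡∂ 1) unitInterval ∞) with hP
  have hPa : ∀ z, P z = (φ z.1, z.2) := fun z => rfl
  -- `k` is the identity at time `0` and has the germ of `φ⁻¹ × id` at time `1`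
  obtain ⟨k, ⟨N', hN'o, hN'b, hN'⟩, hk0, -, hkb, hkl, -⟩ :=
    (K.prod (𝓡∂ 1) unitInterval).exists_diffeomorph_of_germ
      P.symm.toHomeomorph.toOpenPartialHomeomorph P.symm.contMDiff.contMDiffOn
      P.contMDiff.contMDiffOn (subset_univ _)
      (fun z hz => by
        change P.symm z = z
        refine P.injective ((P.apply_symm_apply z).trans ?_)
        change z = (φ z.1, z.2)
        rw [φ.2 z.1 ⟨hz.1.1, hz.2⟩])
      (lam := fun z => (z.2 : ℝ)) (contMDiff_subtypeVal_Icc.comp contMDiff_snd)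
      (fun z => z.2.2) (fun _ _ _ _ => rfl) (fun _ _ => rfl) isOpen_univ (subset_univ _)
  have hk2 : ∀ z, (k z).2 = z.2 := fun z => Subtype.ext (hkl z)
  have hbase : ∀ x ∈ K.base, ∀ t, ((x, t) : M × unitInterval) ∈ (K.prod (𝓡∂ 1) unitInterval).base :=
    fun x hx t => ⟨⟨hx.1, mem_univ _⟩, hx.2⟩
  obtain ⟨φ₁, hφ₁⟩ := exists_diffeomorph_slice (k.trans P) 1 (fun z => by
    change (k z).2 = 1 ↔ z.2 = 1
    rw [hk2])
  have hφ₁' : ∀ x, φ₁ x = (P (k (x, 1))).1 := fun x => (congrArg Prod.fst (hφ₁ x)).symm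
  refine ⟨⟨φ₁, fun x hx => ?_⟩, ⟨k.trans P, fun x => ?_, hφ₁, fun x hx t => ?_⟩,
    {x | (x, 1) ∈ N'}, hN'o.preimage (by fun_prop), fun x hx => hN'b (hbase x hx 1),
    fun x hx => ?_⟩
  · rw [hφ₁', hkb _ (hbase x hx 1), hPa]
    exact φ.2 x hx
  · change P (k (x, 0)) = _
    rw [hk0 _ rfl, hPa]
  · change P (k (x, t)) = _
    rw [hkb _ (hbase x hx t), hPa, φ.2 x hx]
  · change φ₁ x = x
    rw [hφ₁', hN' _ hx rfl]
    exact congrArg Prod.fst (P.apply_symm_apply (x, 1))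

end Boundary

namespace MirrorDouble

variable {E : Type*} [NormedAddCommGroup E] [NormedSpace ℝ E] {H : Type*} [TopologicalSpace H]
  {E' : Type*} [NormedAddCommGroup E'] [NormedSpace ℝ E'] {H' : Type*} [TopologicalSpace H']
  {I : ModelWithCorners ℝ E H} {J : ModelWithCorners ℝ E' H'} {M N : Type*}
  [TopologicalSpace M] [ChartedSpace H M] [TopologicalSpace N] [ChartedSpace H' N]
  (D : MirrorDouble I J M N)

/-- The collar of the boundary of `M`. -/
def collar : Collar I M (Ico 0 1) := D.K.pullback D.smooth_b D.smooth_q_b D.q_b D.mem_b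

/-- The boundary of `M`, that is, the set where the two copies of `M` are glued. -/
def bdry : Set M := {x | D.b x ∈ D.K.base}

theorem base_subset_j {z : N} (hz : z ∈ D.K.base) : z ∈ range D.j :=
  (D.mem_j z hz.1).2 hz.2.le

theorem height_b_pos_iff (x : M) : 0 < D.height (D.b x) ↔ x ∉ D.bdry := by
  rw [bdry, mem_ofPred_eq, ← D.height_b_eq_zero_iff]
  exact ⟨fun h => h.ne', fun h => lt_of_le_of_ne (D.height_b_mem x).1 (Ne.symm h)⟩

theorem mem_j_of_height_nonpos {z : N} (hz : D.height z ≤ 0) : z ∈ range D.j := by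
  rcases D.cover z with ⟨x, rfl⟩ | h
  · exact D.base_subset_j ((D.height_b_eq_zero_iff x).1 (le_antisymm hz (D.height_b_mem x).1))
  · exact h

theorem isClosed_image_b_prod {X : Type*} [TopologicalSpace X] {S : Set (M × X)}
    (hS : IsClosed S) : IsClosed ((fun z : M × X => (D.b z.1, z.2)) '' S) := by
  have h : (fun z : M × X => (D.b z.1, z.2)) '' S =
      (range D.b ×ˢ univ) ∩ (fun w : N × X => (D.q w.1, w.2)) ⁻¹' S := by
    ext w
    constructor
    · rintro ⟨z, hz, rfl⟩
      refine ⟨⟨mem_range_self z.1, mem_univ _⟩, ?_⟩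
      rw [mem_preimage, D.q_b]; exact hz
    · rintro ⟨⟨h1, -⟩, h2⟩
      exact ⟨_, h2, Prod.ext (D.b_q h1) rfl⟩
  rw [h]
  refine ContinuousOn.preimage_isClosed_of_isClosed ?_ (D.isClosed_b.prod isClosed_univ) hS
  exact (D.smooth_q_b.continuousOn.comp continuousOn_fst (fun w hw => hw.1)).prodMk continuousOn_snd

theorem isClosed_image_b {S : Set M} (hS : IsClosed S) : IsClosed (D.b '' S) := by
  have h : D.b '' S = range D.b ∩ D.q ⁻¹' S := by
    ext w
    constructor
    · rintro ⟨z, hz, rfl⟩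
      exact ⟨mem_range_self z, by rwa [mem_preimage, D.q_b]⟩
    · rintro ⟨h1, h2⟩
      exact ⟨_, h2, D.b_q h1⟩
  rw [h]
  exact D.smooth_q_b.continuousOn.preimage_isClosed_of_isClosed D.isClosed_b hS

/-- The map `F` of `N` is `φ` on `b(M)` and the identity on `j(M)`. -/
def IsExtension (φ : M → M) (F : N → N) : Prop :=
  (∀ x, F (D.b x) = D.b (φ x)) ∧ ∀ z ∈ range D.j, F z = z

/-- The extension of a diffeomorphism which is the identity near the boundary is smooth. -/
theorem exists_isExtension (φ : DiffRel I D.bdry) (hφ : IsIdNear D.bdry φ) :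
    ∃ F : DiffRel J (∅ : Set N), D.IsExtension φ F := by
  obtain ⟨O, hO, hAO, hφO⟩ := hφ
  have hU' : IsOpen {z | 0 < D.height z} :=
    isOpen_lt continuous_const D.contMDiff_height.continuous
  obtain ⟨F, hF, hF'⟩ := exists_diffeomorph_transport (c := D.b) (e := D.q)
    (U := {x | 0 < D.height (D.b x)}) hU' D.smooth_b.contMDiffOn
    (D.smooth_q_b.mono (fun z hz => D.mem_b_of_height_pos hz)) (fun x hx => hx)
    (fun z (hz : 0 < D.height z) => by
      change 0 < D.height (D.b (D.q z))
      rwa [D.b_q (D.mem_b_of_height_pos hz)])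
    (fun x _ => D.q_b x) (fun z hz => D.b_q (D.mem_b_of_height_pos hz)) φ.1 (S := Oᶜ)
    (fun x hx => (D.height_b_pos_iff x).2 (fun h => hx (hAO h)))
    (fun x hx => hφO x (not_not.1 hx)) (D.isClosed_image_b hO.isClosed_compl)
  have hj : ∀ z ∈ range D.j, F z = z := fun z hz => hF' z (by
    rintro ⟨x, hx, rfl⟩
    exact hx (hAO (D.mem_base _ (mem_range_self x) hz)))
  refine ⟨⟨F, fun x hx => hx.elim⟩, fun x => ?_, hj⟩
  by_cases h : x ∈ D.bdry
  · change F (D.b x) = D.b (φ x)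
    rw [hj _ (D.base_subset_j h), φ.2 x h]
  · exact hF x ((D.height_b_pos_iff x).2 h)

/-- A pseudo-isotopy between diffeomorphisms that are the identity near the boundary can be changed
to one which is itself the identity near the boundary, and so extends to the double. -/
theorem pseudoIsotopic_extension [FiniteDimensional ℝ E] [IsManifold I ∞ M] [T2Space M]
    [SigmaCompactSpace M] {φ₀ φ₁ : DiffRel I D.bdry}
    (h₀ : IsIdNear D.bdry φ₀) (h₁ : IsIdNear D.bdry φ₁) (h : PseudoIsotopic φ₀ φ₁)
    {F₀ F₁ : DiffRel J (∅ : Set N)} (hF₀ : D.IsExtension φ₀ F₀) (hF₁ : D.IsExtension φ₁ F₁) :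
    PseudoIsotopic F₀ F₁ := by
  obtain ⟨O₀, hO₀, hAO₀, hφ₀⟩ := h₀
  obtain ⟨O₁, hO₁, hAO₁, hφ₁⟩ := h₁
  obtain ⟨Φ, hΦ0, hΦ1, hΦA⟩ := h
  have hsymm : ∀ z w, Φ z = w → Φ.symm w = z := fun z w h => by rw [← h, Φ.symm_apply_apply]
  -- composing the pseudo-isotopy with an extension `k` of the germ of its inverse along the boundary
  obtain ⟨k, ⟨N', hN'o, hN'b, hN'⟩, -, -, -, -, hkZ⟩ :=
    (D.collar.prod (𝓡∂ 1) unitInterval).exists_diffeomorph_of_germ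
      Φ.symm.toHomeomorph.toOpenPartialHomeomorph Φ.symm.contMDiff.contMDiffOn
      Φ.contMDiff.contMDiffOn (subset_univ _)
      (fun z hz => hsymm z z (hΦA z.1 ⟨hz.1.1, hz.2⟩ z.2))
      (contMDiff_const (c := (1 : ℝ))) (fun _ => ⟨zero_le_one, le_rfl⟩) (fun _ _ _ _ => rfl)
      (fun _ _ => rfl) (N := (O₀ ∩ O₁) ×ˢ univ) ((hO₀.inter hO₁).prod isOpen_univ)
      (fun z hz => ⟨⟨hAO₀ ⟨hz.1.1, hz.2⟩, hAO₁ ⟨hz.1.1, hz.2⟩⟩, mem_univ _⟩)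
  -- at the two ends the pseudo-isotopy is already the identity near the boundary
  have hkends : ∀ z : M × unitInterval, z.2 = 0 ∨ z.2 = 1 → k z = z := by
    refine hkZ {z | z.2 = 0 ∨ z.2 = 1} (fun z hz l _ => hz.1) (fun z hz => hsymm z z ?_)
    obtain ⟨h1 | h1, ⟨h2, h3⟩, -⟩ := hz
    · rw [← Prod.mk.eta (p := z), h1, hΦ0, hφ₀ _ h2]
    · rw [← Prod.mk.eta (p := z), h1, hΦ1, hφ₁ _ h3]
  set Φ' := k.trans Φ
  have hΦ'N : ∀ z ∈ N', Φ' z = z := fun z hz => by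
    change Φ (k z) = z
    rw [hN' z hz rfl]
    exact Φ.apply_symm_apply z
  have hΦ'0 : ∀ x, Φ' (x, 0) = (φ₀ x, 0) := fun x => by
    change Φ (k (x, 0)) = _
    rw [hkends _ (Or.inl rfl), hΦ0]
  have hΦ'1 : ∀ x, Φ' (x, 1) = (φ₁ x, 1) := fun x => by
    change Φ (k (x, 1)) = _
    rw [hkends _ (Or.inr rfl), hΦ1]
  have hSU : ∀ z ∈ N'ᶜ, 0 < D.height (D.b z.1) := fun z hz =>
    (D.height_b_pos_iff z.1).2 (fun h => hz (hN'b ⟨⟨h.1, mem_univ _⟩, h.2⟩))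
  have hU' : IsOpen {w : N × unitInterval | 0 < D.height w.1} :=
    isOpen_lt continuous_const D.contMDiff_height_fst.continuous
  have hcs : ContMDiff (I.prod (𝓡∂ 1)) (J.prod (𝓡∂ 1)) ∞
      (fun z : M × unitInterval => (D.b z.1, z.2)) :=
    (D.smooth_b.comp contMDiff_fst).prodMk contMDiff_snd
  have hes : ContMDiffOn (J.prod (𝓡∂ 1)) (I.prod (𝓡∂ 1)) ∞
      (fun w : N × unitInterval => (D.q w.1, w.2)) {w | 0 < D.height w.1} :=
    (D.smooth_q_b.comp contMDiff_fst.contMDiffOn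
      (fun w hw => D.mem_b_of_height_pos hw)).prodMk contMDiff_snd.contMDiffOn
  obtain ⟨Ψ, hΨ, hΨ'⟩ := exists_diffeomorph_transport
    (U := {z : M × unitInterval | 0 < D.height (D.b z.1)})
    (c := fun z : M × unitInterval => (D.b z.1, z.2))
    (e := fun w : N × unitInterval => (D.q w.1, w.2)) hU' hcs.contMDiffOn hes (fun z hz => hz)
    (fun w (hw : 0 < D.height w.1) => by
      change 0 < D.height (D.b (D.q w.1))
      rwa [D.b_q (D.mem_b_of_height_pos hw)])
    (fun z _ => Prod.ext (D.q_b z.1) rfl)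
    (fun w hw => Prod.ext (D.b_q (D.mem_b_of_height_pos hw)) rfl) Φ' (S := N'ᶜ) hSU
    (fun z hz => hΦ'N z (not_not.1 hz)) (D.isClosed_image_b_prod hN'o.isClosed_compl)
  have hend : ∀ (t : unitInterval) (φ : DiffRel I D.bdry) (F : DiffRel J (∅ : Set N)),
      D.IsExtension φ F → (∀ x, Φ' (x, t) = (φ x, t)) → ∀ w, Ψ (w, t) = (F w, t) :=
      fun t φ F hF hφ w => by
    rcases lt_or_ge 0 (D.height w) with h | h
    · obtain ⟨x, rfl⟩ := D.mem_b_of_height_pos h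
      rw [hF.1]
      refine (hΨ (x, t) h).trans ?_
      rw [hφ]
    · rw [hF.2 _ (D.mem_j_of_height_nonpos h)]
      refine hΨ' _ ?_
      rintro ⟨z, hz, hzw⟩
      have h1 := hSU z hz
      have h2 : D.b z.1 = w := congrArg Prod.fst hzw
      rw [h2] at h1
      exact h1.not_ge h
  exact ⟨Ψ, hend 0 φ₀ F₀ hF₀ hΦ'0, hend 1 φ₁ F₁ hF₁ hΦ'1, fun x hx => hx.elim⟩

end MirrorDouble

/-! ### Pushing along the bicollar -/

section Push

variable {E : Type*} [NormedAddCommGroup E] [NormedSpace ℝ E] {H : Type*} [TopologicalSpace H]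
  {J : ModelWithCorners ℝ E H} {N : Type*} [TopologicalSpace N] [ChartedSpace H N]

/-- A small multiple of a smooth function has slope less than `1` on `(-1, 1)`. -/
theorem exists_abs_mul_deriv_lt_one {ρ : ℝ → ℝ} (hρ : ContDiff ℝ ∞ ρ) :
    ∃ δ > 0, δ ≤ 1 / 10 ∧ ∀ l ∈ Ioo (-1 : ℝ) 1, |δ * deriv ρ l| < 1 := by
  obtain ⟨C, hC⟩ := (isCompact_Icc (a := (-1 : ℝ)) (b := 1)).exists_bound_of_continuousOn
    (hρ.continuous_deriv (by simp)).continuousOn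
  have hC' : 0 < |C| + 10 := by positivity
  refine ⟨1 / (|C| + 10), by positivity, ?_, fun l hl => ?_⟩
  · rw [div_le_div_iff₀ hC' (by norm_num)]; linarith [abs_nonneg C]
  · have h := (hC l ⟨hl.1.le, hl.2.le⟩).trans (le_abs_self C)
    rw [Real.norm_eq_abs] at h
    rw [abs_mul, abs_of_pos (by positivity : 0 < 1 / (|C| + 10)), one_div, inv_mul_lt_iff₀ hC']
    linarith

/-- An isotopy pushing a manifold along a bicollar towards its positive side: at time `1`, a point
is at a level below `δ` only if it started below level `0`. -/
theorem Collar.exists_push [IsManifold J ∞ N] (K : Collar J N (Ioo (-1) 1)) :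
    ∃ δ > 0, ∃ Q : (N × unitInterval) ≃ₘ^∞⟮J.prod (𝓡∂ 1), J.prod (𝓡∂ 1)⟯ (N × unitInterval),
      (∀ p, (Q p).2 = p.2) ∧ (∀ z, Q (z, 0) = (z, 0)) ∧ (∀ p, p.1 ∉ K.dom → Q p = p) ∧
      (∀ p, p.1 ∈ K.dom → (Q p).1 ∈ K.dom ∧ K.lev p.1 ≤ K.lev (Q p).1) ∧
      ∀ z ∈ K.dom, K.lev (Q (z, 1)).1 < δ → K.lev z < 0 := by
  -- at time `t` the level `l` is raised by `t * δ * ρ l`; the bump `ρ` vanishes for `5 / 6 ≤ |l|`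
  set ρ : ℝ → ℝ := fun l => cutoff (l ^ 2) with hρ
  have hρs : ContDiff ℝ ∞ ρ := contDiff_cutoff.comp (contDiff_id.pow 2)
  obtain ⟨δ, hδ, hδ', hδρ⟩ := exists_abs_mul_deriv_lt_one hρs
  have hρ0 : ∀ l, 5 / 6 ≤ |l| → ρ l = 0 := fun l hl => cutoff_of_ge (by
    rw [← sq_abs]; nlinarith)
  set m : N × unitInterval → ℝ := fun p => K.lev p.1 + p.2 * (δ * ρ (K.lev p.1)) with hm
  set K' := K.prod (𝓡∂ 1) unitInterval with hK'
  have hmem : ∀ p ∈ K'.dom, K.lev p.1 ∈ Ioo (-1 : ℝ) 1 := fun p hp => K.lev_mem _ hp.1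
  have hbd : ∀ p : N × unitInterval, 0 ≤ p.2 * (δ * ρ (K.lev p.1)) ∧
      p.2 * (δ * ρ (K.lev p.1)) ≤ 1 / 10 := fun p => by
    have h1 := p.2.2.1
    have h2 := p.2.2.2
    have h3 := cutoff_nonneg (K.lev p.1 ^ 2)
    have h4 := cutoff_le_one (K.lev p.1 ^ 2)
    refine ⟨by positivity, (mul_le_of_le_one_left (by positivity) h2).trans
      ((mul_le_of_le_one_right hδ.le h4).trans hδ')⟩
  have hmc : ∀ p ∈ K'.dom, 5 / 6 ≤ |K'.lev p| → m p = K'.lev p := fun p _ h => by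
    change K.lev p.1 + p.2 * (δ * ρ (K.lev p.1)) = K.lev p.1
    rw [hρ0 (K.lev p.1) h]; ring
  have hms : ContMDiffOn (J.prod (𝓡∂ 1)) 𝓘(ℝ, ℝ) ∞ m K'.dom := by
    have h1 : ContMDiffOn (J.prod (𝓡∂ 1)) 𝓘(ℝ, ℝ) ∞ (fun p : N × unitInterval => K.lev p.1)
        K'.dom := K'.smooth_lev
    have h2 : ContMDiffOn (J.prod (𝓡∂ 1)) 𝓘(ℝ, ℝ) ∞ (fun p : N × unitInterval => (p.2 : ℝ))
        K'.dom := (contMDiff_subtypeVal_Icc.comp contMDiff_snd).contMDiffOn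
    exact h1.add (h2.mul (contMDiffOn_const.mul (hρs.contMDiff.comp_contMDiffOn h1)))
  have hmL : MapsTo m K'.dom (Ioo (-1) 1) := fun p hp => by
    rcases le_or_gt (5 / 6) |K.lev p.1| with h | h
    · rw [hmc p hp h]; exact K'.lev_mem p hp
    · have h1 := hbd p
      rw [abs_lt] at h
      exact ⟨by simp only [hm]; linarith, by simp only [hm]; linarith⟩
  have hmm : ∀ p ∈ K'.dom, ∀ l ∈ Ioo (-1 : ℝ) 1, m (K'.mov p l) = l + p.2 * (δ * ρ l) :=
    fun p hp l hl => by
    change K.lev (K.mov p.1 l) + p.2 * (δ * ρ (K.lev (K.mov p.1 l))) = _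
    rw [K.lev_mov _ hp.1 l hl]
  obtain ⟨Q, hQ, hQ'⟩ := K'.exists_diffeomorph_fiberwise (convex_Ioo _ _)
    (by rw [interior_Ioo]; exact nonempty_Ioo.2 (by norm_num)) hms hmL
    (c₀ := 5 / 6) (by norm_num) hmc
    (fun p hp => by
      have hl := hmem p hp
      have h1 : HasDerivAt (fun l => l + (p.2 : ℝ) * (δ * ρ l))
          (1 + p.2 * (δ * deriv ρ (K.lev p.1))) (K.lev p.1) :=
        (hasDerivAt_id _).add
          ((((hρs.differentiable (by simp)) _).hasDerivAt.const_mul δ).const_mul _)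
      change 0 < derivWithin (fun l => m (K'.mov p l)) (Ioo (-1) 1) (K.lev p.1)
      rw [derivWithin_congr (hmm p hp) (hmm p hp _ hl),
        derivWithin_of_mem_nhds (Ioo_mem_nhds hl.1 hl.2), h1.deriv]
      have h2 := hδρ _ hl
      have h3 : |(p.2 : ℝ) * (δ * deriv ρ (K.lev p.1))| < 1 := by
        rw [abs_mul, abs_of_nonneg p.2.2.1]
        exact (mul_le_of_le_one_left (abs_nonneg _) p.2.2.2).trans_lt h2
      linarith [(abs_lt.1 h3).1])
    (fun p hp η hη => by
      have h5 : ∀ l, 5 / 6 ≤ |l| → l ∈ Ioo (-1 : ℝ) 1 → m (K'.mov p l) = l := fun l h h' => by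
        rw [hmm p hp l h', hρ0 l h]; ring
      have ha : min η (-5 / 6) ∈ Ioo (-1 : ℝ) 1 :=
        ⟨lt_min hη.1 (by norm_num), (min_le_left _ _).trans_lt hη.2⟩
      have hb : max η (5 / 6) ∈ Ioo (-1 : ℝ) 1 :=
        ⟨hη.1.trans_le (le_max_left _ _), max_lt hη.2 (by norm_num)⟩
      refine ⟨_, ha, _, hb, ?_, ?_⟩
      · rw [h5 _ _ ha]
        · exact min_le_left _ _
        · have : min η (-5 / 6 : ℝ) ≤ -5 / 6 := min_le_right _ _
          rw [abs_of_nonpos (by linarith)]; linarith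
      · rw [h5 _ _ hb]
        · exact le_max_left _ _
        · exact (le_max_right _ _).trans (le_abs_self _))
  have hdom : ∀ p : N × unitInterval, p.1 ∈ K.dom → p ∈ K'.dom := fun p hp => ⟨hp, mem_univ _⟩
  have hQ1 : ∀ p, p.1 ∈ K.dom → Q p = (K.mov p.1 (m p), p.2) := fun p hp => hQ p (hdom p hp)
  have hQ0 : ∀ p, p.1 ∉ K.dom → Q p = p := fun p hp => hQ' p (fun h => hp h.1)
  have hlev : ∀ p, p.1 ∈ K.dom → K.lev (Q p).1 = m p := fun p hp => by
    rw [hQ1 p hp]; exact K.lev_mov _ hp _ (hmL (hdom p hp))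
  refine ⟨δ, hδ, Q, fun p => ?_, fun z => ?_, hQ0, fun p hp => ⟨?_, ?_⟩, fun z hz h => ?_⟩
  · by_cases hp : p.1 ∈ K.dom
    · rw [hQ1 p hp]
    · rw [hQ0 p hp]
  · by_cases hz : z ∈ K.dom
    · rw [hQ1 _ hz]
      have : m (z, 0) = K.lev z := by simp [hm]
      rw [this, K.mov_lev z hz]
    · exact hQ0 _ hz
  · rw [hQ1 p hp]; exact K.mov_mem _ hp _ (hmL (hdom p hp))
  · rw [hlev p hp]; simp only [hm]; linarith [(hbd p).1]
  · rw [hlev _ hz] at h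
    by_contra h0
    rw [not_lt] at h0
    have h1 := (hbd (z, 1)).1
    simp only [hm, Icc.coe_one, one_mul] at h h1
    rcases le_or_gt (K.lev z) (1 / 2) with h2 | h2
    · have : ρ (K.lev z) = 1 := cutoff_of_le (by nlinarith)
      rw [this] at h
      linarith
    · linarith

end Push

namespace MirrorDouble

variable {E : Type*} [NormedAddCommGroup E] [NormedSpace ℝ E] {H : Type*} [TopologicalSpace H]
  {E' : Type*} [NormedAddCommGroup E'] [NormedSpace ℝ E'] {H' : Type*} [TopologicalSpace H']
  {I : ModelWithCorners ℝ E H} {J : ModelWithCorners ℝ E' H'} {M N : Type*}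
  [TopologicalSpace M] [ChartedSpace H M] [TopologicalSpace N] [ChartedSpace H' N]
  (D : MirrorDouble I J M N)

/-- If `φ` extends by the identity to a diffeomorphism of `N`, then conjugating the extension by the
push along the bicollar gives a pseudo-isotopy to an extension of a diffeomorphism which is the
identity near the boundary. -/
theorem exists_isExtension_isIdNear [IsManifold J ∞ N] {φ : DiffRel I D.bdry}
    {F : DiffRel J (∅ : Set N)} (hF : D.IsExtension φ F) :
    ∃ (φ' : DiffRel I D.bdry) (F' : DiffRel J (∅ : Set N)), D.IsExtension φ' F' ∧
      PseudoIsotopic φ φ' ∧ PseudoIsotopic F F' ∧ IsIdNear D.bdry φ' := by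
  obtain ⟨δ, hδ, Q, hQ2, hQ0, hQout, hQin, hQ1⟩ := D.K.exists_push
  set P : (N × unitInterval) ≃ₘ^∞⟮J.prod (𝓡∂ 1), J.prod (𝓡∂ 1)⟯ (N × unitInterval) :=
    F.1.prodCongr (Diffeomorph.refl (𝓡∂ 1) unitInterval ∞) with hP
  have hPa : ∀ p, P p = (F p.1, p.2) := fun p => rfl
  set Φ := (Q.symm.trans P).trans Q
  have hΦ : ∀ w, Φ w = Q (P (Q.symm w)) := fun w => rfl
  have hΦfix : ∀ w, (Q.symm w).1 ∈ range D.j → Φ w = w := fun w hw => by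
    rw [hΦ, hPa, hF.2 _ hw]
    exact Q.apply_symm_apply w
  -- the inverse of the push lowers levels, and so it preserves `j(M)`
  have hΦj : ∀ w : N × unitInterval, w.1 ∈ range D.j → Φ w = w := fun w hw => hΦfix w (by
    obtain ⟨p, rfl⟩ : ∃ p, Q p = w := ⟨_, Q.apply_symm_apply w⟩
    rw [Q.symm_apply_apply]
    by_cases hp : p.1 ∈ D.K.dom
    · obtain ⟨h1, h2⟩ := hQin p hp
      exact (D.mem_j _ hp).2 (h2.trans ((D.mem_j _ h1).1 hw))
    · rwa [hQout p hp] at hw)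
  have hΦ2 : ∀ w, (Φ w).2 = w.2 := fun w => by
    rw [hΦ, hQ2, hPa]
    change (Q.symm w).2 = w.2
    rw [← hQ2, Q.apply_symm_apply]
  have hΦ0 : ∀ z, Φ (z, 0) = (F z, 0) := fun z => by
    have : Q.symm (z, 0) = (z, 0) := by
      conv_lhs => rw [← hQ0 z]
      exact Q.symm_apply_apply _
    rw [hΦ, this, hPa, hQ0]
  have hcr : ∀ w : N × unitInterval, w ∈ range (fun z : M × unitInterval => (D.b z.1, z.2)) ↔
      w.1 ∈ range D.b := fun w =>
    ⟨fun ⟨z, hz⟩ => ⟨z.1, congrArg Prod.fst hz⟩, fun ⟨x, hx⟩ => ⟨(x, w.2), Prod.ext hx rfl⟩⟩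
  have hΦb : ∀ w, (Φ w).1 ∈ range D.b ↔ w.1 ∈ range D.b := fun w => by
    rcases D.cover w.1 with h1 | h1
    · refine iff_of_true ?_ h1
      refine (D.cover (Φ w).1).elim id (fun h2 => ?_)
      have h3 : Φ w = w := Φ.injective (hΦj _ h2)
      rwa [h3]
    · rw [hΦj w h1]
  obtain ⟨Ψ, hΨ⟩ := exists_diffeomorph_restrict (I := I.prod (𝓡∂ 1)) (J := J.prod (𝓡∂ 1))
    (f := fun z : M × unitInterval => (D.b z.1, z.2))
    (g := fun w : N × unitInterval => (D.q w.1, w.2))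
    ((D.smooth_b.comp contMDiff_fst).prodMk contMDiff_snd)
    ((D.smooth_q_b.comp contMDiffOn_fst (fun w hw => (hcr w).1 hw)).prodMk contMDiffOn_snd)
    (fun z => Prod.ext (D.q_b z.1) rfl) Φ (fun w => by rw [hcr, hcr, hΦb])
  have hΨ' : ∀ z p, Φ (D.b z.1, z.2) = (D.b p, z.2) → Ψ z = (p, z.2) := fun z p h => by
    obtain ⟨h1, h2⟩ := Prod.mk.inj ((hΨ z).trans h)
    refine Prod.ext ?_ h2
    rw [← D.q_b (Ψ z).1, h1, D.q_b]
  have hΨA : ∀ x ∈ D.bdry, ∀ t, Ψ (x, t) = (x, t) := fun x hx t =>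
    hΨ' _ _ (hΦj _ (D.base_subset_j hx))
  obtain ⟨F', hF'⟩ := exists_diffeomorph_slice Φ 1 (fun w => by rw [hΦ2])
  obtain ⟨φ', hφ'⟩ := exists_diffeomorph_slice Ψ 1 (fun z => by
    rw [congrArg Prod.snd (hΨ z), hΦ2])
  have hext : ∀ x, F' (D.b x) = D.b (φ' x) := fun x => by
    have h := hΨ (x, 1)
    rw [hφ', hF'] at h
    exact (congrArg Prod.fst h).symm
  refine ⟨⟨φ', fun x hx => ?_⟩, ⟨F', fun z hz => hz.elim⟩, ⟨hext, fun z hz => ?_⟩,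
    ⟨Ψ, fun x => hΨ' _ _ ?_, hφ', hΨA⟩, ⟨Φ, hΦ0, hF', fun z hz => hz.elim⟩,
    {x | D.b x ∈ {z | z ∈ D.K.dom ∧ D.K.lev z < δ}}, ?_, fun x hx => ⟨hx.1, hx.2.trans_lt hδ⟩,
    fun x hx => ?_⟩
  · exact congrArg Prod.fst ((hφ' x).symm.trans (hΨA x hx 1))
  · exact congrArg Prod.fst ((hF' z).symm.trans (hΦj (z, 1) hz))
  · change Φ (D.b x, 0) = _
    rw [hΦ0, hF.1]
  · exact (D.K.smooth_lev.continuousOn.isOpen_inter_preimage D.K.isOpen_dom isOpen_Iio).preimage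
      D.smooth_b.continuous
  -- at time `1` the points of level below `δ` come from `j(M)`, where `F` is the identity
  · have h1 : Φ (D.b x, 1) = (D.b x, 1) := hΦfix _ (by
      obtain ⟨p, hp⟩ : ∃ p, Q p = (D.b x, 1) := ⟨_, Q.apply_symm_apply _⟩
      have hp2 : p = (p.1, 1) := Prod.ext rfl (by rw [← hQ2, hp])
      rw [← hp, Q.symm_apply_apply]
      have hpd : p.1 ∈ D.K.dom := by
        by_contra h
        rw [hQout p h] at hp
        exact h (hp ▸ hx.1)
      refine (D.mem_j _ hpd).2 (hQ1 _ hpd ?_).le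
      rw [← hp2, hp]
      exact hx.2)
    exact congrArg Prod.fst ((hφ' x).symm.trans (hΨ' _ _ h1))

end MirrorDouble

/-! ### Pseudo-isotopies on the double and on the manifold -/

/-- A pseudo-isotopy from `F` to the identity can be changed to one which is a product near the two
ends. -/
theorem PseudoIsotopic.exists_product_near_ends {E : Type*} [NormedAddCommGroup E]
    [NormedSpace ℝ E] [FiniteDimensional ℝ E] {H : Type*} [TopologicalSpace H]
    {J : ModelWithCorners ℝ E H} {N : Type*} [TopologicalSpace N] [ChartedSpace H N]
    [IsManifold J ∞ N] [T2Space N] [SigmaCompactSpace N] {A : Set N} {F : DiffRel J A}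
    (h : PseudoIsotopic F 1) :
    ∃ Θ : (N × unitInterval) ≃ₘ^∞⟮J.prod (𝓡∂ 1), J.prod (𝓡∂ 1)⟯ (N × unitInterval),
      (∃ U, IsOpen U ∧ (∀ z, (z, 0) ∈ U) ∧ ∀ p ∈ U, Θ p = (F p.1, p.2)) ∧
      ∃ V, IsOpen V ∧ (∀ z, (z, 1) ∈ V) ∧ ∀ p ∈ V, Θ p = p := by
  obtain ⟨Φ, hΦ0, hΦ1, -⟩ := h
  have hsymm : ∀ (Φ : (N × unitInterval) ≃ₘ^∞⟮J.prod (𝓡∂ 1), J.prod (𝓡∂ 1)⟯ (N × unitInterval))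
      (z w), Φ z = w → Φ.symm w = z := fun Φ z w h => by rw [← h, Φ.symm_apply_apply]
  set P : (N × unitInterval) ≃ₘ^∞⟮J.prod (𝓡∂ 1), J.prod (𝓡∂ 1)⟯ (N × unitInterval) :=
    F.1.prodCongr (Diffeomorph.refl (𝓡∂ 1) unitInterval ∞)
  have hP : ∀ p, P p = (F p.1, p.2) := fun p => rfl
  have hlow : IsOpen {p : N × unitInterval | (p.2 : ℝ) < 1 / 2} :=
    isOpen_lt (by fun_prop) continuous_const
  -- straighten the bottom with the germ of `Φ⁻¹ ∘ (F × id)`, then the top with that of the inverse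
  obtain ⟨k, ⟨U, hUo, hUb, hU⟩, -, hk, -, -, -⟩ :=
    (Collar.bottom J N).exists_diffeomorph_of_germ
      (P.trans Φ.symm).toHomeomorph.toOpenPartialHomeomorph
      (P.trans Φ.symm).contMDiff.contMDiffOn (P.trans Φ.symm).symm.contMDiff.contMDiffOn
      (subset_univ _)
      (fun p hp => by
        have hp2 : p.2 = 0 := Subtype.ext hp.2
        refine hsymm Φ p (P p) ?_
        rw [← Prod.mk.eta (p := p), hp2, hΦ0, hP])
      (contMDiff_const (c := (1 : ℝ))) (fun _ => ⟨zero_le_one, le_rfl⟩) (fun _ _ _ _ => rfl)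
      (fun _ _ => rfl) hlow (fun p hp => by
        have hp2 : (p.2 : ℝ) = 0 := hp.2
        rw [mem_ofPred_eq, hp2]; norm_num)
  set Φ' := k.trans Φ
  have hΦ' : ∀ p, Φ' p = Φ (k p) := fun _ => rfl
  obtain ⟨l, ⟨V, hVo, hVb, hV⟩, -, hl, -, -, -⟩ :=
    (Collar.top J N).exists_diffeomorph_of_germ
      Φ'.symm.toHomeomorph.toOpenPartialHomeomorph
      Φ'.symm.contMDiff.contMDiffOn Φ'.contMDiff.contMDiffOn
      (subset_univ _)
      (fun p hp => by
        have hp2 : p.2 = 1 := Subtype.ext (sub_eq_zero.1 hp.2).symm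
        refine hsymm Φ' p p ?_
        rw [hΦ', hk p (by rw [mem_ofPred_eq, hp2]; norm_num), ← Prod.mk.eta (p := p), hp2, hΦ1]
        rfl)
      (contMDiff_const (c := (1 : ℝ))) (fun _ => ⟨zero_le_one, le_rfl⟩) (fun _ _ _ _ => rfl)
      (fun _ _ => rfl) (N := {p | (1 / 2 : ℝ) < p.2}) (isOpen_lt continuous_const (by fun_prop))
      (fun p hp => by
        have hp2 : (p.2 : ℝ) = 1 := (sub_eq_zero.1 hp.2).symm
        rw [mem_ofPred_eq, hp2]; norm_num)
  refine ⟨l.trans Φ', ⟨U ∩ {p | (p.2 : ℝ) < 1 / 2}, hUo.inter hlow, fun z => ⟨hUb ⟨?_, ?_⟩, ?_⟩,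
    fun p hp => ?_⟩, V, hVo, fun z => hVb ⟨?_, ?_⟩, fun p hp => ?_⟩
  · change ((0 : unitInterval) : ℝ) < 1
    simp
  · rfl
  · change ((0 : unitInterval) : ℝ) < 1 / 2
    simp
  · change Φ (k (l p)) = _
    rw [hl p (fun h : (1 / 2 : ℝ) < p.2 => lt_asymm h hp.2), hU p hp.1 rfl]
    exact Φ.apply_symm_apply (P p)
  · change (0 : ℝ) < ((1 : unitInterval) : ℝ)
    simp
  · change 1 - ((1 : unitInterval) : ℝ) = 0
    simp
  · change Φ' (l p) = _
    rw [hV p hp rfl]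
    exact Φ'.apply_symm_apply p

namespace MirrorDouble

section

variable {E : Type*} [NormedAddCommGroup E] [NormedSpace ℝ E] {H : Type*} [TopologicalSpace H]
  {E' : Type*} [NormedAddCommGroup E'] [NormedSpace ℝ E'] [FiniteDimensional ℝ E']
  {H' : Type*} [TopologicalSpace H']
  {I : ModelWithCorners ℝ E H} {J : ModelWithCorners ℝ E' H'} {M N : Type*}
  [TopologicalSpace M] [ChartedSpace H M] [TopologicalSpace N] [ChartedSpace H' N]
  [IsManifold J ∞ N] [T2Space N] [SigmaCompactSpace N]
  (D : MirrorDouble I J M N)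

/-- A pseudo-isotopy on the double from the extension of `φ` to the identity gives a pseudo-isotopy
on `M` from `φ` to the identity: made a product near the ends, it is supported where the bend map,
which carries `b(M) × 0` to `M × 0`, is a diffeomorphism. -/
theorem pseudoIsotopic_one_of_extension {φ : DiffRel I D.bdry} (hφ : IsIdNear D.bdry φ)
    {F : DiffRel J (∅ : Set N)} (hF : D.IsExtension φ F) (h : PseudoIsotopic F 1) :
    PseudoIsotopic φ 1 := by
  obtain ⟨O, hO, hAO, hφO⟩ := hφ
  obtain ⟨Θ, ⟨U, hUo, hU0, hU⟩, V, hVo, hV1, hV⟩ := h.exists_product_near_ends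
  have hWo : IsOpen {p : N × unitInterval | p.1 ∉ D.b '' Oᶜ} :=
    (D.isClosed_image_b hO.isClosed_compl).isOpen_compl.preimage continuous_fst
  -- the support of `Θ` is disjoint from the top, and meets the bottom in `b(M)`, away from the
  -- boundary
  have hfix : ∀ z ∉ D.b '' Oᶜ, F z = z := fun z hz => by
    rcases D.cover z with ⟨x, rfl⟩ | h1
    · rw [hF.1, hφO x (by_contra fun h => hz ⟨x, h, rfl⟩)]
    · exact hF.2 z h1
  obtain ⟨Ψ, hΨ, hΨ'⟩ := D.exists_bent_diffeomorph Θ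
    (S := ((U ∩ {p : N × unitInterval | p.1 ∉ D.b '' Oᶜ}) ∪ V)ᶜ)
    ((hUo.inter hWo).union hVo).isClosed_compl
    (fun p hp => by
      have h1 : p.2 ≠ 1 := fun h => hp (Or.inr (by
        rw [← Prod.mk.eta (p := p), h]; exact hV1 p.1))
      refine ⟨lt_of_le_of_ne p.2.2.2 (fun h => h1 (Subtype.ext h)), ?_⟩
      rcases p.2.2.1.eq_or_lt with h0 | h0
      · have h0' : p.2 = 0 := Subtype.ext h0.symm
        have hpU : p ∈ U := by rw [← Prod.mk.eta (p := p), h0']; exact hU0 p.1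
        obtain ⟨x, hx, hxp⟩ : p.1 ∈ D.b '' Oᶜ := by_contra fun h => hp (Or.inl ⟨hpU, h⟩)
        right
        rw [← hxp, D.height_b_pos_iff]
        exact fun h => hx (hAO h)
      · exact Or.inl h0)
    (fun p hp => by
      rcases not_not.1 hp with ⟨h1, h2⟩ | h1
      · rw [hU p h1, hfix _ h2]
      · exact hV p h1)
  have hΨA : ∀ x ∈ D.bdry, ∀ t, Ψ (x, t) = (x, t) := fun x hx t => hΨ' _ (fun h => by
    have h1 := h.1
    rw [(D.height_b_eq_zero_iff x).2 hx] at h1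
    linarith [t.2.1])
  refine ⟨Ψ, fun x => ?_, fun x => hΨ' _ (fun h => ?_), hΨA⟩
  · by_cases hx : x ∈ D.bdry
    · rw [hΨA x hx, φ.2 x hx]
    · have h1 := (D.height_b_pos_iff x).2 hx
      have h2 : φ x ∉ D.bdry := fun h => hx (by
        have h3 : φ x = x := φ.1.injective (φ.2 _ h)
        rwa [h3] at h)
      rw [← D.bend_bottom h1, hΨ _ ⟨by simp, Or.inr h1⟩, hU _ (hU0 _), hF.1,
        D.bend_bottom ((D.height_b_pos_iff _).2 h2)]
  · have h1 := h.1
    have h2 := (D.height_b_mem x).2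
    simp only [Icc.coe_one] at h1
    linarith

end

variable {E : Type*} [NormedAddCommGroup E] [NormedSpace ℝ E] [FiniteDimensional ℝ E]
  {H : Type*} [TopologicalSpace H]
  {E' : Type*} [NormedAddCommGroup E'] [NormedSpace ℝ E']
  {H' : Type*} [TopologicalSpace H']
  {I : ModelWithCorners ℝ E H} {J : ModelWithCorners ℝ E' H'} {M N : Type*}
  [TopologicalSpace M] [ChartedSpace H M] [TopologicalSpace N] [ChartedSpace H' N]
  [IsManifold I ∞ M] [T2Space M] [SigmaCompactSpace M]
  (D : MirrorDouble I J M N)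

/-- Every class contains a diffeomorphism with a smooth extension. -/
theorem exists_pseudoIsotopic_isExtension (φ : DiffRel I D.bdry) :
    ∃ (φ' : DiffRel I D.bdry) (F : DiffRel J (∅ : Set N)),
      PseudoIsotopic φ' φ ∧ D.IsExtension φ' F := by
  obtain ⟨φ', h1, h2⟩ := D.collar.exists_isIdNear φ
  obtain ⟨F, hF⟩ := D.exists_isExtension φ' h2
  exact ⟨φ', F, h1.symm, hF⟩

variable [IsManifold J ∞ N]

/-- The class of the extension depends only on the class of the diffeomorphism. -/
theorem pseudoIsotopic_of_isExtension {φ₀ φ₁ : DiffRel I D.bdry} {F₀ F₁ : DiffRel J (∅ : Set N)}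
    (h : PseudoIsotopic φ₀ φ₁) (h₀ : D.IsExtension φ₀ F₀) (h₁ : D.IsExtension φ₁ F₁) :
    PseudoIsotopic F₀ F₁ := by
  obtain ⟨φ₀', F₀', he₀, hφ₀, hF₀, hn₀⟩ := D.exists_isExtension_isIdNear h₀
  obtain ⟨φ₁', F₁', he₁, hφ₁, hF₁, hn₁⟩ := D.exists_isExtension_isIdNear h₁
  exact (hF₀.trans
    (D.pseudoIsotopic_extension hn₀ hn₁ ((hφ₀.symm.trans h).trans hφ₁) he₀ he₁)).trans hF₁.symm

variable [FiniteDimensional ℝ E'] [T2Space N] [SigmaCompactSpace N]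

/-- The kernel of the extension map on classes is trivial. -/
theorem pseudoIsotopic_one_iff {φ : DiffRel I D.bdry} {F : DiffRel J (∅ : Set N)}
    (hF : D.IsExtension φ F) : PseudoIsotopic F 1 ↔ PseudoIsotopic φ 1 := by
  refine ⟨fun h => ?_, fun h => D.pseudoIsotopic_of_isExtension h hF ⟨fun _ => rfl, fun _ _ => rfl⟩⟩
  obtain ⟨φ', F', he, hφ, hF', hn⟩ := D.exists_isExtension_isIdNear hF
  exact hφ.trans (D.pseudoIsotopic_one_of_extension hn he (hF'.symm.trans h))

/-- Extension by the identity defines an injective homomorphism of groups of pseudo-isotopy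
classes. -/
theorem exists_monoidHom :
    (∀ c : (pseudoIsotopyCon I D.bdry).Quotient, ∃ (φ : DiffRel I D.bdry)
      (F : DiffRel J (∅ : Set N)), (pseudoIsotopyCon I D.bdry).mk' φ = c ∧ D.IsExtension φ F) ∧
    ∃ w : (pseudoIsotopyCon I D.bdry).Quotient →* (pseudoIsotopyCon J (∅ : Set N)).Quotient,
      (∀ (φ : DiffRel I D.bdry) (F : DiffRel J (∅ : Set N)), D.IsExtension φ F →
        w ((pseudoIsotopyCon I D.bdry).mk' φ) = (pseudoIsotopyCon J (∅ : Set N)).mk' F) ∧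
      Function.Injective w := by
  have hI : ∀ φ ψ : DiffRel I D.bdry, (pseudoIsotopyCon I D.bdry).mk' φ =
      (pseudoIsotopyCon I D.bdry).mk' ψ ↔ PseudoIsotopic φ ψ := fun _ _ => Con.eq _
  have hJ : ∀ F G : DiffRel J (∅ : Set N), (pseudoIsotopyCon J (∅ : Set N)).mk' F =
      (pseudoIsotopyCon J (∅ : Set N)).mk' G ↔ PseudoIsotopic F G := fun _ _ => Con.eq _
  have hex : ∀ c : (pseudoIsotopyCon I D.bdry).Quotient, ∃ (φ : DiffRel I D.bdry)
      (F : DiffRel J (∅ : Set N)), (pseudoIsotopyCon I D.bdry).mk' φ = c ∧ D.IsExtension φ F :=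
    fun c => by
    obtain ⟨φ, rfl⟩ := Con.mk'_surjective c
    obtain ⟨φ', F, h1, h2⟩ := D.exists_pseudoIsotopic_isExtension φ
    exact ⟨φ', F, (hI _ _).2 h1, h2⟩
  refine ⟨hex, ?_⟩
  choose φ F hφ hF using hex
  have hw : ∀ (c) (ψ : DiffRel I D.bdry) (G : DiffRel J (∅ : Set N)),
      (pseudoIsotopyCon I D.bdry).mk' ψ = c → D.IsExtension ψ G →
      (pseudoIsotopyCon J (∅ : Set N)).mk' (F c) = (pseudoIsotopyCon J (∅ : Set N)).mk' G :=
    fun c ψ G h hG => (hJ _ _).2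
      (D.pseudoIsotopic_of_isExtension ((hI _ _).1 ((hφ c).trans h.symm)) (hF c) hG)
  refine ⟨MonoidHom.mk' (fun c => (pseudoIsotopyCon J (∅ : Set N)).mk' (F c)) (fun c d => ?_),
    fun ψ G hG => hw _ ψ G rfl hG, (injective_iff_map_eq_one _).2 (fun c hc => ?_)⟩
  · rw [← map_mul]
    refine hw _ (φ c * φ d) _ (by rw [map_mul, hφ, hφ]) ⟨fun x => ?_, fun z hz => ?_⟩
    · rw [DiffRel.mul_apply, (hF d).1, (hF c).1, DiffRel.mul_apply]
    · rw [DiffRel.mul_apply, (hF d).2 z hz, (hF c).2 z hz]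
  · rw [← hφ c, ← map_one (pseudoIsotopyCon I D.bdry).mk', hI, ← D.pseudoIsotopic_one_iff (hF c),
      ← hJ, map_one]
    exact hc

end MirrorDouble

/-! ### The double of a manifold with boundary -/

section Double

variable {n : ℕ} [NeZero n] {M : Type*} [TopologicalSpace M] [T2Space M]
  [SecondCountableTopology M] [ChartedSpace (EuclideanHalfSpace n) M] [IsManifold (𝓡∂ n) ∞ M]
  [ChartedSpace (EuclideanSpace ℝ (Fin n)) (Double n M)]

/-- A smooth structure on the double of `M` is that of a mirror double, for the given inclusion of
`M × 0`. -/
theorem IsDoubleSmoothStructure.exists_mirrorDouble (hD : IsDoubleSmoothStructure n M) :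
    ∃ D : MirrorDouble (𝓡∂ n) (𝓡 n) M (Double n M), D.b = Double.bottom n ∧
      range D.j = Double.upper n M ∧ D.bdry = (𝓡∂ n).boundary M := by
  have := hD.isManifold
  have hb := hD.bottom
  obtain ⟨j, hj, hju, hjb⟩ := hD.upper
  have : LocallyCompactSpace (EuclideanHalfSpace n) := (𝓡∂ n).locallyCompactSpace
  have : LocallyCompactSpace M := ChartedSpace.locallyCompactSpace (EuclideanHalfSpace n) M
  have : LocallyCompactSpace (Double n M) :=
    ChartedSpace.locallyCompactSpace (EuclideanSpace ℝ (Fin n)) (Double n M)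
  have hbr : range (Double.bottom n : M → Double n M) = {p | p.1.2 = 0} := by
    ext p
    refine ⟨?_, fun h => ⟨p.1.1, Subtype.ext (Prod.ext rfl ?_)⟩⟩
    · rintro ⟨x, rfl⟩; rfl
    · exact h.symm
  have hclb : IsClosed (range (Double.bottom n : M → Double n M)) := by
    rw [hbr]
    exact isClosed_eq (by fun_prop) continuous_const
  have hclj : IsClosed (range j) := by
    rw [hju]
    exact (((𝓡∂ n).isClosed_boundary (M := M) (n := ∞) (by simp)).preimage
      (by fun_prop : Continuous fun p : Double n M => p.1.1)).union
        (isClosed_eq (by fun_prop : Continuous fun p : Double n M => p.1.2) continuous_const)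
  have hcov : ∀ z, z ∈ range (Double.bottom n : M → Double n M) ∨ z ∈ range j := fun z => by
    rw [hbr, hju]
    rcases mem_boundary_prod_unitInterval.1 z.2 with h | h | h
    · exact Or.inr (Or.inl h)
    · exact Or.inl h
    · exact Or.inr (Or.inr h)
  have hinj : Function.Injective (Double.bottom n : M → Double n M) := hb.isEmbedding.injective
  have hbu : ∀ x : M, Double.bottom n x ∈ range j ↔ x ∈ (𝓡∂ n).boundary M := fun x => by
    rw [hju]
    refine ⟨fun h => h.resolve_right (fun h1 => ?_), Or.inl⟩
    exact zero_ne_one (α := unitInterval) h1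
  obtain ⟨K, hKA, hKb⟩ := (hb.isSmoothDomain hclb).exists_bicollar
  have hbK : ∀ x : M, Double.bottom n x ∈ K.base ↔ x ∈ (𝓡∂ n).boundary M := fun x => by
    rw [hKA, hinj.mem_set_image]
  have hinv : ∀ f : M → Double n M, Function.Injective f → ∃ g : Double n M → M, ∀ x, g (f x) = x :=
    fun f hf => by
    rcases isEmpty_or_nonempty M with h | h
    · exact ⟨fun z => z.1.1, fun x => isEmptyElim x⟩
    · exact ⟨Function.invFun f, Function.leftInverse_invFun hf⟩
  obtain ⟨gb, hgb⟩ := hinv _ hinj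
  obtain ⟨gj, hgj⟩ := hinv j hj.isEmbedding.injective
  obtain ⟨D, h1, h2, h3⟩ := _root_.exists_mirrorDouble hb.contMDiff hj.contMDiff
    (hb.contMDiffOn_leftInverse hgb) (hj.contMDiffOn_leftInverse hgj) hgb hgj hclb hclj hcov K hKb
    (fun z hz => by
      rcases lt_or_ge (K.lev z) 0 with h | h
      · exact iff_of_true ((hcov z).resolve_left (fun h1 => h.not_ge ((hKb z hz).1 h1))) h.le
      · obtain ⟨x, rfl⟩ := (hKb z hz).2 h
        rw [hbu, ← hbK]
        exact ⟨fun h1 => h1.2.le, fun h1 => ⟨hz, le_antisymm h1 h⟩⟩)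
    (by
      rintro _ ⟨x, rfl⟩ h
      rwa [hbK, ← hbu])
    (fun x hx => hjb x ((hbK x).1 hx))
  refine ⟨D, h1, h2.trans hju, ?_⟩
  ext x
  rw [MirrorDouble.bdry, mem_ofPred_eq, h1, h3, hbK]

end Double

theorem proposition1 (n : ℕ) [NeZero n] (M : Type*) [TopologicalSpace M] [T2Space M]
    [SecondCountableTopology M] [ChartedSpace (EuclideanHalfSpace n) M] [IsManifold (𝓡∂ n) ∞ M]
    (hM : ((𝓡∂ n).boundary M).Nonempty)
    [ChartedSpace (EuclideanSpace ℝ (Fin n)) (Double n M)]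
    (hD : IsDoubleSmoothStructure n M) :
    (∀ c : RelMappingClassGroup n M, ∃ (φ : DiffRelBoundary n M) (F : DiffAll n (Double n M)),
      relClass φ = c ∧ IsExtensionById φ F) ∧
    ∃ w : RelMappingClassGroup n M →* MappingClassGroup n (Double n M),
      (∀ (φ : DiffRelBoundary n M) (F : DiffAll n (Double n M)),
        IsExtensionById φ F → w (relClass φ) = diffClass F) ∧
      Function.Injective w := by
  have := hD.isManifold
  have : LocallyCompactSpace (EuclideanHalfSpace n) := (𝓡∂ n).locallyCompactSpace
  have : LocallyCompactSpace M := ChartedSpace.locallyCompactSpace (EuclideanHalfSpace n) M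
  have : LocallyCompactSpace (Double n M) :=
    ChartedSpace.locallyCompactSpace (EuclideanSpace ℝ (Fin n)) (Double n M)
  obtain ⟨D, hDb, hDj, hDA⟩ := hD.exists_mirrorDouble
  have h := D.exists_monoidHom
  simp only [MirrorDouble.IsExtension, hDb, hDj] at h
  rw [hDA] at h
  exact h
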